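/- Let $K$ be a field and let $\mathcal C$ be a unital (symmetric) operad in chain complexes of $K$-modules ($\mathcal C(0)$ may be non-zero), with composition written $\gamma(x_1,\dots,x_k;y)$, where $x_i\in\mathcal C(n_i)$, $y\in\mathcal C(k)$. A DG $\mathcal C$-algebra $A$ is a chain complex with operations $\theta:A^{\otimes n}\otimes\mathcal C(n)\to A$, which are chain maps satisfying the associativity, unit and equivariance axioms. All signs are Koszul signs with the inputs written before the operation; $\sigma\in\Sigma_n$ acts on $\mathcal C(n)$ so that $\theta(a_1,\dots,a_n;\sigma c)=\pm\theta(a_{\sigma(1)},\dots,a_{\sigma(n)};c)$. Put $\gamma_i(c',c)=\gamma(1,\dots,1,c',1,\dots,1;c)$ with $c'$ in the $i$-th place. **The augmented bar construction.** $\widetilde B_{\mathcal C}(A)$ is the $K$-module generated by finite planar rooted trees whose leaves are labelled by homogeneous elements of $A$ and whose non-leaf vertices of valency $k\ge 0$ are labelled by homogeneous elements of $\mathcal C(k)$. The degree $|t|$ of such a tree is the sum of the degrees of its labels plus the number of its non-leaf vertices. Write $(c;t_1,\dots,t_k)$ for the tree with root label $c$ and successor trees $t_1,\dots,t_k$. The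 relations are linearity in each label and, at each non-leaf vertex, $(\sigma c;t_1,\dots,t_k)=\pm(c;t_{\sigma(1)},\dots,t_{\sigma(k)})$ for $\sigma\in\Sigma_k$, with the Koszul sign for permuting the $t_i$ (of degrees $|t_i|$). The differential is $d(a)=\partial a$ on a single leaf and $$d(c;t_1,\dots,t_k)=\sum_i(-1)^{|t_1|+\dots+|t_{i-1}|}(c;t_1,\dots,dt_i,\dots,t_k)+(-1)^{|t_1|+\dots+|t_k|}(\partial c;t_1,\dots,t_k)$$ $$+\sum_{i:\ t_i=(c';u_1,\dots,u_m)}(-1)^{|t_1|+\dots+|t_i|+|c'|(|t_{i+1}|+\dots+|t_k|)}(\gamma_i(c',c);t_1,\dots,t_{i-1},u_1,\dots,u_m,t_{i+1},\dots,t_k)+\ell,$$ where $\ell=(-1)^{|a_1|+\dots+|a_k|+|c|}\,\theta(a_1,\dots,a_k;c)$ (a single leaf) if all $t_i=a_i$ are single leaves (the tree is a *bush*, or corolla; $k=0$ is allowed), and $\ell=0$ otherwise. Thus $d$ consists of the internal differentials, the contractions of edges between non-leaf vertices, and the contractions of bushes at the top of the tree to leaves. The single leaves span a subcomplex $A\subseteq\widetilde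 B_{\mathcal C}(A)$; let $B_{\mathcal C}(A)=(\widetilde B_{\mathcal C}(A)/A)[-1]$, where $X[n]_k=X_{k-n}$. **Proposition.** For every DG $\mathcal C$-algebra $A$, $d$ is well defined, has degree $-1$ and satisfies $d\circ d=0$, for the well-defined grading of $\widetilde B_{\mathcal C}(A)$ by degree. Moreover: (1) The map $\mu:B_{\mathcal C}(A)\to A$ given by $\mu(c;a_1,\dots,a_k)=\theta(a_1,\dots,a_k;c)$ on bushes and by $0$ on all other trees is a well-defined chain map. If $\mathcal C$ is $\Sigma$-cofibrant, then $\mu$ induces an isomorphism in homology. Here $\mathcal C$ is called $\Sigma$-cofibrant if each $\mathcal C(n)$ is a retract of a cell chain complex of $K[\Sigma_n]$-modules, i.e. of the colimit of a sequence $0\to X_{(0)}\to X_{(1)}\to\cdots$ in which each map is a pushout of a direct sum of inclusions $K[\Sigma_n][q]\to I[\Sigma_n][q]$, $q\in\mathbb Z$, where $I[\Sigma_n]$ is $K[\Sigma_n]\xrightarrow{=}K[\Sigma_n]$ in degrees $1,0$, and $K[\Sigma_n]$ includes in degree $0$. (2) Grafting of trees, $$\theta(y_1,\dots,y_m;x)=(-1)^{\sum_{p<q}|c_p|(|t_{q,1}|+\dots+|t_{q,k_q}|)}\,(\gamma(c_1,\dots,c_m;x);t_{1,1},\dots,t_{1,k_1},\dots,t_{m,1},\dots,t_{m,k_m})$$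 for $y_q=(c_q;t_{q,1},\dots,t_{q,k_q})$ and homogeneous $x\in\mathcal C(m)$, is well defined and makes $B_{\mathcal C}(A)$ a DG $\mathcal C$-algebra, such that $\mu$ is a map of DG $\mathcal C$-algebras. This is natural in $A$: a map $f:A\to A'$ of DG $\mathcal C$-algebras induces, by application of $f$ to the labels of the leaves, a map $B_{\mathcal C}(A)\to B_{\mathcal C}(A')$ of DG $\mathcal C$-algebras, which commutes with $\mu$ and $f$. -/

import Mathlib

open CategoryTheory CategoryTheory.Limits

universe u

noncomputable section

/-! ## Chain complexes of `K`-modules -/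

/-- `V = ⨁ gr n` is a `ℤ`-graded module and `d` is a differential of degree `-1`. -/
structure IsDG {K V : Type u} [Field K] [AddCommGroup V] [Module K V]
    (gr : ℤ → Submodule K V) (d : V →ₗ[K] V) : Prop where
  internal : DirectSum.IsInternal gr
  map_gr : ∀ {n : ℤ} {x : V}, x ∈ gr n → d x ∈ gr (n - 1)
  d_d : ∀ x, d (d x) = 0

/-- A chain complex of `K`-modules, presented as the internally graded module `⨁ gr n`. -/
structure DGMod (K : Type u) [Field K] where
  V : Type u
  [addCommGroup : AddCommGroup V]
  [module : Module K V]
  gr : ℤ → Submodule K V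
  d : V →ₗ[K] V
  isDG : IsDG gr d

attribute [instance] DGMod.addCommGroup DGMod.module

namespace DGMod

variable {K : Type u} [Field K]

/-- Chain maps. -/
structure Hom (X Y : DGMod K) where
  lin : X.V →ₗ[K] Y.V
  map_gr : ∀ {n : ℤ} {x : X.V}, x ∈ X.gr n → lin x ∈ Y.gr n
  comm : ∀ x, lin (X.d x) = Y.d (lin x)

/-- The (total) homology `ker d / im d = ⨁ Hₙ`. -/
abbrev Homology (X : DGMod K) : Type u :=
  LinearMap.ker X.d ⧸ (LinearMap.range X.d).submoduleOf (LinearMap.ker X.d)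

/-- The map induced by a chain map on cycles. -/
def Hom.cycles {X Y : DGMod K} (f : X.Hom Y) : LinearMap.ker X.d →ₗ[K] LinearMap.ker Y.d :=
  f.lin.restrict fun x hx => by
    rw [LinearMap.mem_ker] at hx ⊢
    rw [← f.comm, hx, map_zero]

/-- The map induced by a chain map on homology. -/
def Hom.homology {X Y : DGMod K} (f : X.Hom Y) : X.Homology →ₗ[K] Y.Homology :=
  Submodule.mapQ _ _ f.cycles <| by
    rintro ⟨x, hx⟩ ⟨y, hy⟩
    exact ⟨f.lin y, by rw [← f.comm, hy]; rfl⟩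

/-- An equivalence: a chain map inducing an isomorphism in homology. -/
def Hom.IsQuasiIso {X Y : DGMod K} (f : X.Hom Y) : Prop :=
  Function.Bijective f.homology

/-- The shift `X[m]`, with `X[m]ₖ = X_{k - m}`. -/
def shift (X : DGMod K) (m : ℤ) : DGMod K where
  V := X.V
  gr k := X.gr (k - m)
  d := X.d
  isDG :=
    { internal := by
        have h := X.isDG.internal
        rw [DirectSum.isInternal_submodule_iff_iSupIndep_and_iSup_eq_top] at h ⊢
        refine ⟨h.1.comp (f := fun k : ℤ => k - m) sub_left_injective, ?_⟩
        rw [← h.2]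
        exact (Equiv.subRight m).iSup_comp (g := X.gr)
      map_gr := fun {n x} hx => by
        have := X.isDG.map_gr hx
        rwa [show n - m - 1 = n - 1 - m by ring] at this
      d_d := X.isDG.d_d }

/-- The quotient of a chain complex by a subcomplex. -/
def quot (X : DGMod K) (S : Submodule K X.V) (hS : S ≤ ⨆ n, S ⊓ X.gr n)
    (hd : S ≤ S.comap X.d) : DGMod K where
  V := X.V ⧸ S
  gr n := (X.gr n).map S.mkQ
  d := S.mapQ S X.d hd
  isDG :=
    { internal := by
        have h := X.isDG.internal
        have h' := h
        rw [DirectSum.isInternal_submodule_iff_iSupIndep_and_iSup_eq_top] at h' ⊢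
        refine ⟨?_, ?_⟩
        · rw [iSupIndep_def]
          intro i
          rw [Submodule.disjoint_def]
          rintro _ ⟨x, hx, rfl⟩ hx'
          simp only [← Submodule.map_iSup] at hx'
          obtain ⟨y, hy, hxy⟩ := hx'
          rw [← sub_eq_zero, ← map_sub, Submodule.mkQ_apply, Submodule.Quotient.mk_eq_zero] at hxy
          have hz := hS hxy
          have hle : (⨆ n, S ⊓ X.gr n) ≤ (S ⊓ X.gr i) ⊔ ⨆ j, ⨆ (_ : j ≠ i), S ⊓ X.gr j := by
            refine iSup_le fun n => ?_
            by_cases hn : n = i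
            · subst hn; exact le_sup_left
            · exact le_sup_of_le_right (le_iSup₂_of_le n hn le_rfl)
          obtain ⟨a, ha, b, hb, hab⟩ := Submodule.mem_sup.1 (hle hz)
          have hb' : b ∈ ⨆ j, ⨆ (_ : j ≠ i), X.gr j :=
            (iSup₂_mono fun j _ => inf_le_right :
              (⨆ j, ⨆ (_ : j ≠ i), S ⊓ X.gr j) ≤ ⨆ j, ⨆ (_ : j ≠ i), X.gr j) hb
          have hdis := (iSupIndep_def.1 h'.1) i
          rw [Submodule.disjoint_def] at hdis
          have hax : a + x = 0 := by
            refine hdis _ (add_mem ha.2 hx) ?_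
            have : a + x = y - b := by rw [eq_sub_iff_add_eq]; rw [add_right_comm, hab]; abel
            rw [this]
            exact sub_mem hy hb'
          have : x = -a := by rw [eq_neg_iff_add_eq_zero, add_comm, hax]
          rw [Submodule.mkQ_apply, Submodule.Quotient.mk_eq_zero, this]
          exact neg_mem ha.1
        · rw [← Submodule.map_iSup, h'.2, Submodule.map_top, Submodule.range_mkQ]
      map_gr := by
        rintro n _ ⟨x, hx, rfl⟩
        exact ⟨X.d x, X.isDG.map_gr hx, rfl⟩
      d_d := by
        intro x
        obtain ⟨x, rfl⟩ := S.mkQ_surjective x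
        simp [X.isDG.d_d] }

end DGMod

/-! ## Koszul signs -/

/-- The exponent of the Koszul sign for rearranging `a₁ ⋯ aₙ` with degrees `p`
into `a_{σ 1} ⋯ a_{σ n}`. -/
def koszul {n : ℕ} (p : Fin n → ℤ) (σ : Equiv.Perm (Fin n)) : ℤ :=
  ∑ i, ∑ j, if i < j ∧ σ j < σ i then p (σ i) * p (σ j) else 0

/-- The exponent of the Koszul sign for rearranging
`b₁ ⋯ bₖ x₁ ⋯ xₖ` into `b₁ x₁ ⋯ bₖ xₖ`, with degrees `q` of `b` and `p` of `x`. -/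
def shuffle {k : ℕ} (p q : Fin k → ℤ) : ℤ :=
  ∑ i, ∑ j, if i < j then p i * q j else 0

/-! ## DG operads and their algebras -/

/-- A sequence `C(n)` of chain complexes with an action of `Σₙ` on `C(n)`. -/
structure SymSeq (K : Type u) [Field K] where
  obj : ℕ → DGMod K
  act : ∀ n, Representation K (Equiv.Perm (Fin n)) (obj n).V
  act_mem : ∀ {n : ℕ} (σ : Equiv.Perm (Fin n)) {p : ℤ} {c : (obj n).V},
    c ∈ (obj n).gr p → act n σ c ∈ (obj n).gr p
  act_d : ∀ {n : ℕ} (σ : Equiv.Perm (Fin n)) (c : (obj n).V),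
    act n σ ((obj n).d c) = (obj n).d (act n σ c)

/-- The action of a bijection `Fin n ≃ Fin m` (so that `n = m`): identify `C(n)` with `C(m)` and
act by the resulting permutation. -/
def SymSeq.relabel {K : Type u} [Field K] (C : SymSeq K) {n m : ℕ} (e : Fin n ≃ Fin m)
    (c : (C.obj n).V) : (C.obj m).V :=
  have h : n = m := Fin.equiv_iff_eq.1 ⟨e⟩
  h ▸ C.act n (e.trans (finCongr h.symm)) c

theorem sum_finSigma {k : ℕ} (m : Fin k → ℕ) (l : ∀ i, Fin (m i) → ℕ) :
    ∑ i, ∑ j, l i j =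
      ∑ s : Fin (∑ i, m i), l (finSigmaFinEquiv.symm s).1 (finSigmaFinEquiv.symm s).2 := by
  rw [← Fintype.sum_sigma']
  exact (Equiv.sum_comp finSigmaFinEquiv.symm (fun x : Σ i, Fin (m i) => l x.1 x.2)).symm

/-- A unital operad in chain complexes of `K`-modules. Composition is written with the inputs
first, `γ(x₁, …, xₖ; y)`, and all signs are the Koszul signs for that order. The action is such
that for the endomorphism operad `(σ f)(a₁, …, aₙ) = ± f(a_{σ 1}, …, a_{σ n})`. -/
structure DGOperad (K : Type u) [Field K] extends SymSeq K where
  one : (obj 1).V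
  one_mem : one ∈ (obj 1).gr 0
  one_d : (obj 1).d one = 0
  γ : ∀ {k : ℕ} (m : Fin k → ℕ),
    MultilinearMap K (fun i => (obj (m i)).V) ((obj k).V →ₗ[K] (obj (∑ i, m i)).V)
  γ_mem : ∀ {k : ℕ} (m : Fin k → ℕ) (p : Fin k → ℤ) (q : ℤ) (x : ∀ i, (obj (m i)).V)
    (y : (obj k).V), (∀ i, x i ∈ (obj (m i)).gr (p i)) → y ∈ (obj k).gr q →
      γ m x y ∈ (obj (∑ i, m i)).gr (∑ i, p i + q)
  γ_d : ∀ {k : ℕ} (m : Fin k → ℕ) (p : Fin k → ℤ) (x : ∀ i, (obj (m i)).V)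
    (y : (obj k).V), (∀ i, x i ∈ (obj (m i)).gr (p i)) →
      (obj (∑ i, m i)).d (γ m x y) =
        ∑ i, (∑ j with j < i, p j).negOnePow •
          γ m (Function.update x i ((obj (m i)).d (x i))) y
        + (∑ i, p i).negOnePow • γ m x ((obj k).d y)
  one_γ : ∀ {k : ℕ} (y : (obj k).V),
    γ (fun _ : Fin k => 1) (fun _ => one) y = toSymSeq.relabel (finCongr (by simp)) y
  γ_one : ∀ {n : ℕ} (x : (obj n).V),
    γ (fun _ : Fin 1 => n) (fun _ => x) one = toSymSeq.relabel (finCongr (by simp)) x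
  γ_assoc : ∀ {k : ℕ} (m : Fin k → ℕ) (l : ∀ i, Fin (m i) → ℕ) (r : ∀ i, Fin (m i) → ℤ)
    (p : Fin k → ℤ) (w : ∀ i (j : Fin (m i)), (obj (l i j)).V) (x : ∀ i, (obj (m i)).V)
    (y : (obj k).V), (∀ i j, w i j ∈ (obj (l i j)).gr (r i j)) →
      (∀ i, x i ∈ (obj (m i)).gr (p i)) →
      γ (fun s => l (finSigmaFinEquiv.symm s).1 (finSigmaFinEquiv.symm s).2)
          (fun s => w (finSigmaFinEquiv.symm s).1 (finSigmaFinEquiv.symm s).2) (γ m x y) =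
        (shuffle p (fun i => ∑ j, r i j)).negOnePow •
          toSymSeq.relabel (finCongr (sum_finSigma m l))
            (γ (fun i => ∑ j, l i j) (fun i => γ (l i) (w i) (x i)) y)
  γ_act : ∀ {k : ℕ} (m : Fin k → ℕ) (p : Fin k → ℤ) (σ : Equiv.Perm (Fin k))
    (x : ∀ i, (obj (m i)).V) (y : (obj k).V), (∀ i, x i ∈ (obj (m i)).gr (p i)) →
      γ m x (act k σ y) =
        (koszul p σ).negOnePow •
          toSymSeq.relabel
            (finSigmaFinEquiv.symm.trans
              ((Equiv.sigmaCongrLeft (β := fun i => Fin (m i)) σ).trans finSigmaFinEquiv))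
            (γ (fun i => m (σ i)) (fun i => x (σ i)) y)
  act_γ : ∀ {k : ℕ} (m : Fin k → ℕ) (τ : ∀ i, Equiv.Perm (Fin (m i)))
    (x : ∀ i, (obj (m i)).V) (y : (obj k).V),
      γ m (fun i => act (m i) (τ i) (x i)) y =
        act (∑ i, m i)
          (finSigmaFinEquiv.symm.trans ((Equiv.sigmaCongrRight τ).trans finSigmaFinEquiv))
          (γ m x y)

/-- The structure of a DG `C`-algebra on a chain complex `X`: operations
`θ : X ⊗ ⋯ ⊗ X ⊗ C(n) → X`, which are chain maps, associative, unital and equivariant. -/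
structure DGOperad.AlgStr {K : Type u} [Field K] (C : DGOperad K) (X : DGMod K) where
  θ : ∀ n : ℕ, MultilinearMap K (fun _ : Fin n => X.V) ((C.obj n).V →ₗ[K] X.V)
  θ_mem : ∀ {n : ℕ} (p : Fin n → ℤ) (q : ℤ) (a : Fin n → X.V) (c : (C.obj n).V),
    (∀ i, a i ∈ X.gr (p i)) → c ∈ (C.obj n).gr q → θ n a c ∈ X.gr (∑ i, p i + q)
  θ_d : ∀ {n : ℕ} (p : Fin n → ℤ) (a : Fin n → X.V) (c : (C.obj n).V),
    (∀ i, a i ∈ X.gr (p i)) →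
      X.d (θ n a c) =
        ∑ i, (∑ j with j < i, p j).negOnePow • θ n (Function.update a i (X.d (a i))) c
        + (∑ i, p i).negOnePow • θ n a ((C.obj n).d c)
  θ_one : ∀ a : X.V, θ 1 (fun _ => a) C.one = a
  θ_γ : ∀ {k : ℕ} (m : Fin k → ℕ) (r : ∀ i, Fin (m i) → ℤ) (p : Fin k → ℤ)
    (a : ∀ i, Fin (m i) → X.V) (x : ∀ i, (C.obj (m i)).V) (y : (C.obj k).V),
    (∀ i j, a i j ∈ X.gr (r i j)) → (∀ i, x i ∈ (C.obj (m i)).gr (p i)) →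
      θ (∑ i, m i) (fun s => a (finSigmaFinEquiv.symm s).1 (finSigmaFinEquiv.symm s).2)
          (C.γ m x y) =
        (shuffle p (fun i => ∑ j, r i j)).negOnePow •
          θ k (fun i => θ (m i) (a i) (x i)) y
  θ_act : ∀ {n : ℕ} (p : Fin n → ℤ) (σ : Equiv.Perm (Fin n)) (a : Fin n → X.V)
    (c : (C.obj n).V), (∀ i, a i ∈ X.gr (p i)) →
      θ n a (C.act n σ c) = (koszul p σ).negOnePow • θ n (fun i => a (σ i)) c

/-- A DG `C`-algebra. -/
structure DGOperad.Alg {K : Type u} [Field K] (C : DGOperad K) where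
  X : DGMod K
  str : C.AlgStr X

/-- A chain map between DG `C`-algebras preserves the operations. -/
def DGOperad.IsAlgHom {K : Type u} [Field K] {C : DGOperad K} {X Y : DGMod K}
    (S : C.AlgStr X) (T : C.AlgStr Y) (f : X.Hom Y) : Prop :=
  ∀ (n : ℕ) (a : Fin n → X.V) (c : (C.obj n).V),
    f.lin (S.θ n a c) = T.θ n (fun i => f.lin (a i)) c

/-! ## `Σ`-cofibrancy -/

namespace SymSeq

variable {K : Type u} [Field K]

/-- The representation of `Σₙ` on the degree `p` part of `C(n)`. -/
def degRep (C : SymSeq K) (n : ℕ) (p : ℤ) :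
    Representation K (Equiv.Perm (Fin n)) ((C.obj n).gr p) where
  toFun σ := (C.act n σ).restrict fun _ hc => C.act_mem σ hc
  map_one' := by ext c; simp
  map_mul' σ τ := by ext c; simp

/-- The differential `C(n)ₚ₊₁ → C(n)ₚ` as a map of representations. -/
def degD (C : SymSeq K) (n : ℕ) (p : ℤ) :
    (C.degRep n (p + 1)).IntertwiningMap (C.degRep n p) where
  toLinearMap := (C.obj n).d.restrict fun x hx => by
    simpa using (C.obj n).isDG.map_gr hx
  isIntertwining' σ := by
    ext c
    exact (C.act_d σ c).symm

/-- `C(n)` as a chain complex of `K[Σₙ]`-modules. -/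
def complex (C : SymSeq K) (n : ℕ) : ChainComplex (Rep.{u} K (Equiv.Perm (Fin n))) ℤ :=
  ChainComplex.of (fun p => Rep.of (C.degRep n p)) (fun p => Rep.ofHom (C.degD n p))
    (fun p => by
      ext c
      exact (C.obj n).isDG.d_d c)

/-- The inclusion `K[Σₙ][q] ⟶ I[Σₙ][q]` of the regular representation, placed in degree `q`, into
the complex `K[Σₙ] = K[Σₙ]` placed in degrees `q + 1` and `q`. -/
def cellMap (K : Type u) [Field K] (n : ℕ) (q : ℤ) :
    (HomologicalComplex.single (Rep.{u} K (Equiv.Perm (Fin n))) (ComplexShape.down ℤ) q).obj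
        (Rep.leftRegular K (Equiv.Perm (Fin n))) ⟶
      HomologicalComplex.double (c := ComplexShape.down ℤ) (i₀ := q + 1) (i₁ := q)
        (𝟙 (Rep.leftRegular K (Equiv.Perm (Fin n)))) rfl :=
  HomologicalComplex.mkHomFromSingle
    (HomologicalComplex.doubleXIso₁ _ _ (by omega)).inv
    (fun k _ => (congrArg _ (HomologicalComplex.double_d_eq_zero₀ _ _ _ _ (by omega))).trans
      comp_zero)

/-- Cell complexes of `K[Σₙ]`-modules: colimits of sequences `0 → X₀ → X₁ → ⋯` in which each step
is a pushout of a direct sum of maps `K[Σₙ][q] ⟶ I[Σₙ][q]`. -/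
def IsCell {n : ℕ} (X : ChainComplex (Rep.{u} K (Equiv.Perm (Fin n))) ℤ) : Prop :=
  (MorphismProperty.coproducts.{u}
    (MorphismProperty.ofHoms (cellMap K n))).pushouts.transfiniteCompositionsOfShape ℕ
      (0 : (HomologicalComplex.zero : ChainComplex (Rep.{u} K (Equiv.Perm (Fin n))) ℤ) ⟶ X)

/-- Each `C(n)` is a retract of a cell chain complex of `K[Σₙ]`-modules. -/
def SigmaCofibrant (C : SymSeq K) : Prop :=
  ∀ n, ∃ Y : ChainComplex (Rep.{u} K (Equiv.Perm (Fin n))) ℤ,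
    IsCell Y ∧ Nonempty (Retract (C.complex n) Y)

end SymSeq

/-! ## Decorated planar trees -/

section Trees

variable {K : Type u} [Field K]

/-- Planar trees whose leaves are decorated by homogeneous elements of `X`, and whose other
vertices, of valency `k ≥ 0`, are decorated by homogeneous elements of `C(k)`. -/
inductive BTree (C : DGOperad K) (X : DGMod K) : Type u
  | leaf (p : ℤ) (a : X.gr p) : BTree C X
  | node (k : ℕ) (p : ℤ) (c : (C.obj k).gr p) (t : Fin k → BTree C X) : BTree C X

variable {C : DGOperad K} {X : DGMod K}

namespace BTree

/-- The degree: the sum of the degrees of all decorations plus the number of non-leaf vertices. -/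
def deg : BTree C X → ℤ
  | leaf p _ => p
  | node _ p _ t => ∑ i, (t i).deg + p + 1

/-- The tree is a single leaf. -/
def IsLeaf : BTree C X → Prop
  | leaf _ _ => True
  | node _ _ _ _ => False

/-- The decoration of a tree that is a single leaf (and `0` for any other tree). -/
def val : BTree C X → X.V
  | leaf _ a => a
  | node _ _ _ _ => 0

theorem val_mem (t : BTree C X) : t.val ∈ X.gr t.deg := by
  cases t with
  | leaf p a => exact a.2
  | node k p c t => exact zero_mem _

/-- Apply a chain map to the decorations of all leaves. -/
def map {Y : DGMod K} (f : X.Hom Y) : BTree C X → BTree C Y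
  | leaf p a => leaf p ⟨f.lin a, f.map_gr a.2⟩
  | node k p c t => node k p c fun i => (t i).map f

end BTree

/-- A tree that is not a single leaf: its root decoration and its successor trees. -/
structure Corolla (C : DGOperad K) (X : DGMod K) where
  k : ℕ
  p : ℤ
  c : (C.obj k).gr p
  t : Fin k → BTree C X

namespace Corolla

def tree (y : Corolla C X) : BTree C X := .node y.k y.p y.c y.t

/-- All successor trees are leaves. -/
def IsBush (y : Corolla C X) : Prop := ∀ i, (y.t i).IsLeaf

/-- The tree with root decorated by the unit and with the single successor tree `t`. -/
def unit (t : BTree C X) : Corolla C X := ⟨1, 0, ⟨C.one, C.one_mem⟩, fun _ => t⟩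

/-- Put the trees `y₁, …, yₘ` above a vertex decorated by `x` and contract the `m` edges at that
vertex: the root gets the decoration `γ(c₁, …, cₘ; x)`, and its successor trees are those of
`y₁`, then those of `y₂`, and so on. -/
def graft {m : ℕ} (y : Fin m → Corolla C X) {q : ℤ} (x : (C.obj m).gr q) : Corolla C X where
  k := ∑ i, (y i).k
  p := ∑ i, (y i).p + q
  c := ⟨C.γ (fun i => (y i).k) (fun i => ((y i).c : (C.obj (y i).k).V)) x,
    C.γ_mem _ _ _ _ _ (fun i => (y i).c.2) x.2⟩
  t s := (y (finSigmaFinEquiv.symm s).1).t (finSigmaFinEquiv.symm s).2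

def map {Y : DGMod K} (f : X.Hom Y) (y : Corolla C X) : Corolla C Y :=
  ⟨y.k, y.p, y.c, fun i => (y.t i).map f⟩

end Corolla

/-! ## The augmented bar construction -/

/-- The relations of the bar construction on formal linear combinations of decorated trees:
linearity in every decoration, and the identification, with the Koszul sign, of
`(σ c; t₁, …, tₖ)` with `(c; t_{σ 1}, …, t_{σ k})` at every non-leaf vertex. -/
inductive BarRel (C : DGOperad K) (X : DGMod K) : (BTree C X →₀ K) → Prop
  | zero : BarRel C X 0
  | add {x y : BTree C X →₀ K} : BarRel C X x → BarRel C X y → BarRel C X (x + y)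
  | smul (r : K) {x : BTree C X →₀ K} : BarRel C X x → BarRel C X (r • x)
  | leaf_add (p : ℤ) (a b : X.gr p) :
      BarRel C X (.single (.leaf p (a + b)) 1 - .single (.leaf p a) 1 - .single (.leaf p b) 1)
  | leaf_smul (p : ℤ) (r : K) (a : X.gr p) :
      BarRel C X (.single (.leaf p (r • a)) 1 - r • .single (.leaf p a) 1)
  | node_add (k : ℕ) (p : ℤ) (c c' : (C.obj k).gr p) (t : Fin k → BTree C X) :
      BarRel C X (.single (.node k p (c + c') t) 1 - .single (.node k p c t) 1
        - .single (.node k p c' t) 1)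
  | node_smul (k : ℕ) (p : ℤ) (r : K) (c : (C.obj k).gr p) (t : Fin k → BTree C X) :
      BarRel C X (.single (.node k p (r • c) t) 1 - r • .single (.node k p c t) 1)
  | perm (k : ℕ) (p : ℤ) (σ : Equiv.Perm (Fin k)) (c : (C.obj k).gr p) (t : Fin k → BTree C X) :
      BarRel C X (.single (.node k p ⟨C.act k σ c, C.act_mem σ c.2⟩ t) 1
        - (koszul (fun i => (t i).deg) σ).negOnePow •
          .single (.node k p c (fun i => t (σ i))) 1)
  | above (k : ℕ) (p : ℤ) (c : (C.obj k).gr p) (t : Fin k → BTree C X) (i : Fin k)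
      {x : BTree C X →₀ K} : BarRel C X x →
      BarRel C X (x.mapDomain fun u => .node k p c (Function.update t i u))

def barRel (C : DGOperad K) (X : DGMod K) : Submodule K (BTree C X →₀ K) where
  carrier := {x | BarRel C X x}
  zero_mem' := .zero
  add_mem' := .add
  smul_mem' r _ := .smul r

/-- The underlying module of the augmented bar construction. -/
abbrev Bar (C : DGOperad K) (X : DGMod K) : Type u := (BTree C X →₀ K) ⧸ barRel C X

/-- The class of a decorated tree. -/
def Bar.cls (t : BTree C X) : Bar C X := (barRel C X).mkQ (.single t 1)

/-- The grading of the augmented bar construction. -/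
def Bar.gr (C : DGOperad K) (X : DGMod K) (n : ℤ) : Submodule K (Bar C X) :=
  Submodule.span K {x | ∃ t : BTree C X, t.deg = n ∧ x = Bar.cls t}

/-- The submodule `X ⊆ Bar C X` of trees consisting of a single leaf. -/
def Bar.leaves (C : DGOperad K) (X : DGMod K) : Submodule K (Bar C X) :=
  Submodule.span K {x | ∃ (p : ℤ) (a : X.gr p), x = Bar.cls (.leaf p a)}

namespace BTree

/-- Contraction of the edge from the root to the root of its `i`-th successor tree `tᵢ`, which is
`0` if `tᵢ` is a leaf. If `tᵢ = (c'; u₁, …, uₘ)`, the root gets the decoration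
`γᵢ(c', c) = γ(1, …, 1, c', 1, …, 1; c)`. -/
def edgeTerm {k : ℕ} {p : ℤ} (c : (C.obj k).gr p) (t : Fin k → BTree C X) (i : Fin k) :
    BTree C X →₀ K :=
  match t i with
  | leaf _ _ => 0
  | node m q c' u =>
    (∑ j with j ≤ i, (t j).deg + q * ∑ j with i < j, (t j).deg).negOnePow •
      .single (Corolla.graft
        (Function.update (fun j => Corolla.unit (t j)) i ⟨m, q, c', u⟩) c).tree 1

open Classical in
/-- Contraction of a bush to a leaf; `0` if the tree is not a bush. -/
def leafTerm (A : C.Alg) {k : ℕ} {p : ℤ} (c : (C.obj k).gr p) (t : Fin k → BTree C A.X) :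
    BTree C A.X →₀ K :=
  if ∀ i, (t i).IsLeaf then
    (∑ i, (t i).deg + p).negOnePow •
      .single (leaf (∑ i, (t i).deg + p)
        ⟨A.str.θ k (fun i => (t i).val) c, A.str.θ_mem _ _ _ _ (fun i => (t i).val_mem) c.2⟩) 1
  else 0

/-- The differential on trees: the sum of all internal differentials, of all contractions of an
edge between non-leaf vertices, and of all contractions of a vertex with only leaves above it. -/
def diff (A : C.Alg) : BTree C A.X → (BTree C A.X →₀ K)
  | leaf p a => .single (leaf (p - 1) ⟨A.X.d a, A.X.isDG.map_gr a.2⟩) 1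
  | node k p c t =>
    ∑ i, (∑ j with j < i, (t j).deg).negOnePow •
        ((t i).diff A).mapDomain (fun u => node k p c (Function.update t i u))
      + (∑ j, (t j).deg).negOnePow •
        .single (node k (p - 1) ⟨(C.obj k).d c, (C.obj k).isDG.map_gr c.2⟩ t) 1
      + ∑ i, edgeTerm c t i
      + leafTerm A c t

end BTree

/-- The differential of the augmented bar construction of `A`: the linear map given on trees by
`BTree.diff`, together with the facts that it makes `Bar C A.X` a chain complex. -/
structure AugBar (A : C.Alg) where
  d : Bar C A.X →ₗ[K] Bar C A.X
  d_cls : ∀ t, d (Bar.cls t) = (barRel C A.X).mkQ (t.diff A)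
  isDG : IsDG (Bar.gr C A.X) d

/-- The differential is determined by its values on trees. -/
instance (A : C.Alg) : Subsingleton (AugBar A) where
  allEq D E := by
    have h : D.d = E.d := by
      refine Submodule.linearMap_qext _ (Finsupp.lhom_ext' fun t => LinearMap.ext_ring ?_)
      exact (D.d_cls t).trans (E.d_cls t).symm
    cases D; cases E; cases h; rfl

namespace AugBar

variable {A : C.Alg}

/-- The augmented bar construction as a chain complex. -/
def dg (D : AugBar A) : DGMod K := ⟨Bar C A.X, Bar.gr C A.X, D.d, D.isDG⟩

theorem leaves_le : Bar.leaves C X ≤ ⨆ n, Bar.leaves C X ⊓ Bar.gr C X n := by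
  refine Submodule.span_le.2 ?_
  rintro _ ⟨p, a, rfl⟩
  exact Submodule.mem_iSup_of_mem p
    ⟨Submodule.subset_span ⟨p, a, rfl⟩, Submodule.subset_span ⟨_, rfl, rfl⟩⟩

theorem leaves_le_comap (D : AugBar A) :
    Bar.leaves C A.X ≤ (Bar.leaves C A.X).comap D.d := by
  refine Submodule.span_le.2 ?_
  rintro _ ⟨p, a, rfl⟩
  exact Submodule.subset_span ⟨p - 1, ⟨A.X.d a, A.X.isDG.map_gr a.2⟩, D.d_cls _⟩

/-- The bar construction: the quotient of the augmented bar construction by `A`, shifted by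
`-1`. -/
def B (D : AugBar A) : DGMod K :=
  (D.dg.quot (Bar.leaves C A.X) leaves_le D.leaves_le_comap).shift (-1)

/-- The class in the bar construction of a tree that is not a single leaf. -/
def cls (D : AugBar A) (y : Corolla C A.X) : D.B.V :=
  Submodule.Quotient.mk (p := Bar.leaves C A.X) (Bar.cls y.tree)

end AugBar

end Trees

end

/-! As a graded module the augmented construction is A plus B: `val` reads off a leaf, `proj` kills
leaves, and the two together detect elements (`bar_eq`). Write `eta` t = (1; t). Because γ(1,…,1; c)
= c, the class of (c; t₁,…,tₖ) in B is the grafting product of the elements `eta` tᵢ with operation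
c (`graftOp_eta`), so B is generated under grafting by a copy of the augmented construction.

In these terms the differential is short. On generators d(`eta` x) = `eta`(dx) ± `proj` x, the
second term being the contraction of the edge above the new unit root (`dRed_eta`). On B it is
extended as a derivation over grafting (`proj_dTree_node`, `dRed_graftOp`). The leaf component of dx
is ∂(`val` x) + μ(± `proj` x), coming from contracted bushes (`val_dBar`). Thus the augmented
construction is, up to signs, the mapping cone of μ : B → A.

The algebraic claims follow. The derivation formula is multilinear and equivariant, hence d respects
the relations (`exists_d`). A derivation squares to zero once it does so on generators
(`dRed_dRed_graftOp`), and there an induction on the tree applies; the leaf component of d² vanishes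
because μ is a chain map (`dBar_dBar`). Finally μ is the algebra map that extends `val` on
generators (`mu_graftOp`, `mu_eta`), so its compatibility with d is also checked on generators
(`mu_dRed`).

For homology, t ↦ ±(1; t) contracts the cone: every cycle x is the boundary of its image
(`dBar_homotopy`). An acyclic cone means that μ is an isomorphism in homology (`exists_boundary`,
`exists_cycle`). Naturality is again an induction on trees through generators.

Operations on quotients are built as multilinear maps from their values on trees
(`exists_multilinear_descend`), and identities between them are checked on homogeneous generators
(`multilinear_eq_of_span`). -/

noncomputable section

namespace OperadBar

section

/-! ## Signs -/

section Signs

/-- Sign identities with repeated terms are compared in `ZMod 2`, where they become polynomial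
identities that hold up to a multiple of 2 = 0. -/
theorem negOnePow_congr {a b : ℤ} (h : (a : ZMod 2) = b) : a.negOnePow = b.negOnePow := by
  rw [Int.negOnePow_eq_iff, ← ZMod.intCast_eq_zero_iff_even]
  push_cast
  rw [h, sub_self]

theorem map_unit_smul {V W F : Type*} [AddCommGroup V] [AddCommGroup W] [FunLike F V W]
    [AddMonoidHomClass F V W] (f : F) (e : ℤˣ) (v : V) : f (e • v) = e • f v := by
  rw [Units.smul_def, map_zsmul, Units.smul_def]

theorem unit_smul_mem {K V : Type*} [Ring K] [AddCommGroup V] [Module K V] (S : Submodule K V)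
    (e : ℤˣ) {v : V} (h : v ∈ S) : e • v ∈ S := by
  rw [Units.smul_def]
  exact zsmul_mem h _

theorem update_unit_smul {ι K W : Type*} {V : ι → Type*} [DecidableEq ι] [CommRing K]
    [∀ i, AddCommGroup (V i)] [∀ i, Module K (V i)] [AddCommGroup W] [Module K W]
    (f : MultilinearMap K V W) (x : ∀ i, V i) (i : ι) (e : ℤˣ) (v : V i) :
    f (Function.update x i (e • v)) = e • f (Function.update x i v) :=
  map_unit_smul (f.toLinearMap x i) e v

/-- The exponent of the Koszul sign for rearranging inputs along a bijection. -/
def koszulEquiv {n m : ℕ} (p : Fin m → ℤ) (e : Fin n ≃ Fin m) : ℤ :=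
  ∑ i, ∑ j, if i < j ∧ e j < e i then p (e i) * p (e j) else 0

theorem finSigma_val {k : ℕ} {m : Fin k → ℕ} (a : Σ i, Fin (m i)) :
    (finSigmaFinEquiv a : ℕ) = ∑ i with i < a.1, m i + a.2 := by
  rw [finSigmaFinEquiv_apply]
  congr 1
  refine Finset.sum_bij' (fun i _ => Fin.castLE a.1.2.le i)
    (fun i hi => ⟨i, by simpa using hi⟩) ?_ ?_ ?_ ?_ ?_ <;> simp [Fin.lt_def, -Fin.val_fin_lt]

/-- The flattened order is lexicographic. All block decompositions of sign exponents rest on this.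
-/
theorem finSigma_lt {k : ℕ} {m : Fin k → ℕ} (a b : Σ i, Fin (m i)) :
    finSigmaFinEquiv a < finSigmaFinEquiv b ↔ a.1 < b.1 ∨ ∃ h : a.1 = b.1, h ▸ a.2 < b.2 := by
  have key : ∀ a b : Σ i, Fin (m i), a.1 < b.1 → finSigmaFinEquiv a < finSigmaFinEquiv b := by
    intro a b h
    rw [Fin.lt_def, finSigma_val, finSigma_val]
    have : ∑ i with i < a.1, m i + m a.1 ≤ ∑ i with i < b.1, m i := by
      rw [add_comm, ← Finset.sum_insert (by simp)]
      refine Finset.sum_le_sum_of_subset fun i hi => ?_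
      simp only [Finset.mem_insert, Finset.mem_filter, Finset.mem_univ, true_and] at hi ⊢
      rcases hi with rfl | hi
      · exact h
      · exact hi.trans h
    have := a.2.2
    omega
  have key' : ∀ (i : Fin k) (a b : Fin (m i)), a < b →
      finSigmaFinEquiv (n := m) ⟨i, a⟩ < finSigmaFinEquiv (n := m) ⟨i, b⟩ := by
    intro i a b h
    rw [Fin.lt_def, finSigma_val, finSigma_val]
    simpa using h
  constructor
  · intro h
    rcases lt_trichotomy a.1 b.1 with h1 | h1 | h1
    · exact .inl h1
    · obtain ⟨i, a⟩ := a
      obtain ⟨j, b⟩ := b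
      obtain rfl : i = j := h1
      refine .inr ⟨rfl, ?_⟩
      by_contra h2
      rcases (not_lt.1 h2).lt_or_eq with h3 | h3
      · exact lt_asymm h (key' i b a h3)
      · obtain rfl : b = a := h3
        exact lt_irrefl _ h
    · exact absurd (key b a h1) (lt_asymm h)
  · rintro (h | ⟨h1, h2⟩)
    · exact key a b h
    · obtain ⟨i, a⟩ := a
      obtain ⟨j, b⟩ := b
      obtain rfl : i = j := h1
      exact key' i a b h2

theorem finSigma_lt_of_ne {k : ℕ} {m : Fin k → ℕ} {i j : Fin k} (h : i ≠ j) (a : Fin (m i))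
    (b : Fin (m j)) :
    finSigmaFinEquiv (n := m) ⟨i, a⟩ < finSigmaFinEquiv (n := m) ⟨j, b⟩ ↔ i < j := by
  rw [finSigma_lt]
  simp [h]

theorem finSigma_lt_same {k : ℕ} {m : Fin k → ℕ} {i : Fin k} (a b : Fin (m i)) :
    finSigmaFinEquiv (n := m) ⟨i, a⟩ < finSigmaFinEquiv (n := m) ⟨i, b⟩ ↔ a < b := by
  rw [finSigma_lt]
  simp

theorem sum_fin_sigma {k : ℕ} {m : Fin k → ℕ} {M : Type*} [AddCommMonoid M]
    (f : Fin (∑ i, m i) → M) :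
    ∑ s, f s = ∑ i, ∑ j, f (finSigmaFinEquiv (n := m) ⟨i, j⟩) := by
  rw [← Fintype.sum_sigma']
  exact (Equiv.sum_comp finSigmaFinEquiv f).symm

/-- Concatenation of `k` finite sequences. -/
def flat {k : ℕ} {m : Fin k → ℕ} {W : Type*} (f : ∀ i, Fin (m i) → W) :
    Fin (∑ i, m i) → W :=
  fun s => f (finSigmaFinEquiv.symm s).1 (finSigmaFinEquiv.symm s).2

@[simp]
theorem flat_apply {k : ℕ} {m : Fin k → ℕ} {W : Type*} (f : ∀ i, Fin (m i) → W)
    (a : Σ i, Fin (m i)) : flat f (finSigmaFinEquiv a) = f a.1 a.2 := by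
  unfold flat
  rw [Equiv.symm_apply_apply]

theorem sum_flat {k : ℕ} {m : Fin k → ℕ} {M : Type*} [AddCommMonoid M]
    (f : ∀ i, Fin (m i) → M) : ∑ s, flat f s = ∑ i, ∑ j, f i j := by
  simp [sum_fin_sigma]

theorem sum_lt_flat {k : ℕ} {m : Fin k → ℕ} {M : Type*} [AddCommMonoid M]
    (p : ∀ i, Fin (m i) → M) (i : Fin k)
    (j : Fin (m i)) :
    ∑ s with s < finSigmaFinEquiv (n := m) ⟨i, j⟩, flat p s =
      ∑ l with l < i, ∑ r, p l r + ∑ r with r < j, p i r := by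
  rw [Finset.sum_filter, sum_fin_sigma, Finset.sum_filter, Finset.sum_filter,
    ← Finset.sum_erase_add _ _ (Finset.mem_univ i)]
  congr 1
  · refine (Finset.sum_congr rfl fun l hl => ?_).trans (Finset.sum_erase _ (by simp))
    simp only [flat_apply, finSigma_lt_of_ne (Finset.ne_of_mem_erase hl)]
    split_ifs <;> simp
  · simp only [flat_apply, finSigma_lt_same]

/-- A pair of flattened positions lies either in one block or in two different ones; the latter
pairs only see the total degrees of the blocks. -/
theorem shuffle_flat {k : ℕ} {m : Fin k → ℕ} (p q : ∀ i, Fin (m i) → ℤ) :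
    shuffle (flat p) (flat q) =
      ∑ i, shuffle (p i) (q i) + shuffle (fun i => ∑ j, p i j) (fun i => ∑ j, q i j) := by
  unfold shuffle
  rw [sum_fin_sigma, ← Finset.sum_add_distrib]
  refine Finset.sum_congr rfl fun i _ => ?_
  simp_rw [sum_fin_sigma (m := m), flat_apply]
  rw [Finset.sum_comm, ← Finset.sum_erase_add _ _ (Finset.mem_univ i), add_comm]
  simp only [finSigma_lt_same]
  congr 1
  refine (Finset.sum_congr rfl fun l hl => ?_).trans (Finset.sum_erase _ (by simp))
  simp only [finSigma_lt_of_ne (Finset.ne_of_mem_erase hl).symm]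
  split_ifs
  · rw [Finset.sum_mul_sum]
  · simp

/-- Moving whole blocks never inverts two entries of one block, and two inverted blocks contribute
the product of their total degrees. -/
theorem koszulEquiv_blocks {k : ℕ} {m : Fin k → ℕ} (q : ∀ i, Fin (m i) → ℤ)
    (σ : Equiv.Perm (Fin k)) :
    koszulEquiv (flat q)
      (finSigmaFinEquiv.symm.trans
        ((Equiv.sigmaCongrLeft (β := fun i => Fin (m i)) σ).trans finSigmaFinEquiv)) =
      koszul (fun i => ∑ j, q i j) σ := by
  unfold koszulEquiv koszul
  rw [sum_fin_sigma]
  refine Finset.sum_congr rfl fun i _ => ?_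
  simp_rw [sum_fin_sigma (m := fun i => m (σ i))]
  rw [Finset.sum_comm]
  refine Finset.sum_congr rfl fun l _ => ?_
  simp only [Equiv.trans_apply, Equiv.symm_apply_apply, Equiv.sigmaCongrLeft_apply, flat_apply]
  by_cases h : i = l
  · subst h
    simp only [finSigma_lt_same, lt_self_iff_false, false_and, if_false]
    refine Finset.sum_eq_zero fun a _ => Finset.sum_eq_zero fun b _ => if_neg ?_
    exact fun h => lt_asymm h.1 h.2
  · simp only [finSigma_lt_of_ne h, finSigma_lt_of_ne (m := m) (fun e => h (σ.injective e).symm)]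
    split_ifs
    · rw [Finset.sum_mul_sum]
    · simp

/-- Permuting inside blocks creates no inversion between different blocks. -/
theorem koszul_blocks {k : ℕ} {m : Fin k → ℕ} (q : ∀ i, Fin (m i) → ℤ)
    (τ : ∀ i, Equiv.Perm (Fin (m i))) :
    koszul (flat q)
      (finSigmaFinEquiv.symm.trans ((Equiv.sigmaCongrRight τ).trans finSigmaFinEquiv)) =
      ∑ i, koszul (q i) (τ i) := by
  unfold koszul
  rw [sum_fin_sigma]
  refine Finset.sum_congr rfl fun i _ => Finset.sum_congr rfl fun a _ => ?_
  rw [sum_fin_sigma, Finset.sum_eq_single i]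
  · simp [finSigma_lt_same]
  · intro l _ h
    refine Finset.sum_eq_zero fun b _ => if_neg ?_
    simp only [Equiv.trans_apply, Equiv.symm_apply_apply, Equiv.sigmaCongrRight_apply,
      finSigma_lt_of_ne h.symm, finSigma_lt_of_ne h]
    exact fun h => lt_asymm h.1 h.2
  · simp

/-- The change of the grafting sign when a tree above the `i`-th vertex is differentiated; the
companion below treats a differentiated root label. -/
theorem shuffle_sub_right {k : ℕ} (p q : Fin k → ℤ) (i : Fin k) :
    shuffle p (q - Pi.single i 1) = shuffle p q - ∑ j with j < i, p j := by
  unfold shuffle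
  rw [Finset.sum_filter, ← Finset.sum_sub_distrib]
  refine Finset.sum_congr rfl fun a _ => ?_
  rw [← Finset.sum_erase_add _ _ (Finset.mem_univ i),
    ← Finset.sum_erase_add Finset.univ (fun j => if a < j then p a * q j else 0)
      (Finset.mem_univ i), add_sub_assoc]
  congr 1
  · refine Finset.sum_congr rfl fun b hb => ?_
    simp [Finset.ne_of_mem_erase hb]
  · simp only [Pi.sub_apply, Pi.single_eq_same]
    split_ifs <;> ring

theorem shuffle_sub_left {k : ℕ} (p q : Fin k → ℤ) (i : Fin k) :
    shuffle (p - Pi.single i 1) q = shuffle p q - ∑ j with i < j, q j := by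
  unfold shuffle
  rw [← Finset.sum_erase_add _ _ (Finset.mem_univ i),
    ← Finset.sum_erase_add Finset.univ (fun a => ∑ j, if a < j then p a * q j else 0)
      (Finset.mem_univ i), add_sub_assoc]
  congr 1
  · refine Finset.sum_congr rfl fun b hb => ?_
    simp [Finset.ne_of_mem_erase hb]
  · rw [Finset.sum_filter, ← Finset.sum_sub_distrib]
    refine Finset.sum_congr rfl fun j _ => ?_
    simp only [Pi.sub_apply, Pi.single_eq_same]
    split_ifs <;> ring

theorem shuffle_add_left {k : ℕ} (p p' q : Fin k → ℤ) :
    shuffle (fun i => p i + p' i) q = shuffle p q + shuffle p' q := by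
  unfold shuffle
  simp only [← Finset.sum_add_distrib]
  refine Finset.sum_congr rfl fun i _ => Finset.sum_congr rfl fun j _ => ?_
  split_ifs <;> ring

theorem shuffle_add_right {k : ℕ} (p q q' : Fin k → ℤ) :
    shuffle p (fun i => q i + q' i) = shuffle p q + shuffle p q' := by
  unfold shuffle
  simp only [← Finset.sum_add_distrib]
  refine Finset.sum_congr rfl fun i _ => Finset.sum_congr rfl fun j _ => ?_
  split_ifs <;> ring

theorem prod_negOnePow {ι : Type*} (s : Finset ι) (f : ι → ℤ) :
    ∏ i ∈ s, (f i).negOnePow = (∑ i ∈ s, f i).negOnePow := by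
  classical
  induction s using Finset.induction_on with
  | empty => simp
  | insert i s hi ih => rw [Finset.prod_insert hi, Finset.sum_insert hi, Int.negOnePow_add, ih]

theorem map_unit_smul_univ {ι K W : Type*} {V : ι → Type*} [Fintype ι] [CommRing K]
    [∀ i, AddCommGroup (V i)] [∀ i, Module K (V i)] [AddCommGroup W] [Module K W]
    (f : MultilinearMap K V W) (e : ι → ℤˣ) (x : ∀ i, V i) :
    f (fun i => e i • x i) = (∏ i, e i) • f x := by
  have h := f.map_smul_univ (fun i => ((e i : ℤ) : K)) x
  simp only [Int.cast_smul_eq_zsmul, ← Int.cast_prod, ← Units.smul_def] at h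
  rw [h, Units.smul_def]
  simp

/-- View the i-th factor as a pair of degrees p i and q i. An inverted pair of factors contributes a
pp term, a qq term and two cross terms; the cross terms are the difference between separating the
pairs before and after the permutation. -/
theorem koszul_add {k : ℕ} (p q : Fin k → ℤ) (σ : Equiv.Perm (Fin k)) :
    (koszul (fun i => p i + q i) σ : ZMod 2) =
      ((shuffle p q + shuffle (fun i => p (σ i)) (fun i => q (σ i)) + koszul p σ + koszul q σ : ℤ)
        : ZMod 2) := by
  have h1 : shuffle p q = ∑ i, ∑ j, if σ i < σ j then p (σ i) * q (σ j) else 0 := by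
    unfold shuffle
    rw [← Equiv.sum_comp σ]
    exact Finset.sum_congr rfl fun i _ => (Equiv.sum_comp σ _).symm
  have h2 : koszul (fun i => p i + q i) σ = koszul p σ + koszul q σ +
      ((∑ i, ∑ j, if i < j ∧ σ j < σ i then p (σ i) * q (σ j) else 0) +
      ∑ i, ∑ j, if j < i ∧ σ i < σ j then p (σ i) * q (σ j) else 0) := by
    rw [Finset.sum_comm (f := fun i j => if j < i ∧ σ i < σ j then p (σ i) * q (σ j) else 0)]
    unfold koszul
    simp only [← Finset.sum_add_distrib]
    refine Finset.sum_congr rfl fun i _ => Finset.sum_congr rfl fun j _ => ?_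
    split_ifs <;> ring
  -- Pairs whose order `σ` preserves occur in both shuffles and cancel mod 2; only the inverted
  -- pairs survive.
  have h3 : ((shuffle p q + shuffle (fun i => p (σ i)) (fun i => q (σ i)) : ℤ) : ZMod 2) =
      (((∑ i, ∑ j, if i < j ∧ σ j < σ i then p (σ i) * q (σ j) else 0) +
      ∑ i, ∑ j, if j < i ∧ σ i < σ j then p (σ i) * q (σ j) else 0 : ℤ) : ZMod 2) := by
    rw [h1]
    unfold shuffle
    simp only [← Finset.sum_add_distrib, Int.cast_sum]
    refine Finset.sum_congr rfl fun i _ => Finset.sum_congr rfl fun j _ => ?_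
    by_cases e : i = j
    · subst e; simp
    · rcases lt_or_gt_of_ne e with h | h <;>
        rcases lt_or_gt_of_ne (σ.injective.ne e) with h' | h' <;>
        simp [h, h', h.not_gt, h'.not_gt, CharTwo.add_self_eq_zero]
  rw [h2, Int.cast_add, ← h3]
  push_cast
  ring

/-- Differentiating factor `σ l` and then permuting has the same sign as permuting and then
differentiating in position `l`: the factors that stand before it on exactly one of the two
occasions are those inverted with it. -/
theorem koszul_sub_single {k : ℕ} (p : Fin k → ℤ) (σ : Equiv.Perm (Fin k)) (l : Fin k) :
    ((∑ j with j < σ l, p j + koszul (p - Pi.single (σ l) 1) σ : ℤ) : ZMod 2) =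
      ((koszul p σ + ∑ j with j < l, p (σ j) : ℤ) : ZMod 2) := by
  have h1 : koszul (p - Pi.single (σ l) 1) σ = koszul p σ -
      ((∑ j, if l < j ∧ σ j < σ l then p (σ j) else 0) +
        ∑ j, if j < l ∧ σ l < σ j then p (σ j) else 0) := by
    unfold koszul
    have e : ∀ i j, (if i < j ∧ σ j < σ i then
        (p - Pi.single (σ l) 1 : Fin k → ℤ) (σ i) * (p - Pi.single (σ l) 1 : Fin k → ℤ) (σ j)
          else 0) =
        (if i < j ∧ σ j < σ i then p (σ i) * p (σ j) else 0) -
        ((if i = l then (if l < j ∧ σ j < σ l then p (σ j) else 0) else 0) +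
          if j = l then (if i < l ∧ σ l < σ i then p (σ i) else 0) else 0) := by
      intro i j
      by_cases hi : i = l <;> by_cases hj : j = l
      · subst hi; subst hj; simp
      · subst hi
        simp only [Pi.sub_apply, Pi.single_eq_same, if_true, hj, if_false,
          Pi.single_eq_of_ne (fun h => hj (σ.injective h) : σ j ≠ σ i)]
        split_ifs <;> ring
      · subst hj
        simp only [Pi.sub_apply, Pi.single_eq_same, if_true, hi, if_false,
          Pi.single_eq_of_ne (fun h => hi (σ.injective h) : σ i ≠ σ j)]
        split_ifs <;> ring
      · simp only [Pi.sub_apply, hi, hj, if_false,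
          Pi.single_eq_of_ne (fun h => hj (σ.injective h) : σ j ≠ σ l),
          Pi.single_eq_of_ne (fun h => hi (σ.injective h) : σ i ≠ σ l)]
        split_ifs <;> ring
    simp only [e, Finset.sum_sub_distrib, Finset.sum_add_distrib, Finset.sum_ite_eq',
      Finset.mem_univ, if_true]
    rw [Finset.sum_comm (f := fun i j => if i = l then _ else _)]
    simp only [Finset.sum_ite_eq', Finset.mem_univ, if_true]
  have h2 : ∑ j with j < σ l, p j = ∑ j, if σ j < σ l then p (σ j) else 0 := by
    rw [Finset.sum_filter]
    exact (Equiv.sum_comp σ _).symm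
  have h3 : ((∑ j, if σ j < σ l then p (σ j) else 0 : ℤ) : ZMod 2) =
      (((∑ j, if l < j ∧ σ j < σ l then p (σ j) else 0) +
        (∑ j, if j < l ∧ σ l < σ j then p (σ j) else 0) +
        ∑ j, if j < l then p (σ j) else 0 : ℤ) : ZMod 2) := by
    simp only [← Finset.sum_add_distrib, Int.cast_sum]
    refine Finset.sum_congr rfl fun j _ => ?_
    by_cases e : j = l
    · subst e; simp
    · rcases lt_or_gt_of_ne e with h | h <;>
        rcases lt_or_gt_of_ne (σ.injective.ne e) with h' | h' <;>
        simp [h, h', h.not_gt, h'.not_gt, CharTwo.add_self_eq_zero]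
  rw [h1, h2, Int.cast_add, h3, Finset.sum_filter]
  push_cast
  ring

/-- Concatenation is associative. -/
theorem flat_flat {k : ℕ} {m : Fin k → ℕ} (l : ∀ i, Fin (m i) → ℕ) {W : Type*}
    (t : ∀ i j, Fin (l i j) → W) (s : Fin (∑ i, ∑ j, l i j)) :
    flat (m := fun s : Fin (∑ i, m i) => l (finSigmaFinEquiv.symm s).1 (finSigmaFinEquiv.symm s).2)
      (fun s => t (finSigmaFinEquiv.symm s).1 (finSigmaFinEquiv.symm s).2)
      (finCongr (sum_finSigma m l) s) = flat (fun i => flat (t i)) s := by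
  obtain ⟨⟨i, s⟩, rfl⟩ := finSigmaFinEquiv.surjective s
  obtain ⟨⟨j, r⟩, rfl⟩ := finSigmaFinEquiv.surjective s
  rw [flat_apply, flat_apply]
  have hl : l i j = l (finSigmaFinEquiv.symm (finSigmaFinEquiv (n := m) ⟨i, j⟩)).1
      (finSigmaFinEquiv.symm (finSigmaFinEquiv (n := m) ⟨i, j⟩)).2 :=
    (flat_apply l ⟨i, j⟩).symm
  -- Both numberings count the entries that precede (i, j, r), which `sum_lt_flat` computes.
  have e : finCongr (sum_finSigma m l) (finSigmaFinEquiv ⟨i, finSigmaFinEquiv ⟨j, r⟩⟩) =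
      finSigmaFinEquiv (n := fun s : Fin (∑ i, m i) =>
        l (finSigmaFinEquiv.symm s).1 (finSigmaFinEquiv.symm s).2)
        ⟨finSigmaFinEquiv ⟨i, j⟩, finCongr hl r⟩ := by
    apply Fin.ext
    have := sum_lt_flat l i j
    unfold flat at this
    simp only [finCongr_apply, Fin.val_cast, finSigma_val, this, add_assoc]
  -- The type of `r'` depends on the pair, so the pair is generalized before it is replaced.
  have key : ∀ (a : Σ i, Fin (m i)) (_ : a = ⟨i, j⟩) (r' : Fin (l a.1 a.2)),
      (r' : ℕ) = r → t a.1 a.2 r' = t i j r := by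
    rintro _ rfl r' hr
    exact congrArg _ (Fin.ext hr)
  exact (congrArg _ e).trans ((flat_apply _ _).trans
    (key _ (Equiv.symm_apply_apply finSigmaFinEquiv ⟨i, j⟩) _ rfl))

end Signs

end

section

/-! ## Multilinear algebra over a field -/

section Multilinear

variable {K : Type*} [Field K]

/-- Induction over all variables of a property that is linear in each of them. -/
theorem span_pi_induction {ι : Type*} [Fintype ι] [DecidableEq ι] {V : ι → Type*}
    [∀ i, AddCommGroup (V i)] [∀ i, Module K (V i)] {S : ∀ i, Set (V i)}
    {P : (∀ i, V i) → Prop}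
    (base : ∀ x, (∀ i, x i ∈ S i) → P x)
    (zero : ∀ x i, P (Function.update x i 0))
    (add : ∀ x i a b, P (Function.update x i a) → P (Function.update x i b) →
      P (Function.update x i (a + b)))
    (smul : ∀ x i (r : K) a, P (Function.update x i a) → P (Function.update x i (r • a)))
    (x : ∀ i, V i) (hx : ∀ i, x i ∈ Submodule.span K (S i)) : P x := by
  -- `J` is the set of coordinates already freed from being generators.
  have key : ∀ J : Finset ι, ∀ x : ∀ i, V i, (∀ i ∈ J, x i ∈ Submodule.span K (S i)) →
      (∀ i ∉ J, x i ∈ S i) → P x := by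
    intro J
    induction J using Finset.induction_on with
    | empty => exact fun x _ h => base x fun i => h i (Finset.notMem_empty i)
    | insert i J hi ih =>
      intro x h1 h2
      have : ∀ v ∈ Submodule.span K (S i), P (Function.update x i v) := by
        intro v hv
        induction hv using Submodule.span_induction with
        | mem v hv =>
          refine ih _ (fun j hj => ?_) fun j hj => ?_
          · have : j ≠ i := fun e => hi (e ▸ hj)
            rw [Function.update_of_ne this]
            exact h1 j (Finset.mem_insert_of_mem hj)
          · by_cases e : j = i
            · subst e; simpa using hv
            · rw [Function.update_of_ne e]
              exact h2 j (by simp [e, hj])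
        | zero => exact zero x i
        | add a b _ _ ha hb => exact add x i a b ha hb
        | smul r a _ ha => exact smul x i r a ha
      have h := this _ (h1 i (Finset.mem_insert_self i J))
      rwa [Function.update_eq_self] at h
  exact key Finset.univ x (fun i _ => hx i) fun i h => absurd (Finset.mem_univ i) h

theorem multilinear_eq_of_span {ι : Type*} [Fintype ι] [DecidableEq ι] {V : ι → Type*} {M : Type*}
    [∀ i, AddCommGroup (V i)] [∀ i, Module K (V i)] [AddCommGroup M] [Module K M]
    {S : ∀ i, Set (V i)} (F G : MultilinearMap K V M)
    (h : ∀ x, (∀ i, x i ∈ S i) → F x = G x) (x : ∀ i, V i)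
    (hx : ∀ i, x i ∈ Submodule.span K (S i)) : F x = G x := by
  refine span_pi_induction (P := fun x => F x = G x) h ?_ ?_ ?_ x hx
  · intro x i
    rw [F.map_coord_zero i (by simp), G.map_coord_zero i (by simp)]
  · intro x i a b ha hb
    rw [F.map_update_add, G.map_update_add, ha, hb]
  · intro x i r a ha
    rw [F.map_update_smul, G.map_update_smul, ha]

theorem multilinear_ext_of_span {ι : Type*} [Fintype ι] [DecidableEq ι] {V : ι → Type*} {M : Type*}
    [∀ i, AddCommGroup (V i)] [∀ i, Module K (V i)] [AddCommGroup M] [Module K M]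
    {S : ∀ i, Set (V i)} (hS : ∀ i, Submodule.span K (S i) = ⊤) (F G : MultilinearMap K V M)
    (h : ∀ x, (∀ i, x i ∈ S i) → F x = G x) : F = G :=
  MultilinearMap.ext fun x => multilinear_eq_of_span F G h x fun i => hS i ▸ Submodule.mem_top

/-- The universal property of free modules in several variables: spread the arguments over all
tuples of generators, weight `f` by the product of the coefficients, and sum. -/
theorem exists_multilinear_finsupp {ι β M : Type*} [Fintype ι] [AddCommGroup M] [Module K M]
    (f : (ι → β) → M) :
    ∃ F : MultilinearMap K (fun _ : ι => β →₀ K) M,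
      ∀ t, F (fun i => Finsupp.single (t i) 1) = f t := by
  classical
  let G := MultilinearMap.dfinsuppFamily (R := K) (κ := fun _ : ι => β) (M := fun _ _ => K)
    (N := fun _ => M) fun p => MultilinearMap.mkPiRing K ι (f p)
  let s : (Π₀ _ : ι → β, M) →ₗ[K] M := DFinsupp.lsum ℕ fun _ => LinearMap.id
  refine ⟨(s.compMultilinearMap G).compLinearMap
    fun _ => (finsuppLequivDFinsupp K).toLinearMap, fun t => ?_⟩
  have : ∀ b : β, (finsuppLequivDFinsupp K) (Finsupp.single b (1 : K)) =
      DFinsupp.single b (1 : K) := fun b => by simp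
  simp only [MultilinearMap.compLinearMap_apply, LinearEquiv.coe_coe, this,
    LinearMap.compMultilinearMap_apply, G]
  rw [MultilinearMap.dfinsuppFamily_single]
  simp [s]

/-- A function of several generators extends to a multilinear map on a quotient of the free module
if it respects the relations in each variable. -/
theorem exists_multilinear_descend {ι β W M : Type*} [Fintype ι] [DecidableEq ι]
    [AddCommGroup W] [Module K W] [AddCommGroup M] [Module K M] (q : (β →₀ K) →ₗ[K] W)
    (hq : Function.Surjective q) (f : (ι → β) → M)
    (hf : ∀ t i x, q x = 0 →
      Finsupp.linearCombination K (fun u => f (Function.update t i u)) x = 0) :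
    ∃ F : MultilinearMap K (fun _ : ι => W) M,
      ∀ t, F (fun i => q (Finsupp.single (t i) 1)) = f t := by
  obtain ⟨F, hF⟩ := exists_multilinear_finsupp (K := K) f
  -- Over a field `q` has a linear section. The descended map is `F` composed with it in every
  -- variable, and it remains to see that the choice of section does not affect the values.
  obtain ⟨s, hs⟩ := q.exists_rightInverse_of_surjective (LinearMap.range_eq_top.2 hq)
  have hqs : ∀ w, q (s w) = w := fun w => LinearMap.congr_fun hs w
  have hz : ∀ (y : ι → β →₀ K) i x, q x = 0 → F (Function.update y i x) = 0 := by
    intro y i x hx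
    -- In slot `i` this is a projection onto the kernel of `q`; it turns the vanishing of `F` on
    -- relations into an identity of multilinear maps, which can be tested on generators.
    let L : ∀ j : ι, (β →₀ K) →ₗ[K] (β →₀ K) :=
      fun j => if j = i then LinearMap.id - s.comp q else LinearMap.id
    have hL : F.compLinearMap L = 0 := by
      refine multilinear_ext_of_span
        (S := fun _ => Set.range fun b : β => Finsupp.single b (1 : K)) (fun _ => ?_) _ _ fun y hy => ?_
      · simpa using (Finsupp.basisSingleOne (R := K) (ι := β)).span_eq
      · choose t ht using hy
        have e : (fun j => L j (y j)) = Function.update (fun j => Finsupp.single (t j) (1 : K)) i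
            (y i - s (q (y i))) := by
          funext j
          by_cases h : j = i
          · subst h; simp [L]
          · simp [L, h, ht]
        have e2 : F.toLinearMap (fun j => Finsupp.single (t j) (1 : K)) i =
            Finsupp.linearCombination K (fun u => f (Function.update t i u)) := by
          refine Finsupp.lhom_ext' fun u => LinearMap.ext_ring ?_
          simp only [LinearMap.comp_apply, Finsupp.lsingle_apply, MultilinearMap.toLinearMap_apply,
            Finsupp.linearCombination_single, one_smul, ← hF]
          congr 1
          funext j
          by_cases h : j = i
          · subst h; simp
          · simp [h]
        rw [MultilinearMap.compLinearMap_apply, e, _root_.zero_apply]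
        refine (LinearMap.congr_fun e2 _).trans (hf _ _ _ ?_)
        rw [map_sub, hqs, sub_self]
    have h := congrArg (fun G => G (Function.update y i x)) hL
    simp only [MultilinearMap.compLinearMap_apply, _root_.zero_apply] at h
    rw [← h]
    congr 1
    funext j
    by_cases h : j = i
    · subst h; simp [L, hx]
    · simp [L, h]
  refine ⟨F.compLinearMap fun _ => s, fun t => ?_⟩
  rw [← hF, MultilinearMap.compLinearMap_apply]
  -- The lifts are exchanged one slot at a time; each exchange alters an argument by an element of
  -- the kernel of `q`.
  have key : ∀ J : Finset ι, F (fun i => if i ∈ J then s (q (Finsupp.single (t i) 1))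
      else Finsupp.single (t i) 1) = F fun i => Finsupp.single (t i) 1 := by
    intro J
    induction J using Finset.induction_on with
    | empty => simp
    | insert i J hi ih =>
      rw [← ih, ← sub_eq_zero]
      set y : ι → β →₀ K := fun i => if i ∈ J then s (q (Finsupp.single (t i) 1))
        else Finsupp.single (t i) 1 with hy
      have e : (fun j => if j ∈ insert i J then s (q (Finsupp.single (t j) 1))
          else Finsupp.single (t j) (1 : K)) =
          Function.update y i (s (q (Finsupp.single (t i) 1))) := by
        funext j
        by_cases h : j = i
        · subst h; simp
        · simp [h, hy]
      have e' : y = Function.update y i (Finsupp.single (t i) 1) := by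
        funext j
        by_cases h : j = i
        · subst h; simp [hy, hi]
        · simp [h]
      rw [e]
      nth_rw 2 [e']
      rw [← F.map_update_sub]
      exact hz _ _ _ (by rw [map_sub, hqs, sub_self])
  simpa using key Finset.univ

theorem exists_linear_of_isInternal {V M : Type*} [AddCommGroup V] [Module K V] [AddCommGroup M]
    [Module K M] {gr : ℤ → Submodule K V} (h : DirectSum.IsInternal gr)
    (g : ∀ p, gr p →ₗ[K] M) : ∃ f : V →ₗ[K] M, ∀ p (x : gr p), f x = g p x := by
  let e := LinearEquiv.ofBijective (DirectSum.coeLinearMap gr) h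
  refine ⟨(DirectSum.toModule K ℤ M g).comp e.symm.toLinearMap, fun p x => ?_⟩
  have : e.symm (x : V) = DirectSum.lof K ℤ (fun p => gr p) p x := by
    rw [LinearEquiv.symm_apply_eq]
    exact (DirectSum.coeLinearMap_lof gr p x).symm
  simp [this]

theorem linear_ext_of_isInternal {V M : Type*} [AddCommGroup V] [Module K V] [AddCommGroup M]
    [Module K M] {gr : ℤ → Submodule K V} (h : DirectSum.IsInternal gr) {f g : V →ₗ[K] M}
    (H : ∀ p, ∀ x ∈ gr p, f x = g x) : f = g := by
  refine LinearMap.ext fun x => ?_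
  have hx : x ∈ ⨆ p, gr p := by rw [h.submodule_iSup_eq_top]; trivial
  induction hx using Submodule.iSup_induction' with
  | mem p x hx => exact H p x hx
  | zero => simp
  | add a b _ _ ha hb => rw [map_add, map_add, ha, hb]

end Multilinear

end

section

variable {K : Type u} [Field K] {C : DGOperad K} {X : DGMod K}

section Multilinear

variable {V W M : Type*} {ι : Type*} [AddCommGroup V] [Module K V] [AddCommGroup W] [Module K W]
  [AddCommGroup M] [Module K M]

/-- The linear map that multiplies by the sign `s n` in degree `n`. -/
def twist {gr : ℤ → Submodule K V} (h : DirectSum.IsInternal gr) (s : ℤ → ℤˣ) : V →ₗ[K] V :=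
  (exists_linear_of_isInternal h fun p => (s p : ℤ) • (gr p).subtype).choose

theorem twist_apply {gr : ℤ → Submodule K V} (h : DirectSum.IsInternal gr) (s : ℤ → ℤˣ) {n : ℤ}
    {x : V} (hx : x ∈ gr n) : twist h s x = s n • x :=
  (exists_linear_of_isInternal h fun p => (s p : ℤ) • (gr p).subtype).choose_spec n ⟨x, hx⟩

/-- Fix the last argument of a multilinear map. -/
def evalAt (F : MultilinearMap K (fun _ : ι => V) (W →ₗ[K] M)) (c : W) :
    MultilinearMap K (fun _ : ι => V) M :=
  (LinearMap.applyₗ c).compMultilinearMap F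

@[simp]
theorem evalAt_apply (F : MultilinearMap K (fun _ : ι => V) (W →ₗ[K] M)) (c : W) (x : ι → V) :
    evalAt F c x = F x c := rfl

end Multilinear

/-! ## Maps out of the augmented bar construction -/

section Bar

variable {M : Type*} [AddCommGroup M] [Module K M]

theorem mkQ_eq (x : BTree C X →₀ K) :
    (barRel C X).mkQ x = Finsupp.linearCombination K Bar.cls x := by
  have : (barRel C X).mkQ = Finsupp.linearCombination K Bar.cls :=
    Finsupp.lhom_ext' fun t => LinearMap.ext_ring (by simp [Bar.cls])
  rw [this]

theorem mkQ_eq_zero {x : BTree C X →₀ K} (h : BarRel C X x) : (barRel C X).mkQ x = 0 :=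
  (Submodule.Quotient.mk_eq_zero _).2 h

theorem span_cls : Submodule.span K (Set.range (Bar.cls (C := C) (X := X))) = ⊤ := by
  refine eq_top_iff.2 fun x _ => ?_
  obtain ⟨x, rfl⟩ := (barRel C X).mkQ_surjective x
  rw [mkQ_eq]
  exact Finsupp.mem_span_range_iff_exists_finsupp.2 ⟨x, rfl⟩

/-- The standard way to discharge an `above` clause: show that the value depends linearly on the
class of the varying subtree. -/
theorem linearCombination_eq_zero (g : BTree C X → M) (L : Bar C X →ₗ[K] M)
    (h : ∀ t, g t = L (Bar.cls t)) {x : BTree C X →₀ K} (hx : BarRel C X x) :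
    Finsupp.linearCombination K g x = 0 := by
  have : g = L ∘ Bar.cls := funext h
  rw [this, ← Finsupp.apply_linearCombination, ← mkQ_eq, mkQ_eq_zero hx, map_zero]

theorem bar_ext {f g : Bar C X →ₗ[K] M} (h : ∀ t, f (Bar.cls t) = g (Bar.cls t)) : f = g :=
  LinearMap.ext_on_range span_cls h

theorem linearCombination_mapDomain_node (g : BTree C X → M) (φ : BTree C X → BTree C X)
    (x : BTree C X →₀ K) :
    Finsupp.linearCombination K g (x.mapDomain φ) =
      Finsupp.linearCombination K (fun u => g (φ u)) x := by
  rw [Finsupp.linearCombination_mapDomain]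
  rfl

/-- Induction over the relations: a function on trees that respects them extends to the augmented
bar construction. -/
theorem exists_bar_lift (g : BTree C X → M)
    (leaf_add : ∀ p a b, g (.leaf p (a + b)) = g (.leaf p a) + g (.leaf p b))
    (leaf_smul : ∀ p (r : K) a, g (.leaf p (r • a)) = r • g (.leaf p a))
    (node_add : ∀ k p c c' t, g (.node k p (c + c') t) = g (.node k p c t) + g (.node k p c' t))
    (node_smul : ∀ k p (r : K) c t, g (.node k p (r • c) t) = r • g (.node k p c t))
    (perm : ∀ k p (σ : Equiv.Perm (Fin k)) (c : (C.obj k).gr p) t,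
      g (.node k p ⟨C.act k σ c, C.act_mem σ c.2⟩ t) =
        (koszul (fun i => (t i).deg) σ).negOnePow • g (.node k p c fun i => t (σ i)))
    (above : ∀ k p c t i x, BarRel C X x → Finsupp.linearCombination K g x = 0 →
      Finsupp.linearCombination K (fun u => g (.node k p c (Function.update t i u))) x = 0) :
    ∃ G : Bar C X →ₗ[K] M, ∀ t, G (Bar.cls t) = g t := by
  refine ⟨(barRel C X).liftQ (Finsupp.linearCombination K g) fun x hx => ?_, fun t => ?_⟩
  · rw [LinearMap.mem_ker]
    change BarRel C X x at hx
    induction hx with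
    | zero => simp
    | add hx hy ihx ihy => rw [map_add, ihx, ihy, add_zero]
    | smul r hx ih => rw [map_smul, ih, smul_zero]
    | leaf_add p a b => simp [leaf_add]
    | leaf_smul p r a => simp [leaf_smul]
    | node_add k p c c' t => simp [node_add]
    | node_smul k p r c t => simp [node_smul]
    | perm k p σ c t => simp [perm]
    | above k p c t i hx ih =>
      rw [linearCombination_mapDomain_node]
      exact above k p c t i _ hx ih
  · simp [Bar.cls]

theorem cls_leaf_add (p : ℤ) (a b : X.gr p) :
    Bar.cls (C := C) (.leaf p (a + b)) = Bar.cls (.leaf p a) + Bar.cls (.leaf p b) := by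
  have := mkQ_eq_zero (C := C) (.leaf_add p a b)
  rwa [map_sub, map_sub, sub_sub, sub_eq_zero] at this

theorem cls_leaf_smul (p : ℤ) (r : K) (a : X.gr p) :
    Bar.cls (C := C) (.leaf p (r • a)) = r • Bar.cls (.leaf p a) := by
  have := mkQ_eq_zero (C := C) (.leaf_smul p r a)
  rwa [map_sub, map_smul, sub_eq_zero] at this

theorem cls_node_add (k : ℕ) (p : ℤ) (c c' : (C.obj k).gr p) (t : Fin k → BTree C X) :
    Bar.cls (.node k p (c + c') t) = Bar.cls (.node k p c t) + Bar.cls (.node k p c' t) := by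
  have := mkQ_eq_zero (.node_add k p c c' t)
  rwa [map_sub, map_sub, sub_sub, sub_eq_zero] at this

theorem cls_node_smul (k : ℕ) (p : ℤ) (r : K) (c : (C.obj k).gr p) (t : Fin k → BTree C X) :
    Bar.cls (.node k p (r • c) t) = r • Bar.cls (.node k p c t) := by
  have := mkQ_eq_zero (.node_smul k p r c t)
  rwa [map_sub, map_smul, sub_eq_zero] at this

theorem cls_perm (k : ℕ) (p : ℤ) (σ : Equiv.Perm (Fin k)) (c : (C.obj k).gr p)
    (t : Fin k → BTree C X) :
    Bar.cls (.node k p ⟨C.act k σ c, C.act_mem σ c.2⟩ t) =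
      (koszul (fun i => (t i).deg) σ).negOnePow • Bar.cls (.node k p c fun i => t (σ i)) := by
  have := mkQ_eq_zero (.perm k p σ c t)
  rwa [map_sub, map_unit_smul, sub_eq_zero] at this

theorem cls_above (k : ℕ) (p : ℤ) (c : (C.obj k).gr p) (t : Fin k → BTree C X) (i : Fin k)
    {x : BTree C X →₀ K} (hx : BarRel C X x) :
    Finsupp.linearCombination K (fun u => Bar.cls (.node k p c (Function.update t i u))) x = 0 := by
  have := mkQ_eq_zero (.above k p c t i hx)
  rwa [mkQ_eq, linearCombination_mapDomain_node] at this

/-! ### The grading -/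

theorem deg_update (k : ℕ) (p : ℤ) (c : (C.obj k).gr p) (t : Fin k → BTree C X) (i : Fin k)
    (u : BTree C X) :
    (BTree.node k p c (Function.update t i u)).deg =
      u.deg + (∑ j ∈ Finset.univ \ {i}, (t j).deg + p + 1) := by
  have : (fun j => (Function.update t i u j).deg) =
      Function.update (fun j => (t j).deg) i u.deg := by
    funext j
    by_cases h : j = i
    · subst h; simp
    · simp [h]
  simp only [BTree.deg]
  rw [this, Finset.sum_update_of_mem (Finset.mem_univ i)]
  ring

/-- The decomposition of the augmented bar construction into its homogeneous parts. -/
theorem exists_grading (C : DGOperad K) (X : DGMod K) :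
    ∃ G : Bar C X →ₗ[K] (ℤ →₀ Bar C X),
    ∀ t, G (Bar.cls t) = Finsupp.single t.deg (Bar.cls t) := by
  refine exists_bar_lift (fun t => Finsupp.single t.deg (Bar.cls t)) ?_ ?_ ?_ ?_ ?_ ?_
  · intro p a b
    simp only [BTree.deg, cls_leaf_add, Finsupp.single_add]
  · intro p r a
    simp only [BTree.deg, cls_leaf_smul, Finsupp.smul_single]
  · intro k p c c' t
    simp only [BTree.deg, cls_node_add, Finsupp.single_add]
  · intro k p r c t
    simp only [BTree.deg, cls_node_smul, Finsupp.smul_single]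
  · intro k p σ c t
    simp only [BTree.deg, cls_perm, Equiv.sum_comp σ fun i => (t i).deg]
    exact map_unit_smul (Finsupp.singleAddHom (M := Bar C X) _) _ _
  · intro k p c t i x hx h
    have hs : barRel C X ≤ LinearMap.ker (Finsupp.linearCombination K
        fun u => Bar.cls (.node k p c (Function.update t i u))) :=
      fun y hy => cls_above k p c t i hy
    let s := (barRel C X).liftQ _ hs
    -- Inserting a tree in slot `i` shifts degrees by a constant and is linear on classes, so it
    -- acts linearly on graded classes and preserves the vanishing in `h`.
    let Φ : (ℤ →₀ Bar C X) →ₗ[K] (ℤ →₀ Bar C X) :=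
      (Finsupp.lmapDomain (Bar C X) K
        (fun n : ℤ => n + (∑ j ∈ Finset.univ \ {i}, (t j).deg + p + 1))).comp
      (Finsupp.mapRange.linearMap s)
    have e : (fun u => Finsupp.single (BTree.node k p c (Function.update t i u)).deg
        (Bar.cls (.node k p c (Function.update t i u)))) =
        Φ ∘ fun u : BTree C X => Finsupp.single u.deg (Bar.cls u) := by
      funext u
      have : s (Bar.cls u) = Bar.cls (.node k p c (Function.update t i u)) := by
        simp [s, Bar.cls]
      simp [Φ, deg_update, this, Finsupp.mapDomain_single]
    rw [e, ← Finsupp.apply_linearCombination, h, map_zero]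

theorem cls_mem (t : BTree C X) : Bar.cls t ∈ Bar.gr C X t.deg :=
  Submodule.subset_span ⟨t, rfl, rfl⟩

/-- The map `G` returns the homogeneous components, so its coordinates separate the summands. -/
theorem bar_isInternal (C : DGOperad K) (X : DGMod K) :
    DirectSum.IsInternal (Bar.gr C X) := by
  obtain ⟨G, hG⟩ := exists_grading C X
  have key : ∀ n x, x ∈ Bar.gr C X n → G x = Finsupp.single n x := by
    intro n x hx
    induction hx using Submodule.span_induction with
    | mem x hx => obtain ⟨t, rfl, rfl⟩ := hx; exact hG t
    | zero => simp
    | add a b _ _ ha hb => rw [map_add, ha, hb, Finsupp.single_add]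
    | smul r a _ ha => rw [map_smul, ha, Finsupp.smul_single]
  rw [DirectSum.isInternal_submodule_iff_iSupIndep_and_iSup_eq_top]
  constructor
  · rw [iSupIndep_def]
    intro i
    rw [Submodule.disjoint_def]
    intro x hx hx'
    have h1 : G x i = x := by rw [key i x hx, Finsupp.single_eq_same]
    have h2 : (⨆ j, ⨆ (_ : j ≠ i), Bar.gr C X j) ≤
        LinearMap.ker ((Finsupp.lapply i).comp G) := by
      refine iSup₂_le fun j hj y hy => ?_
      rw [LinearMap.mem_ker, LinearMap.comp_apply, key j y hy, Finsupp.lapply_apply,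
        Finsupp.single_eq_of_ne (Ne.symm hj)]
    rw [← h1]
    exact h2 hx'
  · rw [eq_top_iff, ← span_cls, Submodule.span_le]
    rintro _ ⟨t, rfl⟩
    exact Submodule.mem_iSup_of_mem _ (cls_mem t)

/-! ### Joining trees at a new root -/

/-- Trees carry homogeneous root labels only. The extension is therefore made first in the label, by
the direct sum decomposition of `C.obj k`, and then in the successor trees. -/
theorem exists_node (C : DGOperad K) (X : DGMod K) (k : ℕ) :
    ∃ N : MultilinearMap K (fun _ : Fin k => Bar C X) ((C.obj k).V →ₗ[K] Bar C X),
      ∀ (p : ℤ) (c : (C.obj k).gr p) (t : Fin k → BTree C X),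
        N (fun i => Bar.cls (t i)) c = Bar.cls (.node k p c t) := by
  have h0 : ∀ t : Fin k → BTree C X, ∃ f : (C.obj k).V →ₗ[K] Bar C X,
      ∀ p (c : (C.obj k).gr p), f c = Bar.cls (.node k p c t) := fun t =>
    exists_linear_of_isInternal (C.obj k).isDG.internal fun p =>
      { toFun := fun c => Bar.cls (.node k p c t)
        map_add' := fun c c' => cls_node_add k p c c' t
        map_smul' := fun r c => cls_node_smul k p r c t }
  choose f hf using h0
  obtain ⟨N, hN⟩ := exists_multilinear_descend (barRel C X).mkQ (barRel C X).mkQ_surjective f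
    (fun t i x hx => by
      refine linear_ext_of_isInternal (C.obj k).isDG.internal fun p c hc => ?_
      have e := cls_above k p ⟨c, hc⟩ t i
        ((Submodule.Quotient.mk_eq_zero (barRel C X)).1 hx : x ∈ barRel C X)
      rw [Finsupp.linearCombination_apply, Finsupp.sum] at e ⊢
      simpa [LinearMap.sum_apply, hf _ p ⟨c, hc⟩] using e)
  refine ⟨N, fun p c t => ?_⟩
  rw [← hf]
  exact LinearMap.congr_fun (hN t) c

/-- The multilinear extension of `(t₁, …, tₖ), c ↦ (c; t₁, …, tₖ)`. -/
def N (k : ℕ) : MultilinearMap K (fun _ : Fin k => Bar C X) ((C.obj k).V →ₗ[K] Bar C X) :=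
  (exists_node C X k).choose

theorem N_cls {k : ℕ} {p : ℤ} (c : (C.obj k).gr p) (t : Fin k → BTree C X) :
    N k (fun i => Bar.cls (t i)) c = Bar.cls (.node k p c t) :=
  (exists_node C X k).choose_spec p c t

theorem N_mem {k : ℕ} (p : Fin k → ℤ) {q : ℤ} (x : Fin k → Bar C X) {c : (C.obj k).V}
    (hx : ∀ i, x i ∈ Bar.gr C X (p i)) (hc : c ∈ (C.obj k).gr q) :
    N k x c ∈ Bar.gr C X (∑ i, p i + q + 1) := by
  refine span_pi_induction (K := K) (P := fun x => N k x c ∈ Bar.gr C X (∑ i, p i + q + 1))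
    (S := fun i => {x | ∃ t : BTree C X, t.deg = p i ∧ x = Bar.cls t}) ?_ ?_ ?_ ?_ x hx
  · intro x hx
    choose t ht hx using hx
    obtain rfl : x = fun i => Bar.cls (t i) := funext hx
    have := cls_mem (.node k q ⟨c, hc⟩ t)
    simp only [BTree.deg, ht] at this
    rwa [← N_cls] at this
  · intro x i
    rw [(N k).map_update_zero]
    exact zero_mem _
  · intro x i a b ha hb
    rw [(N k).map_update_add]
    exact add_mem ha hb
  · intro x i r a ha
    rw [(N k).map_update_smul]
    exact Submodule.smul_mem _ _ ha

theorem N_act {k : ℕ} (p : Fin k → ℤ) (σ : Equiv.Perm (Fin k)) (x : Fin k → Bar C X)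
    (c : (C.obj k).V) (hx : ∀ i, x i ∈ Bar.gr C X (p i)) :
    N k x (C.act k σ c) = (koszul p σ).negOnePow • N k (fun i => x (σ i)) c := by
  have hc : c ∈ ⨆ q, (C.obj k).gr q := by
    rw [(C.obj k).isDG.internal.submodule_iSup_eq_top]; trivial
  induction hc using Submodule.iSup_induction' with
  | mem q c hc =>
    have := multilinear_eq_of_span (S := fun i => {x | ∃ t : BTree C X, t.deg = p i ∧ x = Bar.cls t})
      (evalAt (N k) (C.act k σ c))
      (((koszul p σ).negOnePow : ℤ) • (evalAt (N k) c).domDomCongr σ) ?_ x hx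
    · exact this
    · intro x hx
      choose t ht hx using hx
      obtain rfl : x = fun i => Bar.cls (t i) := funext hx
      have e := cls_perm k q σ ⟨c, hc⟩ t
      simp only [← N_cls, ht] at e
      exact e
  | zero => simp
  | add a b _ _ ha hb => rw [map_add, map_add, map_add, ha, hb, smul_add]

theorem N_relabel {n m : ℕ} (p : Fin m → ℤ) (e : Fin n ≃ Fin m) (x : Fin m → Bar C X)
    (c : (C.obj n).V) (hx : ∀ i, x i ∈ Bar.gr C X (p i)) :
    N m x (C.relabel e c) = (koszulEquiv p e).negOnePow • N n (fun i => x (e i)) c := by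
  obtain rfl : n = m := Fin.equiv_iff_eq.1 ⟨e⟩
  exact N_act p e x c hx

theorem relabel_finCongr {n : ℕ} (h : n = n) (c : (C.obj n).V) :
    C.relabel (finCongr h) c = c := by
  change C.act n 1 c = c
  rw [map_one]
  rfl

theorem N_finCongr {n m : ℕ} (h : n = m) (x : Fin m → Bar C X) (c : (C.obj n).V) :
    N m x (C.relabel (finCongr h) c) = N n (fun i => x (finCongr h i)) c := by
  subst h
  rw [relabel_finCongr]
  rfl

end Bar

end

section

variable {K : Type u} [Field K] {C : DGOperad K} {X : DGMod K}

/-! ## The reduced bar construction -/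

/-- The underlying module of the bar construction. -/
abbrev RedBar (C : DGOperad K) (X : DGMod K) : Type u := Bar C X ⧸ Bar.leaves C X

instance : AddCommGroup (RedBar C X) := Submodule.Quotient.addCommGroup _

instance : AddCommMonoid (RedBar C X) := AddCommGroup.toAddCommMonoid

instance : Module K (RedBar C X) := Submodule.Quotient.module _

/-- The projection from the augmented bar construction, which kills the leaves. -/
abbrev proj (C : DGOperad K) (X : DGMod K) : Bar C X →ₗ[K] RedBar C X := (Bar.leaves C X).mkQ

/-- The grading of the bar construction. -/
def RedBar.gr (C : DGOperad K) (X : DGMod K) (n : ℤ) : Submodule K (RedBar C X) :=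
  (Bar.gr C X (n - -1)).map (proj C X)

/-- The class of a corolla in the bar construction. -/
def rcls (y : Corolla C X) : RedBar C X := proj C X (Bar.cls y.tree)

/-- The degree of a corolla in the bar construction. -/
def cdeg (y : Corolla C X) : ℤ := ∑ j, (y.t j).deg + y.p

theorem tree_deg (y : Corolla C X) : y.tree.deg = cdeg y + 1 := rfl

/-- The zero differential makes `Bar` a chain complex before the true one is available, so that the
decomposition can be taken from `quot` and `shift`. -/
theorem redBar_isInternal (C : DGOperad K) (X : DGMod K) :
    DirectSum.IsInternal (RedBar.gr C X) :=
  (((⟨Bar C X, Bar.gr C X, 0, ⟨bar_isInternal C X, by simp, by simp⟩⟩ : DGMod K).quot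
    (Bar.leaves C X) AugBar.leaves_le (by intro x _; simp)).shift (-1)).isDG.internal

theorem proj_mem {n : ℤ} {x : Bar C X} (h : x ∈ Bar.gr C X (n + 1)) :
    proj C X x ∈ RedBar.gr C X n :=
  ⟨x, by rwa [sub_neg_eq_add], rfl⟩

theorem rcls_mem (y : Corolla C X) : rcls y ∈ RedBar.gr C X (cdeg y) := proj_mem (cls_mem y.tree)

theorem proj_leaf (p : ℤ) (a : X.gr p) : proj C X (Bar.cls (.leaf p a)) = 0 :=
  (Submodule.Quotient.mk_eq_zero _).2 (Submodule.subset_span ⟨p, a, rfl⟩)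

theorem proj_node (k : ℕ) (p : ℤ) (c : (C.obj k).gr p) (t : Fin k → BTree C X) :
    proj C X (Bar.cls (.node k p c t)) = rcls ⟨k, p, c, t⟩ := rfl

/-- Signs depend on degrees, so multilinear identities are tested on corollas of prescribed degrees
rather than on all corollas. -/
theorem redBar_gr_le (n : ℤ) :
    RedBar.gr C X n ≤ Submodule.span K {x | ∃ y : Corolla C X, cdeg y = n ∧ x = rcls y} := by
  rw [RedBar.gr, Bar.gr, Submodule.map_span, Submodule.span_le]
  rintro _ ⟨_, ⟨t, ht, rfl⟩, rfl⟩
  cases t with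
  | leaf p a =>
    rw [proj_leaf]
    exact zero_mem _
  | node k p c t =>
    refine Submodule.subset_span ⟨⟨k, p, c, t⟩, ?_, rfl⟩
    have := tree_deg ⟨k, p, c, t⟩
    rw [Corolla.tree] at this
    linarith

theorem span_rcls : Submodule.span K (Set.range (rcls (C := C) (X := X))) = ⊤ := by
  rw [eq_top_iff, ← (redBar_isInternal C X).submodule_iSup_eq_top, iSup_le_iff]
  intro n
  refine (redBar_gr_le n).trans (Submodule.span_mono ?_)
  rintro _ ⟨y, _, rfl⟩
  exact ⟨y, rfl⟩

section

variable {M : Type*} [AddCommGroup M] [Module K M]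

theorem redBar_ext {f g : RedBar C X →ₗ[K] M} (h : ∀ y, f (rcls y) = g (rcls y)) : f = g :=
  LinearMap.ext_on_range span_rcls h

/-- A function on corollas that respects the relations extends to the bar construction. -/
theorem exists_redBar_lift (g : Corolla C X → M)
    (add : ∀ (z : Corolla C X) c',
      g { z with c := z.c + c' } = g z + g { z with c := c' })
    (smul : ∀ (z : Corolla C X) (r : K), g { z with c := r • z.c } = r • g z)
    (perm : ∀ (z : Corolla C X) (σ : Equiv.Perm (Fin z.k)),
      g { z with c := ⟨C.act z.k σ z.c, C.act_mem σ z.c.2⟩ } =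
        (koszul (fun i => (z.t i).deg) σ).negOnePow • g { z with t := fun i => z.t (σ i) })
    (above : ∀ (z : Corolla C X) i x, BarRel C X x →
      Finsupp.linearCombination K (fun u => g { z with t := Function.update z.t i u }) x = 0) :
    ∃ G : RedBar C X →ₗ[K] M, ∀ y, G (rcls y) = g y := by
  -- Extending by zero on leaves makes the lift factor through the quotient.
  obtain ⟨G, hG⟩ := exists_bar_lift (C := C) (X := X)
    (fun t => match t with
      | .leaf _ _ => (0 : M)
      | .node k p c t => g ⟨k, p, c, t⟩)
    (by simp) (by simp) (fun k p c c' t => add ⟨k, p, c, t⟩ c')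
    (fun k p r c t => smul ⟨k, p, c, t⟩ r) (fun k p σ c t => perm ⟨k, p, c, t⟩ σ)
    (fun k p c t i x hx _ => above ⟨k, p, c, t⟩ i x hx)
  refine ⟨(Bar.leaves C X).liftQ G ?_, fun y => ?_⟩
  · refine Submodule.span_le.2 ?_
    rintro _ ⟨p, a, rfl⟩
    exact hG _
  · exact hG y.tree

theorem rcls_surjective :
    Function.Surjective (Finsupp.linearCombination K (rcls (C := C) (X := X))) := by
  rw [← LinearMap.range_eq_top, Finsupp.range_linearCombination, span_rcls]

theorem linearCombination_corolla_eq_zero (g : Corolla C X → M)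
    (h : ∃ G : RedBar C X →ₗ[K] M, ∀ y, G (rcls y) = g y) (x : Corolla C X →₀ K)
    (hx : Finsupp.linearCombination K rcls x = 0) : Finsupp.linearCombination K g x = 0 := by
  obtain ⟨G, hG⟩ := h
  have : g = G ∘ rcls := funext fun y => (hG y).symm
  rw [this, ← Finsupp.apply_linearCombination, hx, map_zero]

end

/-! ### Grafting -/

/-- The operation `x ↦ (γ(c₁, …, cₘ; x); t₁₁, …)`. -/
def graftMap {m : ℕ} (k : Fin m → ℕ) (c : ∀ i, (C.obj (k i)).V) (t : ∀ i, Fin (k i) → Bar C X) :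
    (C.obj m).V →ₗ[K] RedBar C X :=
  (proj C X).comp ((N _ (flat t)).comp (C.γ k c))

theorem graftMap_apply {m : ℕ} (k : Fin m → ℕ) (c : ∀ i, (C.obj (k i)).V)
    (t : ∀ i, Fin (k i) → Bar C X) (x : (C.obj m).V) :
    graftMap k c t x = proj C X (N _ (flat t) (C.γ k c x)) := rfl

theorem flat_update {m : ℕ} {k : Fin m → ℕ} {W : Type*} (t : ∀ i, Fin (k i) → W) (i : Fin m)
    (l : Fin (k i)) (w : W) :
    flat (Function.update t i (Function.update (t i) l w)) =
      Function.update (flat t) (finSigmaFinEquiv ⟨i, l⟩) w := by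
  funext s
  obtain ⟨⟨j, r⟩, rfl⟩ := finSigmaFinEquiv.surjective s
  rw [flat_apply]
  by_cases h : j = i
  · subst h
    by_cases h : r = l
    · subst h; simp
    · have : (⟨j, r⟩ : Σ i, Fin (k i)) ≠ ⟨j, l⟩ := by simpa using h
      simp [h, this]
  · have : (⟨j, r⟩ : Σ i, Fin (k i)) ≠ ⟨i, l⟩ := fun e => h (congrArg Sigma.fst e)
    simp [h, this]

/-- `graftMap` as a linear function of the `l`-th tree above the `i`-th vertex. -/
def graftSlot {m : ℕ} (k : Fin m → ℕ) (c : ∀ i, (C.obj (k i)).V) (t : ∀ i, Fin (k i) → Bar C X)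
    (i : Fin m) (l : Fin (k i)) : Bar C X →ₗ[K] ((C.obj m).V →ₗ[K] RedBar C X) :=
  ((LinearMap.llcomp K _ _ _ (proj C X)).comp ((LinearMap.lcomp K _ (C.γ k c)))).comp
    ((N _).toLinearMap (flat t) (finSigmaFinEquiv ⟨i, l⟩))

theorem graftSlot_apply {m : ℕ} (k : Fin m → ℕ) (c : ∀ i, (C.obj (k i)).V)
    (t : ∀ i, Fin (k i) → Bar C X) (i : Fin m) (l : Fin (k i)) (w : Bar C X) :
    graftSlot k c t i l w =
      graftMap k c (Function.update t i (Function.update (t i) l w)) := by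
  unfold graftSlot graftMap
  rw [flat_update]
  rfl

theorem graftMap_perm {m : ℕ} (k : Fin m → ℕ) (c : ∀ i, (C.obj (k i)).V)
    (q : ∀ i, Fin (k i) → ℤ) (t : ∀ i, Fin (k i) → Bar C X)
    (ht : ∀ i j, t i j ∈ Bar.gr C X (q i j)) (τ : ∀ i, Equiv.Perm (Fin (k i))) :
    graftMap k (fun i => C.act (k i) (τ i) (c i)) t =
      (∑ i, koszul (q i) (τ i)).negOnePow • graftMap k c (fun i j => t i (τ i j)) := by
  refine LinearMap.ext fun x => ?_
  rw [LinearMap.smul_apply, graftMap_apply, graftMap_apply, C.act_γ,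
    N_act (flat q) _ (flat t) _ fun s => ht _ _, koszul_blocks, map_unit_smul]
  congr 4
  funext s
  obtain ⟨a, rfl⟩ := finSigmaFinEquiv.surjective s
  simp only [Equiv.trans_apply, Equiv.symm_apply_apply, flat_apply]
  rfl

theorem koszul_one {n : ℕ} (p : Fin n → ℤ) : koszul p 1 = 0 :=
  Finset.sum_eq_zero fun _ _ => Finset.sum_eq_zero fun _ _ => if_neg fun h => lt_asymm h.1 h.2

/-- The value of the grafting operation on corollas. -/
def graftFun {m : ℕ} (y : Fin m → Corolla C X) : (C.obj m).V →ₗ[K] RedBar C X :=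
  (shuffle (fun i => (y i).p) (fun i => ∑ j, ((y i).t j).deg)).negOnePow •
    graftMap (fun i => (y i).k) (fun i => (y i).c) (fun i j => Bar.cls ((y i).t j))

theorem graftFun_update_c {m : ℕ} (y : Fin m → Corolla C X) (i : Fin m)
    (c : (C.obj (y i).k).gr (y i).p) :
    graftFun (Function.update y i { y i with c := c }) =
      (shuffle (fun i => (y i).p) (fun i => ∑ j, ((y i).t j).deg)).negOnePow •
        graftMap (fun i => (y i).k) (Function.update (fun i => ((y i).c : (C.obj (y i).k).V)) i c)
          (fun i j => Bar.cls ((y i).t j)) := by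
  have e : Function.update y i { y i with c := c } =
      fun j => ⟨(y j).k, (y j).p, Function.update (fun i => (y i).c) i c j, (y j).t⟩ := by
    funext j
    by_cases h : j = i
    · subst h; simp
    · simp [h]
  have e' : Function.update (fun i => ((y i).c : (C.obj (y i).k).V)) i c =
      fun j => ((Function.update (fun i => (y i).c) i c j : (C.obj (y j).k).gr (y j).p) :
        (C.obj (y j).k).V) := by
    funext j
    by_cases h : j = i
    · subst h; simp
    · simp [h]
  rw [e, e']
  rfl

theorem graftFun_update_t {m : ℕ} (y : Fin m → Corolla C X) (i : Fin m)
    (t : Fin (y i).k → BTree C X) :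
    graftFun (Function.update y i { y i with t := t }) =
      (shuffle (fun i => (y i).p)
          (Function.update (fun i => ∑ j, ((y i).t j).deg) i (∑ j, (t j).deg))).negOnePow •
        graftMap (fun i => (y i).k) (fun i => ((y i).c : (C.obj (y i).k).V))
          (Function.update (fun i j => Bar.cls ((y i).t j)) i fun j => Bar.cls (t j)) := by
  have e : Function.update y i { y i with t := t } =
      fun j => ⟨(y j).k, (y j).p, (y j).c, Function.update (fun i => (y i).t) i t j⟩ := by
    funext j
    by_cases h : j = i
    · subst h; simp
    · simp [h]
  have e1 : Function.update (fun i => ∑ j, ((y i).t j).deg) i (∑ j, (t j).deg) =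
      fun l => ∑ j, (Function.update (fun i => (y i).t) i t l j).deg := by
    funext j
    by_cases h : j = i
    · subst h; simp
    · simp [h]
  have e2 : Function.update (fun i j => Bar.cls ((y i).t j)) i (fun j => Bar.cls (t j)) =
      fun l j => Bar.cls (Function.update (fun i => (y i).t) i t l j) := by
    funext j
    by_cases h : j = i
    · subst h; simp
    · simp [h]
  rw [e, e1, e2]
  rfl

/-- Isolates the dependence of the grafting sign on the degree `a` of one tree above the `i`-th
vertex. -/
theorem shuffle_update_add {k : ℕ} (p q : Fin k → ℤ) (i : Fin k) (a b : ℤ) :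
    shuffle p (Function.update q i (a + b)) =
      (∑ j with j < i, p j) * a + shuffle p (Function.update q i b) := by
  unfold shuffle
  rw [Finset.sum_filter, Finset.sum_mul, ← Finset.sum_add_distrib]
  refine Finset.sum_congr rfl fun j _ => ?_
  rw [← Finset.sum_erase_add _ _ (Finset.mem_univ i),
    ← Finset.sum_erase_add Finset.univ
      (fun l => if j < l then p j * Function.update q i b l else 0) (Finset.mem_univ i),
      add_left_comm]
  congr 1
  · refine Finset.sum_congr rfl fun l hl => ?_
    simp [Finset.ne_of_mem_erase hl]
  · simp only [Function.update_self]
    split_ifs <;> ring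

theorem graftFun_lift {m : ℕ} (y : Fin m → Corolla C X) (i : Fin m) :
    ∃ G : RedBar C X →ₗ[K] ((C.obj m).V →ₗ[K] RedBar C X),
      ∀ z, G (rcls z) = graftFun (Function.update y i z) := by
  refine exists_redBar_lift _ ?_ ?_ ?_ ?_
  · intro z c
    -- Only the entries of `y` other than the `i`-th matter, so one may assume that `z` is that
    -- entry; the update formulas then apply.
    obtain ⟨y, rfl, hy⟩ : ∃ y', z = y' i ∧ ∀ z, Function.update y i z = Function.update y' i z :=
      ⟨Function.update y i z, by simp, by simp⟩
    have h0 : graftFun (Function.update y i (y i)) = _ := graftFun_update_c y i (y i).c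
    simp only [hy, graftFun_update_c]
    rw [h0, ← smul_add]
    congr 1
    refine LinearMap.ext fun x => ?_
    simp only [LinearMap.add_apply, graftMap_apply, Submodule.coe_add, MultilinearMap.map_update_add,
      map_add]
  · intro z r
    obtain ⟨y, rfl, hy⟩ : ∃ y', z = y' i ∧ ∀ z, Function.update y i z = Function.update y' i z :=
      ⟨Function.update y i z, by simp, by simp⟩
    have h0 : graftFun (Function.update y i (y i)) = _ := graftFun_update_c y i (y i).c
    simp only [hy, graftFun_update_c]
    rw [h0, smul_comm r]
    congr 1
    refine LinearMap.ext fun x => ?_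
    simp only [LinearMap.smul_apply, graftMap_apply, Submodule.coe_smul,
      MultilinearMap.map_update_smul, map_smul]
  · intro z σ
    obtain ⟨y, rfl, hy⟩ : ∃ y', z = y' i ∧ ∀ z, Function.update y i z = Function.update y' i z :=
      ⟨Function.update y i z, by simp, by simp⟩
    simp only [hy, graftFun_update_c, graftFun_update_t]
    rw [Equiv.sum_comp σ fun j => ((y i).t j).deg, Function.update_eq_self, smul_comm]
    congr 1
    -- The permutation acts in the `i`-th block only, so a single Koszul exponent survives in
    -- `graftMap_perm`.
    let τ : ∀ j, Equiv.Perm (Fin (y j).k) := Function.update (fun _ => 1) i σ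
    have hτ : ∀ j, j ≠ i → τ j = 1 := fun j h => by simp [τ, h]
    have hτi : τ i = σ := by simp [τ]
    have e := graftMap_perm (fun i => (y i).k) (fun i => ((y i).c : (C.obj (y i).k).V))
      (fun i j => ((y i).t j).deg) (fun i j => Bar.cls ((y i).t j)) (fun i j => cls_mem _) τ
    rw [Finset.sum_eq_single i (fun j _ h => by rw [hτ j h, koszul_one]) (by simp), hτi] at e
    convert e using 2
    · funext j
      by_cases h : j = i
      · subst h; simp [hτi]
      · simp [h, hτ j h]
    · congr 1
      funext j
      by_cases h : j = i
      · subst h; simp [hτi]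
      · simp [h, hτ j h]
  · intro z l x hx
    obtain ⟨y, rfl, hy⟩ : ∃ y', z = y' i ∧ ∀ z, Function.update y i z = Function.update y' i z :=
      ⟨Function.update y i z, by simp, by simp⟩
    -- The sign depends on the degree of the varying tree. Absorbing it in a `twist` makes the value
    -- linear on `Bar`, while `S` collects what does not depend on that tree.
    let s : ℤ → ℤˣ := fun n => ((∑ j with j < i, (y j).p) * n).negOnePow
    let S : ℤˣ := (shuffle (fun i => (y i).p) (Function.update (fun i => ∑ j, ((y i).t j).deg) i
      (∑ j ∈ Finset.univ \ {l}, ((y i).t j).deg))).negOnePow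
    refine linearCombination_eq_zero _ ((S : ℤ) • (graftSlot (fun i => (y i).k)
      (fun i => ((y i).c : (C.obj (y i).k).V)) (fun i j => Bar.cls ((y i).t j)) i l).comp
        (twist (bar_isInternal C X) s)) (fun u => ?_) hx
    have e1 : (fun j => (Function.update (y i).t l u j).deg) =
        Function.update (fun j => ((y i).t j).deg) l u.deg := by
      funext j
      by_cases h : j = l
      · subst h; simp
      · simp [h]
    have e2 : (fun j => Bar.cls (Function.update (y i).t l u j)) =
        Function.update (fun j => Bar.cls ((y i).t j)) l (Bar.cls u) := by
      funext j
      by_cases h : j = l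
      · subst h; simp
      · simp [h]
    rw [hy, graftFun_update_t, e1, e2, Finset.sum_update_of_mem (Finset.mem_univ l),
      shuffle_update_add, Int.negOnePow_add, LinearMap.smul_apply, LinearMap.comp_apply,
      twist_apply _ _ (cls_mem u), map_unit_smul, graftSlot_apply, ← Units.smul_def, smul_smul,
      mul_comm]

theorem exists_graftOp (C : DGOperad K) (X : DGMod K) (m : ℕ) :
    ∃ F : MultilinearMap K (fun _ : Fin m => RedBar C X) ((C.obj m).V →ₗ[K] RedBar C X),
      ∀ y : Fin m → Corolla C X, F (fun i => rcls (y i)) = graftFun y := by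
  obtain ⟨F, hF⟩ := exists_multilinear_descend (Finsupp.linearCombination K rcls)
    rcls_surjective (graftFun (C := C) (X := X) (m := m))
    (fun y i x hx => linearCombination_corolla_eq_zero _ (graftFun_lift y i) x hx)
  refine ⟨F, fun y => ?_⟩
  rw [← hF]
  simp

/-- The operations of the operad on the bar construction, given by grafting. -/
def graftOp (m : ℕ) :
    MultilinearMap K (fun _ : Fin m => RedBar C X) ((C.obj m).V →ₗ[K] RedBar C X) :=
  (exists_graftOp C X m).choose

theorem graftOp_rcls {m : ℕ} (y : Fin m → Corolla C X) :
    graftOp m (fun i => rcls (y i)) = graftFun y :=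
  (exists_graftOp C X m).choose_spec y

end

section

variable {K : Type u} [Field K] {C : DGOperad K} {X : DGMod K}

/-! ## The operad action on the bar construction -/

theorem graftFun_apply {m : ℕ} (y : Fin m → Corolla C X) (x : (C.obj m).V) :
    graftFun y x = (shuffle (fun i => (y i).p) (fun i => ∑ j, ((y i).t j).deg)).negOnePow •
      proj C X (N _ (flat fun i j => Bar.cls ((y i).t j))
        (C.γ (fun i => (y i).k) (fun i => (y i).c) x)) := rfl

theorem graftFun_apply_of_mem {m : ℕ} (y : Fin m → Corolla C X) {q : ℤ} (x : (C.obj m).gr q) :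
    graftFun y x = (shuffle (fun i => (y i).p) (fun i => ∑ j, ((y i).t j).deg)).negOnePow •
      rcls (Corolla.graft y x) := by
  rw [graftFun_apply]
  congr 1
  exact congrArg (proj C X) (N_cls (Corolla.graft y x).c (Corolla.graft y x).t)

theorem cdeg_graft {m : ℕ} (y : Fin m → Corolla C X) {q : ℤ} (x : (C.obj m).gr q) :
    cdeg (Corolla.graft y x) = ∑ i, cdeg (y i) + q := by
  have : ∑ j, ((Corolla.graft y x).t j).deg = ∑ i, ∑ j, ((y i).t j).deg :=
    sum_flat fun i j => ((y i).t j).deg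
  simp only [cdeg, this, Finset.sum_add_distrib]
  exact (add_assoc _ _ _).symm

theorem graftOp_mem {m : ℕ} (p : Fin m → ℤ) (q : ℤ) (x : Fin m → RedBar C X) (c : (C.obj m).V)
    (hx : ∀ i, x i ∈ RedBar.gr C X (p i)) (hc : c ∈ (C.obj m).gr q) :
    graftOp m x c ∈ RedBar.gr C X (∑ i, p i + q) := by
  refine span_pi_induction (K := K) (P := fun x => graftOp m x c ∈ RedBar.gr C X (∑ i, p i + q))
    (S := fun i => {x | ∃ y : Corolla C X, cdeg y = p i ∧ x = rcls y}) ?_ ?_ ?_ ?_ x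
    fun i => redBar_gr_le _ (hx i)
  · intro x hx
    choose y hy hx using hx
    obtain rfl : x = fun i => rcls (y i) := funext hx
    rw [graftOp_rcls]
    have e := graftFun_apply_of_mem y ⟨c, hc⟩
    rw [show graftFun y c = _ from e]
    refine unit_smul_mem _ _ ?_
    have := rcls_mem (Corolla.graft y ⟨c, hc⟩)
    simpa only [cdeg_graft, hy] using this
  · intro x i
    rw [(graftOp m).map_update_zero]
    exact zero_mem _
  · intro x i a b ha hb
    rw [(graftOp m).map_update_add]
    exact add_mem ha hb
  · intro x i r a ha
    rw [(graftOp m).map_update_smul]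
    exact Submodule.smul_mem _ _ ha

theorem graftOp_one (a : RedBar C X) : graftOp 1 (fun _ => a) C.one = a := by
  have : (MultilinearMap.ofSubsingleton K (RedBar C X) (RedBar C X) (0 : Fin 1)).symm
      (evalAt (graftOp 1) C.one) = LinearMap.id := by
    refine redBar_ext fun y => ?_
    change graftOp 1 (fun _ => rcls y) C.one = rcls y
    rw [graftOp_rcls (fun _ : Fin 1 => y), graftFun_apply]
    have e : shuffle (fun _ : Fin 1 => y.p) (fun _ => ∑ j, (y.t j).deg) = 0 := by
      simp [shuffle]
    rw [e, Int.negOnePow_zero, one_smul]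
    have h := C.γ_one (n := y.k) (y.c : (C.obj y.k).V)
    rw [h]
    refine (congrArg (proj C X) (N_finCongr _ _ _)).trans ?_
    refine (congrArg (proj C X) ?_).trans (congrArg (proj C X) (N_cls y.c y.t))
    refine congrArg (fun t => N y.k t (y.c : (C.obj y.k).V)) ?_
    funext j
    have e : finCongr (show y.k = ∑ _i : Fin 1, y.k by simp) j =
        finSigmaFinEquiv (n := fun _ : Fin 1 => y.k) ⟨0, j⟩ := by
      apply Fin.ext
      rw [finSigmaFinEquiv_one]
      rfl
    exact (congrArg _ e).trans (flat_apply _ _)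
  exact LinearMap.congr_fun this a

/-- On corollas the operad axiom gives the Koszul sign of the root labels and `N_relabel` that of
the blocks of trees; `koszul_add` combines these with the two grafting signs. -/
theorem graftOp_act {n : ℕ} (p : Fin n → ℤ) (σ : Equiv.Perm (Fin n)) (x : Fin n → RedBar C X)
    (c : (C.obj n).V) (hx : ∀ i, x i ∈ RedBar.gr C X (p i)) :
    graftOp n x (C.act n σ c) = (koszul p σ).negOnePow • graftOp n (fun i => x (σ i)) c := by
  refine multilinear_eq_of_span
    (S := fun i => {x | ∃ y : Corolla C X, cdeg y = p i ∧ x = rcls y})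
    (evalAt (graftOp n) (C.act n σ c))
    (((koszul p σ).negOnePow : ℤ) • (evalAt (graftOp n) c).domDomCongr σ) ?_ x
    fun i => redBar_gr_le _ (hx i)
  intro x hx
  choose y hy hx using hx
  obtain rfl : x = fun i => rcls (y i) := funext hx
  change graftOp n (fun i => rcls (y i)) (C.act n σ c) =
    (koszul p σ).negOnePow • graftOp n (fun i => rcls (y (σ i))) c
  rw [graftOp_rcls, graftOp_rcls fun i => y (σ i), graftFun_apply, graftFun_apply,
    C.γ_act _ (fun i => (y i).p) σ _ _ (fun i => (y i).c.2)]
  have hflat : ∀ s, flat (fun i j => Bar.cls ((y i).t j)) s ∈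
      Bar.gr C X (flat (fun i j => ((y i).t j).deg) s) := fun s => cls_mem _
  rw [map_unit_smul, map_unit_smul, N_relabel _ _ _ _ hflat, map_unit_smul, koszulEquiv_blocks,
    smul_smul, smul_smul, smul_smul, ← Int.negOnePow_add, ← Int.negOnePow_add,
    ← Int.negOnePow_add]
  congr 1
  · refine negOnePow_congr ?_
    have hp : p = fun i => (∑ j, ((y i).t j).deg) + (y i).p := funext fun i => (hy i).symm
    have := koszul_add (fun i => (y i).p) (fun i => ∑ j, ((y i).t j).deg) σ
    rw [hp]
    simp only [add_comm _ (y _).p]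
    push_cast at this ⊢
    rw [this]
    linear_combination -(shuffle (fun i => (y (σ i)).p)
      (fun i => ∑ j, ((y (σ i)).t j).deg) : ZMod 2) * (CharTwo.two_eq_zero (R := ZMod 2))
  · refine congrArg (proj C X) (congrArg (fun t => N _ t _) ?_)
    funext s
    obtain ⟨a, rfl⟩ := finSigmaFinEquiv.surjective s
    simp only [Equiv.trans_apply, Equiv.symm_apply_apply, flat_apply]
    rfl

theorem graftOp_γ {k : ℕ} (m : Fin k → ℕ) (r : ∀ i, Fin (m i) → ℤ) (p : Fin k → ℤ)
    (a : ∀ i, Fin (m i) → RedBar C X) (x : ∀ i, (C.obj (m i)).V) (z : (C.obj k).V)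
    (ha : ∀ i j, a i j ∈ RedBar.gr C X (r i j)) (hx : ∀ i, x i ∈ (C.obj (m i)).gr (p i)) :
    graftOp (∑ i, m i) (flat a) (C.γ m x z) =
      (shuffle p (fun i => ∑ j, r i j)).negOnePow •
        graftOp k (fun i => graftOp (m i) (a i) (x i)) z := by
  -- Changing one entry of the double family changes one inner product on the right and, by `upd'`,
  -- one flattened entry on the left. So both sides are multilinear in that family and it suffices
  -- to treat corollas.
  have upd : ∀ (b : (Σ i, Fin (m i)) → RedBar C X) (s : Σ i, Fin (m i)) (v : RedBar C X),
      (fun i => graftOp (m i) (fun j => Function.update b s v ⟨i, j⟩) (x i)) =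
        Function.update (fun i => graftOp (m i) (fun j => b ⟨i, j⟩) (x i)) s.1
          (graftOp (m s.1) (Function.update (fun j => b ⟨s.1, j⟩) s.2 v) (x s.1)) := by
    rintro b ⟨i, j⟩ v
    funext l
    by_cases h : l = i
    · subst h
      rw [Function.update_self]
      congr 2
      funext j'
      by_cases h : j' = j
      · subst h; simp
      · have : (⟨l, j'⟩ : Σ i, Fin (m i)) ≠ ⟨l, j⟩ := by simpa using h
        simp [h, this]
    · rw [Function.update_of_ne h]
      congr 2
      funext j'
      have : (⟨l, j'⟩ : Σ i, Fin (m i)) ≠ ⟨i, j⟩ := fun e => h (congrArg Sigma.fst e)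
      simp [this]
  have upd' : ∀ (b : (Σ i, Fin (m i)) → RedBar C X) (s : Σ i, Fin (m i)) (v : RedBar C X),
      (fun l => Function.update b s v (finSigmaFinEquiv.symm l)) =
        Function.update (fun l => b (finSigmaFinEquiv.symm l)) (finSigmaFinEquiv s) v := by
    intro b s v
    funext l
    obtain ⟨l, rfl⟩ := finSigmaFinEquiv.surjective l
    by_cases h : l = s
    · subst h; simp
    · simp [h]
  refine span_pi_induction (K := K) (ι := Σ i, Fin (m i))
    (P := fun b => graftOp (∑ i, m i) (fun l => b (finSigmaFinEquiv.symm l)) (C.γ m x z) =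
      (shuffle p (fun i => ∑ j, r i j)).negOnePow •
        graftOp k (fun i => graftOp (m i) (fun j => b ⟨i, j⟩) (x i)) z)
    (S := fun s => {x | ∃ y : Corolla C X, cdeg y = r s.1 s.2 ∧ x = rcls y}) ?_ ?_ ?_ ?_
    (fun s => a s.1 s.2) fun s => redBar_gr_le _ (ha s.1 s.2)
  · intro b hb
    choose y' hy hb using hb
    obtain ⟨y, rfl⟩ : ∃ y : ∀ i, Fin (m i) → Corolla C X, y' = fun s => y s.1 s.2 :=
      ⟨fun i j => y' ⟨i, j⟩, rfl⟩
    obtain rfl : b = fun s => rcls (y s.1 s.2) := funext hb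
    have e1 : ∀ i, graftOp (m i) (fun j => rcls (y i j)) (x i) =
        (shuffle (fun j => (y i j).p) (fun j => ∑ l, ((y i j).t l).deg)).negOnePow •
          rcls (Corolla.graft (y i) ⟨x i, hx i⟩) := fun i => by
      rw [graftOp_rcls]
      exact graftFun_apply_of_mem (y i) ⟨x i, hx i⟩
    simp only [e1]
    rw [map_unit_smul_univ, graftOp_rcls (fun i => Corolla.graft (y i) ⟨x i, hx i⟩),
      graftOp_rcls (fun l => y (finSigmaFinEquiv.symm l).1 (finSigmaFinEquiv.symm l).2),
      LinearMap.smul_apply, graftFun_apply, graftFun_apply, prod_negOnePow]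
    have hγ := C.γ_assoc m (fun i j => (y i j).k) (fun i j => (y i j).p) p
      (fun i j => ((y i j).c : (C.obj (y i j).k).V)) x z (fun i j => (y i j).c.2) hx
    rw [hγ, map_unit_smul, map_unit_smul, smul_smul, smul_smul, smul_smul, ← Int.negOnePow_add,
      ← Int.negOnePow_add, ← Int.negOnePow_add]
    congr 1
    -- After splitting into blocks, the sign for moving the labels `x` past the trees occurs twice
    -- on the right and disappears mod 2.
    · have h1 := shuffle_flat (fun i j => (y i j).p) (fun i j => ∑ l, ((y i j).t l).deg)
      have h2 : ∀ i, ∑ s, ((Corolla.graft (y i) ⟨x i, hx i⟩).t s).deg =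
          ∑ j, ∑ l, ((y i j).t l).deg := fun i => sum_flat fun j l => ((y i j).t l).deg
      have h3 : ∀ i, ∑ j, r i j = ∑ j, (y i j).p + ∑ j, ∑ l, ((y i j).t l).deg := by
        intro i
        rw [← Finset.sum_add_distrib]
        refine Finset.sum_congr rfl fun j _ => ?_
        rw [← hy ⟨i, j⟩, cdeg, add_comm]
      have h4 : ∀ i, (Corolla.graft (y i) ⟨x i, hx i⟩).p = ∑ j, (y i j).p + p i := fun i => rfl
      unfold flat at h1
      simp only [h1, h2, h3, h4, shuffle_add_left, shuffle_add_right]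
      refine negOnePow_congr ?_
      push_cast
      linear_combination -(shuffle p (fun i => ∑ j, ∑ l, ((y i j).t l).deg) : ZMod 2) *
        (CharTwo.two_eq_zero (R := ZMod 2))
    · refine congrArg (proj C X) ((N_finCongr _ _ _).trans (congrArg (fun t => N _ t _) ?_))
      funext s
      exact flat_flat (fun i j => (y i j).k) (fun i j l => Bar.cls ((y i j).t l)) s
  · intro b s
    rw [upd, upd', (graftOp _).map_update_zero, LinearMap.zero_apply, (graftOp _).map_update_zero,
      LinearMap.zero_apply, (graftOp k).map_update_zero, LinearMap.zero_apply, smul_zero]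
  · intro b s v w hv hw
    rw [upd, upd'] at hv hw ⊢
    rw [(graftOp _).map_update_add, (graftOp _).map_update_add, LinearMap.add_apply,
      LinearMap.add_apply, (graftOp k).map_update_add, LinearMap.add_apply, smul_add, hv, hw]
  · intro b s c v hv
    rw [upd, upd'] at hv ⊢
    rw [(graftOp _).map_update_smul, (graftOp _).map_update_smul, LinearMap.smul_apply,
      LinearMap.smul_apply, (graftOp k).map_update_smul, LinearMap.smul_apply, smul_comm _ c, hv]

/-! ### Generators -/

/-- The inclusion of generators `t ↦ (1; t)`. -/
def eta (C : DGOperad K) (X : DGMod K) : Bar C X →ₗ[K] RedBar C X :=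
  (proj C X).comp ((MultilinearMap.ofSubsingleton K (Bar C X) (Bar C X) (0 : Fin 1)).symm
    (evalAt (N 1) C.one))

theorem eta_apply (x : Bar C X) : eta C X x = proj C X (N 1 (fun _ => x) C.one) := rfl

theorem eta_cls (t : BTree C X) : eta C X (Bar.cls t) = rcls (Corolla.unit t) :=
  congrArg (proj C X) (N_cls ⟨C.one, C.one_mem⟩ fun _ => t)

theorem eta_mem {n : ℤ} {x : Bar C X} (h : x ∈ Bar.gr C X n) : eta C X x ∈ RedBar.gr C X n := by
  have := N_mem (fun _ : Fin 1 => n) (fun _ => x) (fun _ => h) C.one_mem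
  rw [show ∑ _i : Fin 1, n + 0 + 1 = n + 1 by simp] at this
  exact proj_mem this

/-- By the unit axiom γ(1,…,1; c) = c, with no sign since the unit has degree 0. Hence every corolla
is a product of generators, which reduces later claims to `eta`. -/
theorem graftOp_eta {k : ℕ} (x : Fin k → Bar C X) (c : (C.obj k).V) :
    graftOp k (fun i => eta C X (x i)) c = proj C X (N k x c) := by
  let F : MultilinearMap K (fun _ : Fin k => Bar C X) (RedBar C X) :=
    (evalAt (graftOp (C := C) (X := X) k) c).compLinearMap fun _ => eta C X
  let G : MultilinearMap K (fun _ : Fin k => Bar C X) (RedBar C X) :=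
    (proj C X).compMultilinearMap (evalAt (N k) c)
  have : F = G := by
    refine multilinear_ext_of_span (S := fun _ => Set.range (Bar.cls (C := C) (X := X)))
      (fun _ => span_cls (C := C) (X := X)) F G
      fun x hx => ?_
    choose t ht using hx
    obtain rfl : (fun i => Bar.cls (t i)) = x := funext ht
    change graftOp k (fun i => eta C X (Bar.cls (t i))) c =
      proj C X (N k (fun i => Bar.cls (t i)) c)
    simp only [eta_cls]
    rw [graftOp_rcls, graftFun_apply]
    have e : shuffle (fun i => (Corolla.unit (t i)).p)
        (fun i => ∑ j, ((Corolla.unit (t i)).t j).deg) = 0 := by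
      simp [shuffle, Corolla.unit]
    rw [e, Int.negOnePow_zero, one_smul]
    refine congrArg (proj C X) ((congrArg _ (C.one_γ c)).trans ((N_finCongr _ _ _).trans
      (congrArg (fun t => N k t c) ?_)))
    funext i
    have e : finCongr (show k = ∑ _i : Fin k, 1 by simp) i =
        finSigmaFinEquiv (n := fun _ : Fin k => 1) ⟨i, 0⟩ := by
      apply Fin.ext
      rw [finSigmaFinEquiv_apply]
      simp
    exact (congrArg _ e).trans (flat_apply _ _)
  exact congrArg (fun F => F x) this

end

section

variable {K : Type u} [Field K] {C : DGOperad K} {X : DGMod K}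

/-! ## Leaves -/

theorem exists_val (C : DGOperad K) (X : DGMod K) :
    ∃ G : Bar C X →ₗ[K] X.V, ∀ t : BTree C X, G (Bar.cls t) = t.val :=
  exists_bar_lift _ (fun _ _ _ => rfl) (fun _ _ _ => rfl) (fun _ _ _ _ _ => (add_zero _).symm)
    (fun _ _ _ _ _ => (smul_zero _).symm) (fun _ _ _ _ _ => (smul_zero _).symm)
    (fun _ _ _ _ _ _ _ _ => by simp [BTree.val, Finsupp.linearCombination_apply])

/-- The projection from the augmented bar construction to the leaves. -/
def val (C : DGOperad K) (X : DGMod K) : Bar C X →ₗ[K] X.V := (exists_val C X).choose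

theorem val_cls (t : BTree C X) : val C X (Bar.cls t) = t.val := (exists_val C X).choose_spec t

theorem val_node (k : ℕ) (x : Fin k → Bar C X) (c : (C.obj k).V) : val C X (N k x c) = 0 := by
  have h : ∀ t : Fin k → BTree C X, (val C X).comp (N k fun i => Bar.cls (t i)) = 0 := by
    intro t
    refine linear_ext_of_isInternal (C.obj k).isDG.internal fun p c hc => ?_
    rw [LinearMap.comp_apply, N_cls ⟨c, hc⟩, val_cls]
    rfl
  let F : MultilinearMap K (fun _ : Fin k => Bar C X) X.V :=
    (val C X).compMultilinearMap (evalAt (N k) c)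
  have : F = 0 := by
    refine multilinear_ext_of_span (S := fun _ => Set.range (Bar.cls (C := C) (X := X)))
      (fun _ => span_cls (C := C) (X := X)) F 0 fun x hx => ?_
    choose t ht using hx
    obtain rfl : (fun i => Bar.cls (t i)) = x := funext ht
    exact LinearMap.congr_fun (h t) c
  exact congrArg (fun F => F x) this

theorem exists_incl (C : DGOperad K) (X : DGMod K) :
    ∃ G : X.V →ₗ[K] Bar C X, ∀ p (a : X.gr p), G a = Bar.cls (.leaf p a) :=
  exists_linear_of_isInternal X.isDG.internal fun p =>
    { toFun := fun a => Bar.cls (.leaf p a)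
      map_add' := cls_leaf_add p
      map_smul' := cls_leaf_smul p }

/-- The inclusion of the leaves. -/
def incl (C : DGOperad K) (X : DGMod K) : X.V →ₗ[K] Bar C X := (exists_incl C X).choose

theorem incl_apply {p : ℤ} (a : X.gr p) : incl C X a = Bar.cls (.leaf p a) :=
  (exists_incl C X).choose_spec p a

theorem val_incl (a : X.V) : val C X (incl C X a) = a := by
  have : (val C X).comp (incl C X) = LinearMap.id :=
    linear_ext_of_isInternal X.isDG.internal fun p a ha => by
      rw [LinearMap.comp_apply, show incl C X a = _ from incl_apply ⟨a, ha⟩, val_cls]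
      rfl
  exact LinearMap.congr_fun this a

theorem proj_incl (a : X.V) : proj C X (incl C X a) = 0 := by
  have : (proj C X).comp (incl C X) = 0 :=
    linear_ext_of_isInternal X.isDG.internal fun p a ha => by
      rw [LinearMap.comp_apply, show incl C X a = _ from incl_apply ⟨a, ha⟩, proj_leaf]
      rfl
  exact LinearMap.congr_fun this a

theorem eq_incl_of_proj_eq_zero {x : Bar C X} (h : proj C X x = 0) :
    x = incl C X (val C X x) := by
  have hx : x ∈ Bar.leaves C X := (Submodule.Quotient.mk_eq_zero _).1 h
  have hle : Bar.leaves C X ≤ LinearMap.ker (LinearMap.id - (incl C X).comp (val C X)) := by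
    refine Submodule.span_le.2 ?_
    rintro _ ⟨p, a, rfl⟩
    simp only [SetLike.mem_coe, LinearMap.mem_ker, LinearMap.sub_apply, LinearMap.id_apply,
      LinearMap.comp_apply, val_cls, BTree.val, incl_apply, sub_self]
  exact sub_eq_zero.1 (hle hx)

/-- The splitting into leaves and the rest; identities in `Bar` are proved one component at a time.
-/
theorem bar_eq {x y : Bar C X} (h1 : proj C X x = proj C X y) (h2 : val C X x = val C X y) :
    x = y := by
  rw [← sub_eq_zero, eq_incl_of_proj_eq_zero (x := x - y) (by rw [map_sub, h1, sub_self]),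
    map_sub, h2, sub_self, map_zero]

/-! ### Signs -/

/-- The sign `(-1)ⁿ` on the augmented bar construction. -/
def sgB (C : DGOperad K) (X : DGMod K) : Bar C X →ₗ[K] Bar C X :=
  twist (bar_isInternal C X) Int.negOnePow

/-- The sign `(-1)ⁿ` on the bar construction. -/
def sgR (C : DGOperad K) (X : DGMod K) : RedBar C X →ₗ[K] RedBar C X :=
  twist (redBar_isInternal C X) Int.negOnePow

theorem sgB_apply {n : ℤ} {x : Bar C X} (h : x ∈ Bar.gr C X n) : sgB C X x = n.negOnePow • x :=
  twist_apply _ _ h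

theorem sgR_apply {n : ℤ} {x : RedBar C X} (h : x ∈ RedBar.gr C X n) :
    sgR C X x = n.negOnePow • x :=
  twist_apply _ _ h

/-- The minus sign is the degree shift of the bar construction. -/
theorem sgR_proj (x : Bar C X) : sgR C X (proj C X x) = -proj C X (sgB C X x) := by
  have : (sgR C X).comp (proj C X) = -((proj C X).comp (sgB C X)) :=
    linear_ext_of_isInternal (bar_isInternal C X) fun n x hx => by
      have h : proj C X x ∈ RedBar.gr C X (n - 1) := proj_mem (by rwa [sub_add_cancel])
      rw [LinearMap.comp_apply, sgR_apply h, LinearMap.neg_apply, LinearMap.comp_apply,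
        sgB_apply hx, map_unit_smul, Int.negOnePow_sub, Int.negOnePow_one, mul_neg, mul_one,
        Units.neg_smul]
  exact LinearMap.congr_fun this x

/-! ## The projection to the algebra -/

section mu

variable (A : C.Alg)

/-- No case distinction is needed: `BTree.val` vanishes on non-leaves, so the multilinear `θ`
vanishes unless the tree is a bush. -/
theorem exists_mu : ∃ G : RedBar C A.X →ₗ[K] A.X.V,
    ∀ y : Corolla C A.X, G (rcls y) = A.str.θ y.k (fun i => (y.t i).val) y.c := by
  refine exists_redBar_lift _ (fun z c => ?_) (fun z r => ?_) (fun z σ => ?_)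
    (fun z i x hx => ?_)
  · exact map_add _ _ _
  · exact map_smul _ _ _
  · exact A.str.θ_act _ σ _ _ fun i => (z.t i).val_mem
  · refine linearCombination_eq_zero _ (((evalAt (A.str.θ z.k) (z.c : (C.obj z.k).V)).toLinearMap
      (fun i => (z.t i).val) i).comp (val C A.X)) (fun u => ?_) hx
    have e : (fun j => (Function.update z.t i u j).val) =
        Function.update (fun j => (z.t j).val) i u.val :=
      funext fun j => Function.apply_update (fun _ => BTree.val) z.t i u j
    rw [LinearMap.comp_apply, val_cls, MultilinearMap.toLinearMap_apply, evalAt_apply, ← e]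

/-- The projection from the bar construction to the algebra. -/
def mu : RedBar C A.X →ₗ[K] A.X.V := (exists_mu A).choose

theorem mu_rcls (y : Corolla C A.X) :
    mu A (rcls y) = A.str.θ y.k (fun i => (y.t i).val) y.c := (exists_mu A).choose_spec y

theorem mu_proj_N {k : ℕ} (t : Fin k → BTree C A.X) (c : (C.obj k).V) :
    mu A (proj C A.X (N k (fun i => Bar.cls (t i)) c)) = A.str.θ k (fun i => (t i).val) c := by
  have h : ((mu A).comp (proj C A.X)).comp (N k fun i => Bar.cls (t i)) =
      A.str.θ k (fun i => (t i).val) := by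
    refine linear_ext_of_isInternal (C.obj k).isDG.internal fun p c hc => ?_
    rw [LinearMap.comp_apply, LinearMap.comp_apply, N_cls ⟨c, hc⟩, proj_node, mu_rcls]
  exact LinearMap.congr_fun h c

theorem mu_eta (x : Bar C A.X) : mu A (eta C A.X x) = val C A.X x := by
  have : (mu A).comp (eta C A.X) = val C A.X := bar_ext fun t => by
    rw [LinearMap.comp_apply, eta_cls, mu_rcls, val_cls]
    exact A.str.θ_one t.val
  exact LinearMap.congr_fun this x

/-- On corollas this is associativity of `θ`, whose shuffle sign equals the grafting sign and
cancels it. -/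
theorem mu_graftOp {m : ℕ} (x : Fin m → RedBar C A.X) (c : (C.obj m).V) :
    mu A (graftOp m x c) = A.str.θ m (fun i => mu A (x i)) c := by
  let F : MultilinearMap K (fun _ : Fin m => RedBar C A.X) A.X.V :=
    (mu A).compMultilinearMap (evalAt (graftOp m) c)
  let G : MultilinearMap K (fun _ : Fin m => RedBar C A.X) A.X.V :=
    (evalAt (A.str.θ m) c).compLinearMap fun _ => mu A
  have : F = G := by
    refine multilinear_ext_of_span (S := fun _ => Set.range (rcls (C := C) (X := A.X)))
      (fun _ => span_rcls (C := C) (X := A.X)) F G fun x hx => ?_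
    choose y hy using hx
    obtain rfl : (fun i => rcls (y i)) = x := funext hy
    change mu A (graftOp m (fun i => rcls (y i)) c) = A.str.θ m (fun i => mu A (rcls (y i))) c
    simp only [mu_rcls]
    have h := A.str.θ_γ (fun i => (y i).k) (fun i j => ((y i).t j).deg) (fun i => (y i).p)
      (fun i j => ((y i).t j).val) (fun i => (y i).c) c (fun i j => ((y i).t j).val_mem)
      (fun i => (y i).c.2)
    rw [graftOp_rcls, graftFun_apply, map_unit_smul]
    have e := mu_proj_N A (flat fun i j => (y i).t j) (C.γ (fun i => (y i).k) (fun i => (y i).c) c)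
    refine (congrArg _ (e.trans h)).trans ?_
    rw [smul_smul, Int.units_mul_self, one_smul]
  exact congrArg (fun F => F x) this

end mu

end

section

variable {K : Type u} [Field K] {C : DGOperad K} (A : C.Alg)

/-! ## The differential -/

/-- The class of the differential of a tree. -/
def dTree (t : BTree C A.X) : Bar C A.X := (barRel C A.X).mkQ (t.diff A)

theorem update_cls {k : ℕ} {W : Type*} (g : BTree C A.X → W) (t : Fin k → BTree C A.X) (i : Fin k)
    (u : BTree C A.X) :
    (fun j => g (Function.update t i u j)) = Function.update (fun j => g (t j)) i (g u) :=
  funext fun j => Function.apply_update (fun _ => g) t i u j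

theorem mkQ_mapDomain_node {k : ℕ} {p : ℤ} (c : (C.obj k).gr p) (t : Fin k → BTree C A.X)
    (i : Fin k) (x : BTree C A.X →₀ K) :
    (barRel C A.X).mkQ (x.mapDomain fun u => .node k p c (Function.update t i u)) =
      N k (Function.update (fun j => Bar.cls (t j)) i ((barRel C A.X).mkQ x)) c := by
  rw [mkQ_eq, linearCombination_mapDomain_node, mkQ_eq]
  have e : (fun u => Bar.cls (BTree.node k p c (Function.update t i u))) =
      (evalAt (N k) (c : (C.obj k).V)).toLinearMap (fun j => Bar.cls (t j)) i ∘ Bar.cls := by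
    funext u
    rw [← N_cls, update_cls]
    rfl
  rw [e, ← Finsupp.apply_linearCombination]
  rfl

theorem dTree_leaf (p : ℤ) (a : A.X.gr p) :
    dTree A (.leaf p a) = Bar.cls (.leaf (p - 1) ⟨A.X.d a, A.X.isDG.map_gr a.2⟩) := rfl

theorem dTree_node {k : ℕ} {p : ℤ} (c : (C.obj k).gr p) (t : Fin k → BTree C A.X) :
    dTree A (.node k p c t) =
      ∑ i, (∑ j with j < i, (t j).deg).negOnePow •
        N k (Function.update (fun j => Bar.cls (t j)) i (dTree A (t i))) c
      + (∑ j, (t j).deg).negOnePow • N k (fun j => Bar.cls (t j)) ((C.obj k).d c)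
      + ∑ i, (barRel C A.X).mkQ (BTree.edgeTerm c t i)
      + (barRel C A.X).mkQ (BTree.leafTerm A c t) := by
  unfold dTree
  rw [BTree.diff]
  simp only [map_add, map_sum, map_unit_smul, mkQ_mapDomain_node]
  congr 3
  exact congrArg _ (N_cls (⟨(C.obj k).d c, (C.obj k).isDG.map_gr c.2⟩ : (C.obj k).gr (p - 1))
    t).symm

theorem mkQ_edgeTerm_eq {k : ℕ} {p : ℤ} (c : (C.obj k).gr p) (t : Fin k → BTree C A.X)
    (i : Fin k) :
    (∃ q a, t i = .leaf q a ∧ (barRel C A.X).mkQ (BTree.edgeTerm c t i) = 0) ∨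
    ∃ m q c' u, t i = .node m q c' u ∧ (barRel C A.X).mkQ (BTree.edgeTerm c t i) =
      (∑ j with j ≤ i, (t j).deg + q * ∑ j with i < j, (t j).deg).negOnePow •
        Bar.cls (Corolla.graft (Function.update (fun j => Corolla.unit (t j)) i
          ⟨m, q, c', u⟩) c).tree := by
  unfold BTree.edgeTerm
  split
  · exact .inl ⟨_, _, by assumption, map_zero _⟩
  · exact .inr ⟨_, _, _, _, by assumption, map_unit_smul _ _ _⟩

theorem cdeg_unit (t : BTree C A.X) : cdeg (Corolla.unit t) = t.deg := by
  change ∑ _j : Fin 1, t.deg + 0 = t.deg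
  simp

theorem sum_update_sub {k : ℕ} (q : Fin k → ℤ) (i : Fin k) (b : ℤ) :
    ∑ j, Function.update q i b j = ∑ j, q j - q i + b := by
  rw [Finset.sum_update_of_mem (Finset.mem_univ i), ← Finset.sum_erase_add _ _ (Finset.mem_univ i),
    Finset.sdiff_singleton_eq_erase]
  ring

theorem dTree_mem (t : BTree C A.X) : dTree A t ∈ Bar.gr C A.X (t.deg - 1) := by
  induction t with
  | leaf p a => exact cls_mem (.leaf (p - 1) ⟨A.X.d a, A.X.isDG.map_gr a.2⟩)
  | node k p c t ih =>
    have hdeg : (BTree.node k p c t).deg = ∑ i, (t i).deg + p + 1 := rfl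
    rw [dTree_node]
    refine add_mem (add_mem (add_mem (sum_mem fun i _ => unit_smul_mem _ _ ?_)
      (unit_smul_mem _ _ ?_)) (sum_mem fun i _ => ?_)) ?_
    · have := N_mem (Function.update (fun j => (t j).deg) i ((t i).deg - 1))
        (Function.update (fun j => Bar.cls (t j)) i (dTree A (t i))) (fun j => by
          by_cases h : j = i
          · subst h; simpa using ih j
          · simpa [h] using cls_mem (t j)) c.2
      rw [sum_update_sub] at this
      rw [hdeg]
      convert this using 2
      ring
    · have := N_mem (fun j => (t j).deg) (fun j => Bar.cls (t j)) (fun j => cls_mem (t j))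
        ((C.obj k).isDG.map_gr c.2)
      rw [hdeg]
      convert this using 2
      ring
    · rcases mkQ_edgeTerm_eq A c t i with ⟨q, a, _, h⟩ | ⟨m, q, c', u, h', h⟩
      · rw [h]
        exact zero_mem _
      · rw [h]
        refine unit_smul_mem _ _ ?_
        have e : (Corolla.graft (Function.update (fun j => Corolla.unit (t j)) i
            ⟨m, q, c', u⟩) c).tree.deg = (BTree.node k p c t).deg - 1 := by
          have h1 : (fun j => cdeg (Function.update (fun j => Corolla.unit (t j)) i
              ⟨m, q, c', u⟩ j)) =
              Function.update (fun j => (t j).deg) i (cdeg (⟨m, q, c', u⟩ : Corolla C A.X)) := by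
            simp only [← cdeg_unit]
            exact funext fun j => Function.apply_update (fun _ => cdeg)
              (fun j => Corolla.unit (t j)) i _ j
          have h2 : (t i).deg = cdeg (⟨m, q, c', u⟩ : Corolla C A.X) + 1 := by rw [h']; rfl
          rw [tree_deg, cdeg_graft, h1, sum_update_sub, h2, hdeg]
          ring
        rw [← e]
        exact cls_mem _
    · unfold BTree.leafTerm
      split_ifs
      · rw [map_unit_smul]
        refine unit_smul_mem _ _ ?_
        rw [hdeg, add_sub_cancel_right]
        exact cls_mem (.leaf _ _)
      · rw [map_zero]
        exact zero_mem _

/-- Only the differential of a leaf and the contraction of a bush produce leaves, and the sign of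
the latter is the parity of the degree in the bar construction. This is the cone description of the
augmented construction. -/
theorem val_dTree (t : BTree C A.X) :
    val C A.X (dTree A t) = A.X.d (val C A.X (Bar.cls t)) +
      mu A (sgR C A.X (proj C A.X (Bar.cls t))) := by
  cases t with
  | leaf p a =>
    rw [proj_leaf, map_zero, map_zero, add_zero, dTree_leaf, val_cls, val_cls]
    rfl
  | node k p c t =>
    have h1 : ∀ i, val C A.X ((barRel C A.X).mkQ (BTree.edgeTerm c t i)) = 0 := by
      intro i
      rcases mkQ_edgeTerm_eq A c t i with ⟨q, a, _, h⟩ | ⟨m, q, c', u, h', h⟩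
      · rw [h, map_zero]
      · rw [h, map_unit_smul, val_cls]
        exact smul_zero _
    rw [dTree_node]
    simp only [map_add, map_sum, map_unit_smul, val_node, smul_zero, Finset.sum_const_zero, h1,
      zero_add]
    rw [val_cls, proj_node, sgR_apply (rcls_mem _), map_unit_smul, mu_rcls]
    change _ = A.X.d 0 + _
    rw [map_zero, zero_add]
    unfold BTree.leafTerm
    split_ifs with h
    · rw [map_unit_smul, map_unit_smul]
      congr 1
      exact val_cls _
    · rw [map_zero, map_zero]
      push Not at h
      obtain ⟨i, hi⟩ := h
      have : A.str.θ k (fun i => (t i).val) = 0 := by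
        refine MultilinearMap.map_coord_zero _ i ?_
        cases hti : t i with
        | leaf p a => rw [hti] at hi; exact absurd trivial hi
        | node => rfl
      rw [this, LinearMap.zero_apply, smul_zero]

/-- The value of the differential of the bar construction on the generator `(1; t)`. -/
def dGen (t : BTree C A.X) : RedBar C A.X :=
  eta C A.X (dTree A t) + t.deg.negOnePow • proj C A.X (Bar.cls t)

theorem dGen_mem (t : BTree C A.X) : dGen A t ∈ RedBar.gr C A.X (t.deg - 1) :=
  add_mem (eta_mem (dTree_mem A t))
    (unit_smul_mem _ _ (proj_mem (by rw [sub_add_cancel]; exact cls_mem t)))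

/-- Contracting the i-th edge grafts `t i` itself in place of the generator (1; `t i`). The other
root labels are units of degree 0, so the grafting sign is exactly the part of the contraction sign
that involves the label of `t i`. -/
theorem proj_edgeTerm {k : ℕ} {p : ℤ} (c : (C.obj k).gr p) (t : Fin k → BTree C A.X)
    (i : Fin k) :
    proj C A.X ((barRel C A.X).mkQ (BTree.edgeTerm c t i)) =
      (∑ j with j ≤ i, (t j).deg).negOnePow •
        graftOp k (Function.update (fun j => eta C A.X (Bar.cls (t j))) i
          (proj C A.X (Bar.cls (t i)))) c := by
  rcases mkQ_edgeTerm_eq A c t i with ⟨q, a, h', h⟩ | ⟨m, q, c', u, h', h⟩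
  · rw [h, h', proj_leaf, (graftOp k).map_update_zero, map_zero, LinearMap.zero_apply, smul_zero]
  · rw [h, h', proj_node, map_unit_smul]
    have e : Function.update (fun j => eta C A.X (Bar.cls (t j))) i (rcls ⟨m, q, c', u⟩) =
        fun j => rcls (Function.update (fun j => Corolla.unit (t j)) i ⟨m, q, c', u⟩ j) := by
      funext j
      by_cases h : j = i
      · subst h; simp
      · simp [h, eta_cls]
    rw [e, graftOp_rcls, graftFun_apply_of_mem, smul_smul, ← Int.negOnePow_add]
    congr 2
    have e1 : ∀ j, (Function.update (fun j => Corolla.unit (t j)) i ⟨m, q, c', u⟩ j).p =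
        if j = i then q else 0 := by
      intro j
      by_cases h : j = i
      · subst h; simp
      · simp [h, Corolla.unit]
    have e2 : ∀ j, i < j → ∑ l, ((Function.update (fun j => Corolla.unit (t j)) i
        ⟨m, q, c', u⟩ j).t l).deg = (t j).deg := by
      intro j h
      rw [Function.update_of_ne h.ne']
      exact Fin.sum_univ_one _
    congr 1
    unfold shuffle
    refine Eq.symm ((Finset.sum_eq_single i ?_ (by simp)).trans ?_)
    · intro j _ h
      refine Finset.sum_eq_zero fun l _ => ?_
      simp only [e1, if_neg h, zero_mul, ite_self]
    · rw [Finset.sum_filter, Finset.mul_sum]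
      refine Finset.sum_congr rfl fun j _ => ?_
      split_ifs with h
      · simp only [e1, if_true, e2 j h]
      · rw [mul_zero]

theorem proj_leafTerm {k : ℕ} {p : ℤ} (c : (C.obj k).gr p) (t : Fin k → BTree C A.X) :
    proj C A.X ((barRel C A.X).mkQ (BTree.leafTerm A c t)) = 0 := by
  unfold BTree.leafTerm
  split_ifs
  · rw [map_unit_smul, map_unit_smul]
    exact (congrArg _ (proj_leaf _ _)).trans (smul_zero _)
  · rw [map_zero, map_zero]

theorem eta_update {k : ℕ} (x : Fin k → Bar C A.X) (i : Fin k) (v : Bar C A.X) :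
    (fun j => eta C A.X (Function.update x i v j)) =
      Function.update (fun j => eta C A.X (x j)) i (eta C A.X v) :=
  funext fun j => Function.apply_update (fun _ => eta C A.X) x i v j

/-- The differential is, up to leaves, a derivation determined by its values on generators. -/
theorem proj_dTree_node {k : ℕ} {p : ℤ} (c : (C.obj k).gr p) (t : Fin k → BTree C A.X) :
    proj C A.X (dTree A (.node k p c t)) =
      ∑ i, (∑ j with j < i, (t j).deg).negOnePow •
        graftOp k (Function.update (fun j => eta C A.X (Bar.cls (t j))) i (dGen A (t i))) c
      + (∑ j, (t j).deg).negOnePow •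
        graftOp k (fun j => eta C A.X (Bar.cls (t j))) ((C.obj k).d c) := by
  rw [dTree_node]
  simp only [map_add, map_sum, map_unit_smul, proj_edgeTerm, proj_leafTerm, add_zero, ← graftOp_eta,
    eta_update]
  -- For each i, the differential inside `t i` and the contraction of the edge below it change the
  -- same slot, and together they form `dGen`.
  rw [add_right_comm, ← Finset.sum_add_distrib]
  congr 1
  refine Finset.sum_congr rfl fun i _ => ?_
  rw [dGen, (graftOp k).map_update_add, LinearMap.add_apply, smul_add]
  congr 1
  have := update_unit_smul (evalAt (graftOp k) (c : (C.obj k).V))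
    (fun j => eta C A.X (Bar.cls (t j))) i (t i).deg.negOnePow (proj C A.X (Bar.cls (t i)))
  simp only [evalAt_apply] at this
  rw [this, smul_smul, ← Int.negOnePow_add]
  congr 2
  have e : Finset.univ.filter (fun j => j ≤ i) = insert i (Finset.univ.filter fun j => j < i) := by
    ext j
    simp [le_iff_eq_or_lt]
  rw [e, Finset.sum_insert (by simp), add_comm]

end

section

variable {K : Type u} [Field K] {C : DGOperad K} (A : C.Alg)

/-! ### The differential respects the relations -/

theorem deg_update_erase {k : ℕ} (t : Fin k → BTree C A.X) (i : Fin k) (u : BTree C A.X)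
    (s : Finset (Fin k)) :
    (∑ j ∈ s, (Function.update t i u j).deg).negOnePow =
      (if i ∈ s then u.deg.negOnePow else 1) * (∑ j ∈ s.erase i, (t j).deg).negOnePow := by
  have e : ∑ j ∈ s.erase i, (Function.update t i u j).deg = ∑ j ∈ s.erase i, (t j).deg :=
    Finset.sum_congr rfl fun j hj => by rw [Function.update_of_ne (Finset.ne_of_mem_erase hj)]
  split_ifs with h
  · rw [← Finset.add_sum_erase _ _ h, e, Function.update_self, Int.negOnePow_add]
  · rw [← e, Finset.erase_eq_of_notMem h, one_mul]

/-- The part of the differential in the bar construction is a linear function of each successor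
tree and its differential. -/
theorem exists_proj_dTree_update {k : ℕ} {p : ℤ} (c : (C.obj k).gr p) (t : Fin k → BTree C A.X)
    (i : Fin k) : ∃ L L' : Bar C A.X →ₗ[K] RedBar C A.X, ∀ u,
      proj C A.X (dTree A (.node k p c (Function.update t i u))) =
        L (dTree A u) + L' (Bar.cls u) := by
  let x : Fin k → RedBar C A.X := fun j => eta C A.X (Bar.cls (t j))
  let T : (C.obj k).V → (Fin k → RedBar C A.X) → RedBar C A.X →ₗ[K] RedBar C A.X :=
    fun c x => (evalAt (graftOp (C := C) (X := A.X) k) c).toLinearMap x i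
  -- `E s` is the sign of the total degree over `s` as a linear operator on slot `i`: a constant
  -- sign, times the parity of the varying tree when `i ∈ s`.
  let S : Finset (Fin k) → ℤ := fun s => (∑ j ∈ s.erase i, (t j).deg).negOnePow
  let E : Finset (Fin k) → Bar C A.X →ₗ[K] Bar C A.X :=
    fun s => S s • if i ∈ s then sgB C A.X else LinearMap.id
  have hE : ∀ (s : Finset (Fin k)) (u : BTree C A.X), E s (Bar.cls u) =
      (∑ j ∈ s, (Function.update t i u j).deg).negOnePow • Bar.cls u := by
    intro s u
    rw [deg_update_erase, mul_comm, mul_smul]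
    simp only [E, S, LinearMap.smul_apply, Units.smul_def]
    split_ifs
    · rw [sgB_apply (cls_mem u), Units.smul_def]
    · simp
  have hT : ∀ c x v, T c x v = graftOp k (Function.update x i v) c := fun _ _ _ => rfl
  let F : Fin k → Finset (Fin k) := fun j => Finset.univ.filter fun l => l < j
  -- Only the i-th summand involves the differential of the varying tree, which gives `L`. The edge
  -- term of that summand, the other summands and the differentiated root label make up `L'`.
  refine ⟨((T c x).comp (eta C A.X)).comp (S (F i) • LinearMap.id),
    ((T c x).comp (proj C A.X)).comp ((S (F i) • LinearMap.id).comp (sgB C A.X)) +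
      ∑ j ∈ Finset.univ.erase i, ((T c (Function.update x j (dGen A (t j)))).comp
        (eta C A.X)).comp (E (F j)) +
      ((T ((C.obj k).d c) x).comp (eta C A.X)).comp (E Finset.univ), fun u => ?_⟩
  simp only [LinearMap.add_apply, LinearMap.sum_apply, LinearMap.comp_apply, hE]
  rw [proj_dTree_node, ← Finset.add_sum_erase _ _ (Finset.mem_univ i), ← add_assoc, ← add_assoc]
  have hx : (fun j => eta C A.X (Bar.cls (Function.update t i u j))) =
      Function.update x i (eta C A.X (Bar.cls u)) :=
    update_cls A (fun t => eta C A.X (Bar.cls t)) t i u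
  congr 1
  · congr 1
    · have hi : i ∉ F i := by simp [F]
      have h1 : (∑ j with j < i, (Function.update t i u j).deg).negOnePow =
          (∑ j ∈ (F i).erase i, (t j).deg).negOnePow := by
        have := deg_update_erase A t i u (F i)
        rwa [if_neg hi, one_mul] at this
      rw [h1, hx, Function.update_idem, Function.update_self, dGen, ← hT]
      simp only [S, LinearMap.smul_apply, LinearMap.id_apply, ← Units.smul_def,
        sgB_apply (cls_mem u), map_add, map_unit_smul, smul_add]
      rw [smul_comm u.deg.negOnePow]
    · refine Finset.sum_congr rfl fun j hj => ?_
      have hj := Finset.ne_of_mem_erase hj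
      rw [hx, Function.update_of_ne hj, Function.update_comm (Ne.symm hj), ← hT, map_unit_smul,
        map_unit_smul]
  · rw [hx, ← hT, map_unit_smul, map_unit_smul]

/-- Equivariance of grafting, applied to each summand of the derivation formula; `koszul_sub_single`
matches the signs. -/
theorem proj_dTree_perm {k : ℕ} {p : ℤ} (σ : Equiv.Perm (Fin k)) (c : (C.obj k).gr p)
    (t : Fin k → BTree C A.X) :
    proj C A.X (dTree A (.node k p ⟨C.act k σ c, C.act_mem σ c.2⟩ t)) =
      (koszul (fun i => (t i).deg) σ).negOnePow •
        proj C A.X (dTree A (.node k p c fun i => t (σ i))) := by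
  set x : Fin k → RedBar C A.X := fun j => eta C A.X (Bar.cls (t j)) with hx
  have hxm : ∀ j, x j ∈ RedBar.gr C A.X (t j).deg := fun j => eta_mem (cls_mem (t j))
  rw [proj_dTree_node, proj_dTree_node, smul_add, Finset.smul_sum, ← C.act_d]
  congr 1
  · rw [← Equiv.sum_comp σ]
    refine Finset.sum_congr rfl fun l _ => ?_
    have hm : ∀ j, Function.update x (σ l) (dGen A (t (σ l))) j ∈ RedBar.gr C A.X
        (((fun i => (t i).deg) - Pi.single (σ l) 1 : Fin k → ℤ) j) := by
      intro j
      by_cases h : j = σ l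
      · subst h
        simpa using dGen_mem A (t (σ l))
      · simpa [h] using hxm j
    have e : (fun j => Function.update x (σ l) (dGen A (t (σ l))) (σ j)) =
        Function.update (fun j => x (σ j)) l (dGen A (t (σ l))) := by
      funext j
      by_cases h : j = l
      · subst h; simp
      · simp [h, σ.injective.ne h]
    have h := graftOp_act _ σ _ (c : (C.obj k).V) hm
    rw [e] at h
    refine (congrArg _ h).trans ?_
    rw [smul_smul, smul_smul, ← Int.negOnePow_add, ← Int.negOnePow_add]
    congr 1
    exact negOnePow_congr (koszul_sub_single (fun i => (t i).deg) σ l)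
  · rw [graftOp_act _ σ x _ hxm, smul_comm, Equiv.sum_comp σ fun j => (t j).deg]

theorem exists_d : ∃ d : Bar C A.X →ₗ[K] Bar C A.X, ∀ t, d (Bar.cls t) = dTree A t := by
  let V : Bar C A.X →ₗ[K] A.X.V :=
    A.X.d.comp (val C A.X) + ((mu A).comp (sgR C A.X)).comp (proj C A.X)
  have hV : ∀ t, val C A.X (dTree A t) = V (Bar.cls t) := val_dTree A
  refine exists_bar_lift _ ?_ ?_ ?_ ?_ ?_ ?_
  · intro p a b
    simp only [dTree_leaf, ← cls_leaf_add]
    congr 2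
    exact Subtype.ext (map_add _ _ _)
  · intro p r a
    simp only [dTree_leaf, ← cls_leaf_smul]
    congr 2
    exact Subtype.ext (map_smul _ _ _)
  · intro k p c c' t
    refine bar_eq ?_ ?_
    · simp only [map_add, proj_dTree_node, Submodule.coe_add, smul_add, Finset.sum_add_distrib]
      abel
    · rw [map_add, hV, hV, hV, cls_node_add, map_add]
  · intro k p r c t
    refine bar_eq ?_ ?_
    · simp only [map_smul, proj_dTree_node, Submodule.coe_smul, smul_add, Finset.smul_sum,
        smul_comm r]
    · rw [map_smul, hV, hV, cls_node_smul, map_smul]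
  · intro k p σ c t
    refine bar_eq ?_ ?_
    · rw [proj_dTree_perm, map_unit_smul]
    · rw [map_unit_smul, hV, hV, cls_perm, map_unit_smul]
  · intro k p c t i x hx h
    refine bar_eq ?_ ?_
    -- The `L` part vanishes by the induction hypothesis `h`, the `L'` part because `x` is itself a
    -- relation.
    · obtain ⟨L, L', hL⟩ := exists_proj_dTree_update A c t i
      rw [map_zero, Finsupp.apply_linearCombination]
      have e : (proj C A.X ∘ fun u => dTree A (.node k p c (Function.update t i u))) =
          (L ∘ dTree A) + (L' ∘ Bar.cls) := funext hL
      have e2 : Finsupp.linearCombination K ((L ∘ dTree A) + (L' ∘ Bar.cls)) x =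
          Finsupp.linearCombination K (L ∘ dTree A) x +
            Finsupp.linearCombination K (L' ∘ Bar.cls) x := by
        simp [Finsupp.linearCombination_apply, Finsupp.sum, Finset.sum_add_distrib]
      rw [e, e2, ← Finsupp.apply_linearCombination, ← Finsupp.apply_linearCombination, h,
        ← mkQ_eq, mkQ_eq_zero hx, map_zero, map_zero, add_zero]
    · rw [map_zero, Finsupp.apply_linearCombination]
      have e : (val C A.X ∘ fun u => dTree A (.node k p c (Function.update t i u))) =
          V ∘ fun u => Bar.cls (.node k p c (Function.update t i u)) := funext fun u => hV _
      rw [e, ← Finsupp.apply_linearCombination, cls_above k p c t i hx, map_zero]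

/-- The differential of the augmented bar construction. -/
def dBar : Bar C A.X →ₗ[K] Bar C A.X := (exists_d A).choose

theorem dBar_cls (t : BTree C A.X) : dBar A (Bar.cls t) = dTree A t := (exists_d A).choose_spec t

theorem dBar_mem {n : ℤ} {x : Bar C A.X} (h : x ∈ Bar.gr C A.X n) :
    dBar A x ∈ Bar.gr C A.X (n - 1) := by
  have : Bar.gr C A.X n ≤ (Bar.gr C A.X (n - 1)).comap (dBar A) := by
    refine Submodule.span_le.2 ?_
    rintro _ ⟨t, rfl, rfl⟩
    rw [SetLike.mem_coe, Submodule.mem_comap, dBar_cls]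
    exact dTree_mem A t
  exact this h

theorem leaves_le_comap_dBar : Bar.leaves C A.X ≤ (Bar.leaves C A.X).comap (dBar A) := by
  refine Submodule.span_le.2 ?_
  rintro _ ⟨p, a, rfl⟩
  exact Submodule.subset_span ⟨p - 1, ⟨A.X.d a, A.X.isDG.map_gr a.2⟩, dBar_cls A _⟩

theorem dBar_incl (a : A.X.V) : dBar A (incl C A.X a) = incl C A.X (A.X.d a) := by
  have : (dBar A).comp (incl C A.X) = (incl C A.X).comp A.X.d :=
    linear_ext_of_isInternal A.X.isDG.internal fun p a ha => by
      rw [LinearMap.comp_apply, show incl C A.X a = _ from incl_apply ⟨a, ha⟩, dBar_cls,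
        dTree_leaf, ← incl_apply]
      rfl
  exact LinearMap.congr_fun this a

theorem val_dBar (x : Bar C A.X) :
    val C A.X (dBar A x) = A.X.d (val C A.X x) + mu A (sgR C A.X (proj C A.X x)) := by
  have : (val C A.X).comp (dBar A) =
      A.X.d.comp (val C A.X) + ((mu A).comp (sgR C A.X)).comp (proj C A.X) :=
    bar_ext fun t => (congrArg _ (dBar_cls A t)).trans (val_dTree A t)
  exact LinearMap.congr_fun this x

/-- The differential of the bar construction. -/
def dRed : RedBar C A.X →ₗ[K] RedBar C A.X :=
  (Bar.leaves C A.X).mapQ (Bar.leaves C A.X) (dBar A) (leaves_le_comap_dBar A)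

theorem dRed_proj (x : Bar C A.X) : dRed A (proj C A.X x) = proj C A.X (dBar A x) := rfl

theorem dRed_mem {n : ℤ} {x : RedBar C A.X} (h : x ∈ RedBar.gr C A.X n) :
    dRed A x ∈ RedBar.gr C A.X (n - 1) := by
  obtain ⟨x, hx, rfl⟩ := h
  refine ⟨dBar A x, ?_, rfl⟩
  have := dBar_mem A hx
  rwa [show n - -1 - 1 = n - 1 - -1 by ring] at this

theorem dRed_sgR (x : RedBar C A.X) : sgR C A.X (dRed A x) = -dRed A (sgR C A.X x) := by
  have : (sgR C A.X).comp (dRed A) = -((dRed A).comp (sgR C A.X)) :=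
    linear_ext_of_isInternal (redBar_isInternal C A.X) fun n x hx => by
      rw [LinearMap.comp_apply, sgR_apply (dRed_mem A hx), LinearMap.neg_apply,
        LinearMap.comp_apply, sgR_apply hx, map_unit_smul, Int.negOnePow_sub, Int.negOnePow_one,
        mul_neg, mul_one, Units.neg_smul]
  exact LinearMap.congr_fun this x

theorem dBar_sgB (x : Bar C A.X) : sgB C A.X (dBar A x) = -dBar A (sgB C A.X x) := by
  have : (sgB C A.X).comp (dBar A) = -((dBar A).comp (sgB C A.X)) :=
    linear_ext_of_isInternal (bar_isInternal C A.X) fun n x hx => by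
      rw [LinearMap.comp_apply, sgB_apply (dBar_mem A hx), LinearMap.neg_apply,
        LinearMap.comp_apply, sgB_apply hx, map_unit_smul, Int.negOnePow_sub, Int.negOnePow_one,
        mul_neg, mul_one, Units.neg_smul]
  exact LinearMap.congr_fun this x

/-- The differential on products of generators. -/
theorem dRed_graftOp_dGen {k : ℕ} (t : Fin k → BTree C A.X) (c : (C.obj k).V) :
    dRed A (graftOp k (fun j => eta C A.X (Bar.cls (t j))) c) =
      ∑ i, (∑ j with j < i, (t j).deg).negOnePow •
        graftOp k (Function.update (fun j => eta C A.X (Bar.cls (t j))) i (dGen A (t i))) c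
      + (∑ j, (t j).deg).negOnePow •
        graftOp k (fun j => eta C A.X (Bar.cls (t j))) ((C.obj k).d c) := by
  let G : (C.obj k).V →ₗ[K] RedBar C A.X :=
    ∑ i, ((∑ j with j < i, (t j).deg).negOnePow : ℤ) •
        graftOp k (Function.update (fun j => eta C A.X (Bar.cls (t j))) i (dGen A (t i)))
      + ((∑ j, (t j).deg).negOnePow : ℤ) •
        (graftOp k (fun j => eta C A.X (Bar.cls (t j)))).comp (C.obj k).d
  have : (dRed A).comp (graftOp k fun j => eta C A.X (Bar.cls (t j))) = G := by
    refine linear_ext_of_isInternal (C.obj k).isDG.internal fun p c hc => ?_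
    rw [LinearMap.comp_apply, graftOp_eta, N_cls ⟨c, hc⟩, dRed_proj, dBar_cls, proj_dTree_node]
    simp only [G, LinearMap.add_apply, LinearMap.sum_apply, LinearMap.smul_apply,
      LinearMap.comp_apply, Units.smul_def]
  refine (LinearMap.congr_fun this c).trans ?_
  simp only [G, LinearMap.add_apply, LinearMap.sum_apply, LinearMap.smul_apply,
    LinearMap.comp_apply, Units.smul_def]

theorem dRed_eta_cls (t : BTree C A.X) : dRed A (eta C A.X (Bar.cls t)) = dGen A t := by
  have h := dRed_graftOp_dGen A (fun _ : Fin 1 => t) C.one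
  rw [graftOp_one, C.one_d, map_zero, smul_zero, add_zero, Fin.sum_univ_one] at h
  have e : Function.update (fun _ : Fin 1 => eta C A.X (Bar.cls t)) 0 (dGen A t) =
      fun _ => dGen A t := by
    funext j
    rw [Subsingleton.elim j 0, Function.update_self]
  rw [e, graftOp_one] at h
  simpa using h

/-- The formula on generators: up to sign, `eta` is a null-homotopy of `proj`. It drives the proofs
of d² = 0, of compatibility with `mu`, and of contractibility. -/
theorem dRed_eta (x : Bar C A.X) :
    dRed A (eta C A.X x) = eta C A.X (dBar A x) + proj C A.X (sgB C A.X x) := by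
  have : (dRed A).comp (eta C A.X) =
      (eta C A.X).comp (dBar A) + (proj C A.X).comp (sgB C A.X) := bar_ext fun t => by
    simp only [LinearMap.comp_apply, LinearMap.add_apply, dRed_eta_cls, dGen, dBar_cls,
      sgB_apply (cls_mem t), map_unit_smul]
  exact LinearMap.congr_fun this x

end

section

variable {K : Type u} [Field K] {C : DGOperad K} (A : C.Alg)

/-! ## The differential is a derivation -/

theorem sum_eq_sum_lt_add {m : ℕ} (T : Fin m → ℤ) (i : Fin m) :
    ∑ l, T l = ∑ l with l < i, T l + T i + ∑ l with i < l, T l := by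
  have : ∑ l, T l = ∑ l, ((if l < i then T l else 0) + (if l = i then T l else 0) +
      if i < l then T l else 0) := by
    refine Finset.sum_congr rfl fun l _ => ?_
    rcases lt_trichotomy l i with h | h | h
    · simp [h, h.ne, h.not_gt]
    · simp [h]
    · simp [h, h.ne', h.not_gt]
  rw [this, Finset.sum_add_distrib, Finset.sum_add_distrib, Finset.sum_ite_eq',
    if_pos (Finset.mem_univ i), Finset.sum_filter, Finset.sum_filter]

theorem rcls_eq_graftOp (y : Corolla C A.X) :
    graftOp y.k (fun j => eta C A.X (Bar.cls (y.t j))) (y.c : (C.obj y.k).V) = rcls y := by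
  rw [graftOp_eta, N_cls]
  rfl

/-- The differential of a grafting in terms of generators, one tree at a time. -/
theorem dRed_graftOp_rcls {m : ℕ} (y : Fin m → Corolla C A.X) (x : (C.obj m).V) :
    dRed A (graftOp m (fun i => rcls (y i)) x) =
      ∑ i, (∑ j with j < i, cdeg (y j)).negOnePow •
        graftOp m (Function.update (fun i => rcls (y i)) i (dRed A (rcls (y i)))) x
      + (∑ i, cdeg (y i)).negOnePow • graftOp m (fun i => rcls (y i)) ((C.obj m).d x) := by
  let k : Fin m → ℕ := fun i => (y i).k
  let p : Fin m → ℤ := fun i => (y i).p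
  let r : ∀ i, Fin (k i) → ℤ := fun i j => ((y i).t j).deg
  let T : Fin m → ℤ := fun i => ∑ j, r i j
  let c : ∀ i, (C.obj (k i)).V := fun i => (y i).c
  let a : ∀ i, Fin (k i) → RedBar C A.X := fun i j => eta C A.X (Bar.cls ((y i).t j))
  have hc : ∀ i, c i ∈ (C.obj (k i)).gr (p i) := fun i => (y i).c.2
  have ha : ∀ i j, a i j ∈ RedBar.gr C A.X (r i j) := fun i j => eta_mem (cls_mem _)
  have hy : ∀ i, cdeg (y i) = T i + p i := fun i => rfl
  have hr : ∀ i, rcls (y i) = graftOp (k i) (a i) (c i) :=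
    fun i => (rcls_eq_graftOp A (y i)).symm
  have hda : ∀ i j, dRed A (a i j) ∈ RedBar.gr C A.X (r i j - 1) :=
    fun i j => dRed_mem A (ha i j)
  -- the differential of one factor
  have hdr : ∀ i, dRed A (rcls (y i)) = ∑ j, (∑ l with l < j, r i l).negOnePow •
      graftOp (k i) (Function.update (a i) j (dRed A (a i j))) (c i) +
      (T i).negOnePow • graftOp (k i) (a i) ((C.obj (k i)).d (c i)) := by
    intro i
    rw [hr i]
    refine (dRed_graftOp_dGen A (y i).t (c i)).trans ?_
    simp only [← dRed_eta_cls]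
    rfl
  -- the contribution of a tree
  have h1 : ∀ i (j : Fin (k i)), (shuffle p T).negOnePow •
      (∑ s with s < finSigmaFinEquiv (n := k) ⟨i, j⟩, flat r s).negOnePow •
        graftOp _ (flat (Function.update a i (Function.update (a i) j (dRed A (a i j)))))
          (C.γ k c x) =
      (∑ l with l < i, (T l + p l)).negOnePow • (∑ l with l < j, r i l).negOnePow •
        graftOp m (Function.update (fun i => rcls (y i)) i
          (graftOp (k i) (Function.update (a i) j (dRed A (a i j))) (c i))) x := by
    intro i j
    rw [graftOp_γ k (Function.update r i (Function.update (r i) j (r i j - 1))) p _ c x _ hc]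
    · have e1 : (fun l => ∑ n, Function.update r i (Function.update (r i) j (r i j - 1)) l n) =
          T - Pi.single i 1 := by
        funext l
        by_cases h : l = i
        · subst h
          rw [Function.update_self, sum_update_sub, Pi.sub_apply, Pi.single_eq_same]
          simp only [T]
          ring
        · simp [h, T]
      have e2 : (fun l => graftOp (k l)
          (Function.update a i (Function.update (a i) j (dRed A (a i j))) l) (c l)) =
          Function.update (fun i => rcls (y i)) i
            (graftOp (k i) (Function.update (a i) j (dRed A (a i j))) (c i)) := by
        funext l
        by_cases h : l = i
        · subst h; simp
        · simp [h, hr]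
      rw [e1, e2, sum_lt_flat, shuffle_sub_right, smul_smul, smul_smul, smul_smul,
        ← Int.negOnePow_add, ← Int.negOnePow_add, ← Int.negOnePow_add]
      congr 1
      refine negOnePow_congr ?_
      rw [Finset.sum_add_distrib]
      simp only [T]
      push_cast
      linear_combination ((shuffle p fun i => ∑ j, r i j : ℤ) - ∑ l with l < i, (p l : ZMod 2)) *
        (CharTwo.two_eq_zero (R := ZMod 2))
    · intro l n
      by_cases h : l = i
      · subst h
        by_cases h : n = j
        · subst h; simpa using hda l n
        · simpa [h] using ha l n
      · simpa [h] using ha l n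
  -- the contribution of a root
  have h2 : ∀ i, (shuffle p T).negOnePow • (∑ i, T i).negOnePow •
      (∑ l with l < i, p l).negOnePow •
        graftOp _ (flat a) (C.γ k (Function.update c i ((C.obj (k i)).d (c i))) x) =
      (∑ l with l < i, (T l + p l)).negOnePow • (T i).negOnePow •
        graftOp m (Function.update (fun i => rcls (y i)) i
          (graftOp (k i) (a i) ((C.obj (k i)).d (c i)))) x := by
    intro i
    rw [graftOp_γ k r (p - Pi.single i 1) a _ x ha]
    · have e2 : (fun l => graftOp (k l) (a l) (Function.update c i ((C.obj (k i)).d (c i)) l)) =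
          Function.update (fun i => rcls (y i)) i
            (graftOp (k i) (a i) ((C.obj (k i)).d (c i))) := by
        funext l
        by_cases h : l = i
        · subst h; simp
        · simp [h, hr]
      rw [e2, shuffle_sub_left, sum_eq_sum_lt_add T i, smul_smul, smul_smul, smul_smul, smul_smul,
        ← Int.negOnePow_add, ← Int.negOnePow_add, ← Int.negOnePow_add, ← Int.negOnePow_add]
      congr 1
      refine negOnePow_congr ?_
      rw [Finset.sum_add_distrib]
      simp only [T]
      push_cast
      linear_combination (shuffle p fun i => ∑ j, r i j : ℤ) *
        (CharTwo.two_eq_zero (R := ZMod 2))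
    · intro l
      by_cases h : l = i
      · subst h; simpa using (C.obj (k l)).isDG.map_gr (hc l)
      · simpa [h] using hc l
  -- By associativity a product of corollas is one product of generators, with operation γ(c; z). It
  -- can be differentiated by the formula for generators, and the summands are then regrouped by
  -- factors.
  have h3 : ∀ z, graftOp m (fun i => rcls (y i)) z =
      (shuffle p T).negOnePow • graftOp _ (flat a) (C.γ k c z) := by
    intro z
    rw [graftOp_γ k r p a c z ha hc, smul_smul, Int.units_mul_self, one_smul]
    simp only [hr]
  have h4 : dRed A (graftOp _ (flat a) (C.γ k c x)) =
      ∑ i, ∑ j, (∑ s with s < finSigmaFinEquiv (n := k) ⟨i, j⟩, flat r s).negOnePow •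
        graftOp _ (flat (Function.update a i (Function.update (a i) j (dRed A (a i j)))))
          (C.γ k c x) +
      (∑ i, T i).negOnePow • graftOp _ (flat a) ((C.obj _).d (C.γ k c x)) := by
    refine (dRed_graftOp_dGen A (flat fun i j => (y i).t j) (C.γ k c x)).trans ?_
    rw [sum_fin_sigma]
    congr 1
    · refine Finset.sum_congr rfl fun i _ => Finset.sum_congr rfl fun j _ => ?_
      rw [flat_update, ← dRed_eta_cls, flat_apply]
      rfl
    · congr 2
      exact sum_flat r
  rw [h3, map_unit_smul, h4, C.γ_d k p c x hc]
  simp only [map_add, map_sum, map_unit_smul, smul_add, Finset.smul_sum, h1, h2]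
  rw [← add_assoc, ← Finset.sum_add_distrib]
  congr 1
  · refine Finset.sum_congr rfl fun i _ => ?_
    rw [hdr, (graftOp m).map_update_add, (graftOp m).map_update_sum, LinearMap.add_apply,
      LinearMap.sum_apply, smul_add, Finset.smul_sum]
    simp only [hy]
    congr 1
    · refine Finset.sum_congr rfl fun j _ => congrArg _ ?_
      exact (update_unit_smul (evalAt (graftOp m) x) _ i _ _).symm
    · refine congrArg _ ?_
      exact (update_unit_smul (evalAt (graftOp m) x) _ i _ _).symm
  · rw [h3, smul_smul, smul_smul, smul_smul]
    congr 1
    simp only [hy]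
    rw [Finset.sum_add_distrib, Int.negOnePow_add]
    ac_rfl

end

section

variable {K : Type u} [Field K] {C : DGOperad K} (A : C.Alg)

/-- With the degrees `p` fixed, the signs are constants and both sides are multilinear in `x`, so
corollas suffice. -/
theorem dRed_graftOp {m : ℕ} (p : Fin m → ℤ) (x : Fin m → RedBar C A.X) (c : (C.obj m).V)
    (hx : ∀ i, x i ∈ RedBar.gr C A.X (p i)) :
    dRed A (graftOp m x c) =
      ∑ i, (∑ j with j < i, p j).negOnePow •
        graftOp m (Function.update x i (dRed A (x i))) c
      + (∑ i, p i).negOnePow • graftOp m x ((C.obj m).d c) := by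
  let F : MultilinearMap K (fun _ : Fin m => RedBar C A.X) (RedBar C A.X) :=
    (dRed A).compMultilinearMap (evalAt (graftOp m) c)
  let L : Fin m → Fin m → RedBar C A.X →ₗ[K] RedBar C A.X :=
    fun i j => if j = i then dRed A else LinearMap.id
  let G : MultilinearMap K (fun _ : Fin m => RedBar C A.X) (RedBar C A.X) :=
    ∑ i, ((∑ j with j < i, p j).negOnePow : ℤ) • (evalAt (graftOp m) c).compLinearMap (L i)
      + ((∑ i, p i).negOnePow : ℤ) • evalAt (graftOp m) ((C.obj m).d c)
  have hL : ∀ (x : Fin m → RedBar C A.X) i,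
      (fun j => L i j (x j)) = Function.update x i (dRed A (x i)) := by
    intro x i
    funext j
    by_cases h : j = i
    · subst h; simp [L]
    · simp [L, h]
  have hG : ∀ x, G x = ∑ i, (∑ j with j < i, p j).negOnePow •
        graftOp m (Function.update x i (dRed A (x i))) c
      + (∑ i, p i).negOnePow • graftOp m x ((C.obj m).d c) := by
    intro x
    simp only [G, _root_.add_apply, _root_.sum_apply, _root_.smul_apply,
      MultilinearMap.compLinearMap_apply, hL, evalAt_apply, Units.smul_def]
  rw [← hG]
  refine multilinear_eq_of_span (S := fun i => {x | ∃ y : Corolla C A.X, cdeg y = p i ∧ x = rcls y})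
    F G ?_ x fun i => redBar_gr_le _ (hx i)
  intro x hx
  choose y hy hx using hx
  obtain rfl : x = fun i => rcls (y i) := funext hx
  obtain rfl : (fun i => cdeg (y i)) = p := funext hy
  rw [hG]
  exact dRed_graftOp_rcls A y c

/-! ### The square of the differential -/

theorem sum_eq_zero_of_antisymm {m : ℕ} {V : Type*} [AddCommGroup V] (f : Fin m → Fin m → V)
    (h0 : ∀ i, f i i = 0) (h : ∀ i j, i < j → f i j + f j i = 0) : ∑ i, ∑ j, f i j = 0 := by
  have h1 : ∑ i, ∑ j, f i j = ∑ i, ∑ j, ((if i < j then f i j else 0) +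
      if j < i then f i j else 0) := by
    refine Finset.sum_congr rfl fun i _ => Finset.sum_congr rfl fun j _ => ?_
    rcases lt_trichotomy i j with h | h | h
    · simp [h, h.not_gt]
    · subst h; simp [h0]
    · simp [h, h.not_gt]
  simp only [Finset.sum_add_distrib] at h1
  rw [Finset.sum_comm (f := fun i j => if j < i then f i j else 0)] at h1
  simp only [← Finset.sum_add_distrib] at h1
  rw [h1]
  refine Finset.sum_eq_zero fun i _ => Finset.sum_eq_zero fun j _ => ?_
  split_ifs with hij
  · exact h i j hij
  · exact add_zero 0

/-- Terms that differentiate two different places occur in both orders. They cancel, because the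
differential applied first at the earlier place lowers by one the degree that the later one has to
pass. -/
theorem dRed_dRed_graftOp {m : ℕ} (p : Fin m → ℤ) (x : Fin m → RedBar C A.X) (c : (C.obj m).V)
    (hx : ∀ i, x i ∈ RedBar.gr C A.X (p i)) (h0 : ∀ i, dRed A (dRed A (x i)) = 0) :
    dRed A (dRed A (graftOp m x c)) = 0 := by
  have hp : ∀ i j, Function.update x i (dRed A (x i)) j ∈
      RedBar.gr C A.X ((p - Pi.single i 1 : Fin m → ℤ) j) := by
    intro i j
    by_cases h : j = i
    · subst h; simpa using dRed_mem A (hx j)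
    · simpa [h] using hx j
  have hs1 : ∀ (s : Finset (Fin m)) i, i ∈ s →
      ∑ j ∈ s, (p - Pi.single i 1 : Fin m → ℤ) j = ∑ j ∈ s, p j - 1 := by
    intro s i hi
    simp [Finset.sum_sub_distrib, Finset.sum_pi_single', hi]
  have hs2 : ∀ (s : Finset (Fin m)) i, i ∉ s →
      ∑ j ∈ s, (p - Pi.single i 1 : Fin m → ℤ) j = ∑ j ∈ s, p j := by
    intro s i hi
    simp [Finset.sum_sub_distrib, Finset.sum_pi_single', hi]
  rw [dRed_graftOp A p x c hx, map_add, map_sum, map_unit_smul, dRed_graftOp A p x _ hx]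
  simp only [map_unit_smul]
  simp only [fun i => dRed_graftOp A _ _ c (hp i), (C.obj m).isDG.d_d, map_zero, smul_zero,
    add_zero, smul_add, Finset.sum_add_distrib, Finset.smul_sum]
  rw [add_assoc]
  have e2 : (∑ i, (∑ j with j < i, p j).negOnePow •
      (∑ l, (p - Pi.single i 1 : Fin m → ℤ) l).negOnePow •
        graftOp m (Function.update x i (dRed A (x i))) ((C.obj m).d c)) +
      ∑ i, (∑ l, p l).negOnePow • (∑ j with j < i, p j).negOnePow •
        graftOp m (Function.update x i (dRed A (x i))) ((C.obj m).d c) = 0 := by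
    rw [← Finset.sum_add_distrib]
    refine Finset.sum_eq_zero fun i _ => ?_
    rw [hs1 _ _ (Finset.mem_univ i), Int.negOnePow_sub, Int.negOnePow_one, mul_neg, mul_one,
      Units.neg_smul, smul_neg, smul_comm, neg_add_cancel]
  rw [e2, add_zero]
  refine sum_eq_zero_of_antisymm _ (fun i => ?_) fun i j hij => ?_
  · rw [Function.update_self, h0, (graftOp m).map_update_zero, LinearMap.zero_apply, smul_zero,
      smul_zero]
  · rw [Function.update_of_ne hij.ne', Function.update_of_ne hij.ne,
      hs1 _ i (by simpa using hij), hs2 _ j (by simpa using hij.le),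
      Function.update_comm hij.ne, Int.negOnePow_sub, Int.negOnePow_one, mul_neg, mul_one,
      Units.neg_smul, smul_neg, smul_comm, neg_add_cancel]

/-- On a generator the contracted edge and the contracted bush contribute the same term with
opposite signs, by `sgR_proj`. The general case follows from the derivation formula and `θ_d`. -/
theorem mu_dRed (z : RedBar C A.X) : mu A (dRed A z) = A.X.d (mu A z) := by
  have h : ∀ t, mu A (dGen A t) = A.X.d t.val := by
    intro t
    have e : mu A (dRed A (eta C A.X (Bar.cls t))) = A.X.d t.val := by
      rw [dRed_eta, map_add, mu_eta, val_dBar, sgR_proj, map_neg, neg_add_cancel_right, val_cls]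
    rwa [dRed_eta_cls] at e
  have : (mu A).comp (dRed A) = A.X.d.comp (mu A) := redBar_ext fun y => by
    rw [LinearMap.comp_apply, LinearMap.comp_apply, ← rcls_eq_graftOp, dRed_graftOp_dGen,
      map_add, map_sum, map_unit_smul]
    simp only [map_unit_smul, mu_graftOp, mu_eta, val_cls]
    rw [A.str.θ_d (fun j => (y.t j).deg) _ _ fun j => (y.t j).val_mem]
    congr 1
    refine Finset.sum_congr rfl fun i _ => ?_
    congr 2
    refine congrArg _ ?_
    funext j
    by_cases hj : j = i
    · subst hj; simp [h]
    · simp [hj, mu_eta, val_cls]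
  exact LinearMap.congr_fun this z

/-- The leaf component of d² always vanishes, since `mu` commutes with the differentials and `sgR`
anticommutes with them. For the other component, induction on the tree gives d² = 0 on each
generator `eta` (t i), and `dRed_dRed_graftOp` passes to their product. -/
theorem dBar_dBar (x : Bar C A.X) : dBar A (dBar A x) = 0 := by
  have key : ∀ x, dRed A (dRed A (proj C A.X x)) = 0 → dBar A (dBar A x) = 0 := by
    intro x h
    refine bar_eq (by rwa [map_zero]) ?_
    rw [val_dBar, val_dBar, map_add, A.X.isDG.d_d, zero_add, ← mu_dRed, ← dRed_proj,
      dRed_sgR, map_neg, add_neg_cancel, map_zero]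
  have : (dBar A).comp (dBar A) = 0 := bar_ext fun t => by
    change dBar A (dBar A (Bar.cls t)) = 0
    induction t with
    | leaf p a => exact key _ (by rw [proj_leaf, map_zero, map_zero])
    | node k p c t ih =>
      refine key _ ?_
      rw [← N_cls, ← graftOp_eta]
      refine dRed_dRed_graftOp A (fun j => (t j).deg) _ _ (fun j => eta_mem (cls_mem (t j)))
        fun i => ?_
      rw [dRed_eta, map_add, dRed_eta, ih, map_zero, zero_add, dBar_sgB, map_neg, dRed_proj,
        neg_add_cancel]
  exact LinearMap.congr_fun this x

/-! ## Contractibility -/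

/-- The contracting homotopy `t ↦ ±(1; t)` of the augmented bar construction. -/
def homotopy : Bar C A.X →ₗ[K] Bar C A.X :=
  ((MultilinearMap.ofSubsingleton K (Bar C A.X) (Bar C A.X) (0 : Fin 1)).symm
    (evalAt (N 1) C.one)).comp (sgB C A.X)

theorem homotopy_apply (x : Bar C A.X) :
    homotopy A x = N 1 (fun _ => sgB C A.X x) C.one := rfl

theorem sgB_sgB (x : Bar C A.X) : sgB C A.X (sgB C A.X x) = x := by
  have : (sgB C A.X).comp (sgB C A.X) = LinearMap.id := bar_ext fun t => by
    rw [LinearMap.comp_apply, sgB_apply (cls_mem t), map_unit_smul, sgB_apply (cls_mem t),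
      smul_smul, Int.units_mul_self, one_smul]
    rfl
  exact LinearMap.congr_fun this x

/-- Contracting the edge above the new unit root returns the non-leaf part of `x`; if the subtree is
a leaf, contracting the bush (1; a) returns a. The remaining term vanishes since `x` is a cycle. -/
theorem dBar_homotopy {x : Bar C A.X} (h : dBar A x = 0) : dBar A (homotopy A x) = x := by
  have hp : proj C A.X (homotopy A x) = eta C A.X (sgB C A.X x) := rfl
  have hd : dBar A (sgB C A.X x) = 0 := by rw [← neg_eq_zero, ← dBar_sgB, h, map_zero]
  refine bar_eq ?_ ?_
  · rw [← dRed_proj, hp, dRed_eta, hd, map_zero, zero_add, sgB_sgB]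
  · rw [val_dBar, hp, homotopy_apply, val_node, map_zero, zero_add]
    have e : sgR C A.X (eta C A.X (sgB C A.X x)) = eta C A.X x := by
      have : (sgR C A.X).comp ((eta C A.X).comp (sgB C A.X)) = eta C A.X := bar_ext fun t => by
        rw [LinearMap.comp_apply, LinearMap.comp_apply, sgB_apply (cls_mem t), map_unit_smul,
          map_unit_smul, sgR_apply (eta_mem (cls_mem t)), smul_smul, Int.units_mul_self, one_smul]
      exact LinearMap.congr_fun this x
    rw [e, mu_eta]

end

section

/-! ## Naturality -/

section map

variable {K : Type u} [Field K] {C : DGOperad K} {X Y : DGMod K} (f : X.Hom Y)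

theorem deg_map (t : BTree C X) : (t.map f).deg = t.deg := by
  induction t with
  | leaf p a => rfl
  | node k p c t ih => simp only [BTree.map, BTree.deg, ih]

theorem val_map (t : BTree C X) : (t.map f).val = f.lin t.val := by
  cases t with
  | leaf p a => rfl
  | node k p c t => exact (map_zero _).symm

theorem exists_mapBar (C : DGOperad K) :
    ∃ G : Bar C X →ₗ[K] Bar C Y, ∀ t : BTree C X, G (Bar.cls t) = Bar.cls (t.map f) := by
  refine exists_bar_lift _ (fun p a b => ?_) (fun p r a => ?_)
    (fun _ _ _ _ _ => cls_node_add _ _ _ _ _) (fun _ _ _ _ _ => cls_node_smul _ _ _ _ _)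
    (fun k p σ c t => ?_) (fun k p c t i x _ h => ?_)
  · simp only [BTree.map, ← cls_leaf_add]
    congr 2
    exact Subtype.ext (map_add _ _ _)
  · simp only [BTree.map, ← cls_leaf_smul]
    congr 2
    exact Subtype.ext (map_smul _ _ _)
  · simp only [BTree.map, cls_perm, deg_map]
  · have e : (fun u => Bar.cls (BTree.map f (.node k p c (Function.update t i u)))) =
        (evalAt (N k) (c : (C.obj k).V)).toLinearMap (fun j => Bar.cls ((t j).map f)) i ∘
          fun u => Bar.cls (u.map f) := by
      funext u
      rw [BTree.map, ← N_cls, show (fun j => Bar.cls ((Function.update t i u j).map f)) =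
        Function.update (fun j => Bar.cls ((t j).map f)) i (Bar.cls (u.map f)) from
        funext fun j => Function.apply_update (fun _ v => Bar.cls (v.map f)) t i u j]
      rfl
    rw [e, ← Finsupp.apply_linearCombination, h, map_zero]

/-- A chain map applied to the decorations of all leaves. -/
def mapBar (C : DGOperad K) : Bar C X →ₗ[K] Bar C Y := (exists_mapBar f C).choose

theorem mapBar_cls (t : BTree C X) : mapBar f C (Bar.cls t) = Bar.cls (t.map f) :=
  (exists_mapBar f C).choose_spec t

theorem mapBar_mem {n : ℤ} {x : Bar C X} (h : x ∈ Bar.gr C X n) :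
    mapBar f C x ∈ Bar.gr C Y n := by
  have : Bar.gr C X n ≤ (Bar.gr C Y n).comap (mapBar f C) := by
    refine Submodule.span_le.2 ?_
    rintro _ ⟨t, rfl, rfl⟩
    rw [SetLike.mem_coe, Submodule.mem_comap, mapBar_cls, ← deg_map f t]
    exact cls_mem _
  exact this h

theorem mapBar_N {k : ℕ} (x : Fin k → Bar C X) (c : (C.obj k).V) :
    mapBar f C (N k x c) = N k (fun i => mapBar f C (x i)) c := by
  have h : ∀ t : Fin k → BTree C X, (mapBar f C).comp (N k fun i => Bar.cls (t i)) =
      N k fun i => Bar.cls ((t i).map f) := fun t =>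
    linear_ext_of_isInternal (C.obj k).isDG.internal fun p c hc => by
      rw [LinearMap.comp_apply, N_cls ⟨c, hc⟩, N_cls ⟨c, hc⟩, mapBar_cls]
      rfl
  let F : MultilinearMap K (fun _ : Fin k => Bar C X) (Bar C Y) :=
    (mapBar f C).compMultilinearMap (evalAt (N k) c)
  let G : MultilinearMap K (fun _ : Fin k => Bar C X) (Bar C Y) :=
    (evalAt (N (C := C) (X := Y) k) c).compLinearMap fun _ => mapBar f C
  have : F = G := by
    refine multilinear_ext_of_span (S := fun _ => Set.range (Bar.cls (C := C) (X := X)))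
      (fun _ => span_cls (C := C) (X := X)) F G fun x hx => ?_
    choose t ht using hx
    obtain rfl : (fun i => Bar.cls (t i)) = x := funext ht
    change mapBar f C (N k (fun i => Bar.cls (t i)) c) =
      N k (fun i => mapBar f C (Bar.cls (t i))) c
    simp only [mapBar_cls]
    exact LinearMap.congr_fun (h t) c
  exact congrArg (fun F => F x) this

theorem val_mapBar (x : Bar C X) : val C Y (mapBar f C x) = f.lin (val C X x) := by
  have : (val C Y).comp (mapBar f C) = f.lin.comp (val C X) := bar_ext fun t => by
    rw [LinearMap.comp_apply, LinearMap.comp_apply, mapBar_cls, val_cls, val_cls, val_map]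
  exact LinearMap.congr_fun this x

theorem sgB_mapBar (x : Bar C X) : sgB C Y (mapBar f C x) = mapBar f C (sgB C X x) := by
  have : (sgB C Y).comp (mapBar f C) = (mapBar f C).comp (sgB C X) := bar_ext fun t => by
    rw [LinearMap.comp_apply, LinearMap.comp_apply, sgB_apply (cls_mem t),
      sgB_apply (mapBar_mem f (cls_mem t)), map_unit_smul]
  exact LinearMap.congr_fun this x

theorem leaves_le_comap_mapBar : Bar.leaves C X ≤ (Bar.leaves C Y).comap (mapBar f C) := by
  refine Submodule.span_le.2 ?_
  rintro _ ⟨p, a, rfl⟩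
  rw [SetLike.mem_coe, Submodule.mem_comap, mapBar_cls]
  exact Submodule.subset_span ⟨p, _, rfl⟩

/-- The map induced by a chain map on the bar construction. -/
def mapRed (C : DGOperad K) : RedBar C X →ₗ[K] RedBar C Y :=
  (Bar.leaves C X).mapQ (Bar.leaves C Y) (mapBar f C) (leaves_le_comap_mapBar f)

theorem mapRed_proj (x : Bar C X) : mapRed f C (proj C X x) = proj C Y (mapBar f C x) := rfl

theorem mapRed_rcls (y : Corolla C X) : mapRed f C (rcls y) = rcls (y.map f) :=
  congrArg (proj C Y) (mapBar_cls f y.tree)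

theorem mapRed_mem {n : ℤ} {x : RedBar C X} (h : x ∈ RedBar.gr C X n) :
    mapRed f C x ∈ RedBar.gr C Y n := by
  obtain ⟨x, hx, rfl⟩ := h
  exact ⟨mapBar f C x, mapBar_mem f hx, rfl⟩

theorem sgR_mapRed (x : RedBar C X) : sgR C Y (mapRed f C x) = mapRed f C (sgR C X x) := by
  obtain ⟨x, rfl⟩ := (Bar.leaves C X).mkQ_surjective x
  rw [sgR_proj, mapRed_proj, sgR_proj, sgB_mapBar, map_neg, mapRed_proj]

theorem mapRed_eta (x : Bar C X) : mapRed f C (eta C X x) = eta C Y (mapBar f C x) := by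
  rw [eta_apply, eta_apply, mapRed_proj, mapBar_N]

theorem mapRed_graftOp {m : ℕ} (x : Fin m → RedBar C X) (c : (C.obj m).V) :
    mapRed f C (graftOp m x c) = graftOp m (fun i => mapRed f C (x i)) c := by
  let F : MultilinearMap K (fun _ : Fin m => RedBar C X) (RedBar C Y) :=
    (mapRed f C).compMultilinearMap (evalAt (graftOp m) c)
  let G : MultilinearMap K (fun _ : Fin m => RedBar C X) (RedBar C Y) :=
    (evalAt (graftOp (C := C) (X := Y) m) c).compLinearMap fun _ => mapRed f C
  have : F = G := by
    refine multilinear_ext_of_span (S := fun _ => Set.range (rcls (C := C) (X := X)))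
      (fun _ => span_rcls (C := C) (X := X)) F G fun x hx => ?_
    choose y hy using hx
    obtain rfl : (fun i => rcls (y i)) = x := funext hy
    change mapRed f C (graftOp m (fun i => rcls (y i)) c) =
      graftOp m (fun i => mapRed f C (rcls (y i))) c
    simp only [mapRed_rcls]
    rw [graftOp_rcls, graftOp_rcls, graftFun_apply, graftFun_apply, map_unit_smul, mapRed_proj,
      mapBar_N]
    have e : (fun s => mapBar f C (flat (fun i j => Bar.cls ((y i).t j)) s)) =
        flat (fun i j => Bar.cls (((y i).map f).t j)) := funext fun s => mapBar_cls f _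
    rw [e]
    congr 2
    exact congrArg _ (funext fun i => Finset.sum_congr rfl fun j _ => (deg_map f _).symm)
  exact congrArg (fun F => F x) this

end map

section alg

variable {K : Type u} [Field K] {C : DGOperad K} {A A' : C.Alg} (f : A.X.Hom A'.X)

theorem mu_mapRed (hf : DGOperad.IsAlgHom A.str A'.str f) (z : RedBar C A.X) :
    mu A' (mapRed f C z) = f.lin (mu A z) := by
  have : (mu A').comp (mapRed f C) = f.lin.comp (mu A) := redBar_ext fun y => by
    rw [LinearMap.comp_apply, LinearMap.comp_apply, mapRed_rcls, mu_rcls, mu_rcls, hf]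
    exact congrArg (fun a => A'.str.θ y.k a _) (funext fun i => val_map f _)
  exact LinearMap.congr_fun this z

/-- The leaf component is compatibility of `mu` with `f`. The other one is an induction on trees:
the hypothesis handles the generators, and the derivation formula their products. -/
theorem dBar_mapBar (hf : DGOperad.IsAlgHom A.str A'.str f) (x : Bar C A.X) :
    dBar A' (mapBar f C x) = mapBar f C (dBar A x) := by
  have hval : ∀ x, val C A'.X (dBar A' (mapBar f C x)) = val C A'.X (mapBar f C (dBar A x)) := by
    intro x
    rw [val_mapBar, val_dBar, val_dBar, val_mapBar, ← mapRed_proj, sgR_mapRed, mu_mapRed f hf,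
      map_add, f.comm]
  have : (dBar A').comp (mapBar f C) = (mapBar f C).comp (dBar A) := bar_ext fun t => by
    change dBar A' (mapBar f C (Bar.cls t)) = mapBar f C (dBar A (Bar.cls t))
    induction t with
    | leaf p a =>
      refine bar_eq ?_ (hval _)
      rw [← dRed_proj, ← mapRed_proj, ← mapRed_proj, ← dRed_proj, proj_leaf, map_zero, map_zero,
        map_zero, map_zero]
    | node k p c t ih =>
      refine bar_eq ?_ (hval _)
      have hg : ∀ i, mapRed f C (dGen A (t i)) = dGen A' ((t i).map f) := fun i => by
        rw [← dRed_eta_cls, ← dRed_eta_cls, ← mapBar_cls, dRed_eta, dRed_eta, map_add, mapRed_eta,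
          ih, sgB_mapBar, mapRed_proj]
      rw [← dRed_proj, ← mapRed_proj, ← mapRed_proj, ← dRed_proj, ← N_cls, ← graftOp_eta,
        dRed_graftOp_dGen, mapRed_graftOp]
      simp only [mapRed_eta, mapBar_cls]
      rw [dRed_graftOp_dGen, map_add, map_sum]
      simp only [map_unit_smul, mapRed_graftOp, mapRed_eta, mapBar_cls, deg_map]
      congr 1
      refine Finset.sum_congr rfl fun i _ => ?_
      congr 2
      refine congrArg _ (funext fun j => ?_)
      rw [Function.apply_update (fun _ => mapRed f C), hg]
      simp only [mapRed_eta, mapBar_cls]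
  exact LinearMap.congr_fun this x

theorem dRed_mapRed (hf : DGOperad.IsAlgHom A.str A'.str f) (x : RedBar C A.X) :
    dRed A' (mapRed f C x) = mapRed f C (dRed A x) := by
  obtain ⟨x, rfl⟩ := (Bar.leaves C A.X).mkQ_surjective x
  rw [mapRed_proj, dRed_proj, dBar_mapBar f hf, ← mapRed_proj, dRed_proj]

end alg

end

section

variable {K : Type u} [Field K] {C : DGOperad K} (A : C.Alg)

/-! ## Assembling the structure -/

theorem dBar_isDG : IsDG (Bar.gr C A.X) (dBar A) where
  internal := bar_isInternal C A.X
  map_gr := dBar_mem A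
  d_d := dBar_dBar A

/-- The augmented bar construction. -/
def augBar : AugBar A := ⟨dBar A, dBar_cls A, dBar_isDG A⟩

theorem mu_mem {n : ℤ} {z : RedBar C A.X} (h : z ∈ RedBar.gr C A.X n) : mu A z ∈ A.X.gr n := by
  have hle : Submodule.span K {x | ∃ y : Corolla C A.X, cdeg y = n ∧ x = rcls y} ≤
      (A.X.gr n).comap (mu A) := by
    refine Submodule.span_le.2 ?_
    rintro _ ⟨y, rfl, rfl⟩
    rw [SetLike.mem_coe, Submodule.mem_comap, mu_rcls]
    exact A.str.θ_mem _ _ _ _ (fun i => (y.t i).val_mem) y.c.2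
  exact hle (redBar_gr_le n h)

/-- The projection to the algebra, as a chain map. -/
def muHom : (augBar A).B.Hom A.X where
  lin := mu A
  map_gr := mu_mem A
  comm := mu_dRed A

/-- The algebra structure given by grafting. -/
def graftStr : C.AlgStr (augBar A).B where
  θ := graftOp
  θ_mem := graftOp_mem
  θ_d p a c ha := dRed_graftOp A p a c ha
  θ_one := graftOp_one
  θ_γ := graftOp_γ
  θ_act := graftOp_act

open Classical in
theorem mu_rcls_eq_ite (y : Corolla C A.X) :
    mu A (rcls y) = if y.IsBush then A.str.θ y.k (fun i => (y.t i).val) y.c else 0 := by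
  rw [mu_rcls]
  split_ifs with h
  · rfl
  · obtain ⟨i, hi⟩ := not_forall.1 h
    have hv : (y.t i).val = 0 := by
      generalize y.t i = t at hi
      cases t with
      | leaf p a => exact absurd trivial hi
      | node k p c t => rfl
    rw [(A.str.θ y.k).map_coord_zero i hv, LinearMap.zero_apply]

/-! ### The projection in homology -/

theorem sgR_sgR (x : RedBar C A.X) : sgR C A.X (sgR C A.X x) = x := by
  obtain ⟨x, rfl⟩ := (Bar.leaves C A.X).mkQ_surjective x
  rw [sgR_proj, map_neg, sgR_proj, neg_neg, sgB_sgB]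

/-- Injectivity: the pair (± `z`, -`a`) is a cycle of the cone, hence a boundary, and its component
in the bar construction exhibits `z` as one. -/
theorem exists_boundary {z : RedBar C A.X} (hz : dRed A z = 0) {a : A.X.V}
    (ha : mu A z = A.X.d a) : ∃ w, dRed A w = z := by
  obtain ⟨x, hx⟩ := (Bar.leaves C A.X).mkQ_surjective (sgR C A.X z)
  let t := x - incl C A.X (val C A.X x + a)
  have hp : proj C A.X t = sgR C A.X z := by rw [map_sub, proj_incl, sub_zero, hx]
  have hv : val C A.X t = -a := by rw [map_sub, val_incl, sub_add_cancel_left]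
  have hd : dBar A t = 0 := by
    refine bar_eq ?_ ?_
    · rw [← dRed_proj, hp, ← neg_eq_iff_eq_neg.2 (dRed_sgR A z), hz, map_zero, map_zero, neg_zero]
    · rw [val_dBar, hp, hv, sgR_sgR, ha, map_neg, neg_add_cancel, map_zero]
  refine ⟨-sgR C A.X (proj C A.X (homotopy A t)), ?_⟩
  rw [map_neg, ← dRed_sgR, dRed_proj, dBar_homotopy A hd, hp, sgR_sgR]

/-- Surjectivity: the leaf `a` is a cycle of the cone, hence the boundary of some w. The components
of w in the bar construction and in the algebra give `z`, up to sign, and the correcting element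
`b`. -/
theorem exists_cycle {a : A.X.V} (ha : A.X.d a = 0) :
    ∃ z, dRed A z = 0 ∧ ∃ b, a = A.X.d b + mu A z := by
  have hd : dBar A (incl C A.X a) = 0 := by rw [dBar_incl, ha, map_zero]
  have hw := dBar_homotopy A hd
  refine ⟨sgR C A.X (proj C A.X (homotopy A (incl C A.X a))), ?_,
    val C A.X (homotopy A (incl C A.X a)), ?_⟩
  · rw [← neg_eq_zero, ← dRed_sgR, dRed_proj, hw, proj_incl, map_zero]
  · rw [← val_dBar, hw, val_incl]

theorem muHom_isQuasiIso : (muHom A).IsQuasiIso := by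
  constructor
  · rw [← LinearMap.ker_eq_bot, LinearMap.ker_eq_bot']
    intro z hz
    obtain ⟨⟨z, hzc⟩, rfl⟩ := Submodule.mkQ_surjective _ z
    obtain ⟨a, ha⟩ := (Submodule.Quotient.mk_eq_zero _).1 hz
    obtain ⟨w, hw⟩ := exists_boundary A hzc ha.symm
    exact (Submodule.Quotient.mk_eq_zero _).2 ⟨w, hw⟩
  · intro a
    obtain ⟨⟨a, hac⟩, rfl⟩ := Submodule.mkQ_surjective _ a
    obtain ⟨z, hz, b, hb⟩ := exists_cycle A hac
    refine ⟨Submodule.Quotient.mk ⟨z, hz⟩, (Submodule.Quotient.eq _).2 ⟨-b, ?_⟩⟩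
    change A.X.d (-b) = mu A z - a
    rw [hb, map_neg, sub_add_cancel_right]

/-- The map of bar constructions induced by a map of algebras, as a chain map. -/
def mapHom {A A' : C.Alg} (f : A.X.Hom A'.X) (hf : DGOperad.IsAlgHom A.str A'.str f) :
    (augBar A).B.Hom (augBar A').B where
  lin := mapRed f C
  map_gr := mapRed_mem f
  comm x := (dRed_mapRed f hf x).symm

end

end OperadBar

end

open Classical in
theorem mainTheorem3 {K : Type u} [Field K] (C : DGOperad K) :
    ∃ (D : ∀ A : C.Alg, AugBar A)
      (μ : ∀ A : C.Alg, (D A).B.Hom A.X)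
      (S : ∀ A : C.Alg, C.AlgStr (D A).B),
      -- `μ` is the algebra operation on bushes, and zero on all other trees
      (∀ (A : C.Alg) (y : Corolla C A.X),
        (μ A).lin ((D A).cls y) =
          if y.IsBush then A.str.θ y.k (fun i => (y.t i).val) y.c else 0) ∧
      -- it is an equivalence when the operad is cofibrant
      (C.SigmaCofibrant → ∀ A : C.Alg, (μ A).IsQuasiIso) ∧
      -- the algebra structure is given by grafting of trees
      (∀ (A : C.Alg) (m : ℕ) (y : Fin m → Corolla C A.X) (q : ℤ) (x : (C.obj m).gr q),
        (S A).θ m (fun i => (D A).cls (y i)) x =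
          (shuffle (fun i => (y i).p) (fun i => ∑ j, ((y i).t j).deg)).negOnePow •
            (D A).cls (Corolla.graft y x)) ∧
      -- `μ` is a map of algebras
      (∀ A : C.Alg, DGOperad.IsAlgHom (S A) A.str (μ A)) ∧
      -- everything is natural in the algebra
      (∀ (A A' : C.Alg) (f : A.X.Hom A'.X), DGOperad.IsAlgHom A.str A'.str f →
        ∃ F : (D A).B.Hom (D A').B,
          (∀ y : Corolla C A.X, F.lin ((D A).cls y) = (D A').cls (y.map f)) ∧
          DGOperad.IsAlgHom (S A) (S A') F ∧
          ∀ z, f.lin ((μ A).lin z) = (μ A').lin (F.lin z)) := by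
  refine ⟨OperadBar.augBar, OperadBar.muHom, OperadBar.graftStr, OperadBar.mu_rcls_eq_ite,
    fun _ => OperadBar.muHom_isQuasiIso, fun A m y q x => ?_,
    fun A n a c => OperadBar.mu_graftOp A a c, fun A A' f hf => ⟨OperadBar.mapHom f hf,
      OperadBar.mapRed_rcls f, fun n a c => OperadBar.mapRed_graftOp f a c,
      fun z => (OperadBar.mu_mapRed f hf z).symm⟩⟩
  exact (LinearMap.congr_fun (OperadBar.graftOp_rcls y) _).trans
    (OperadBar.graftFun_apply_of_mem y x)
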